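/- **Setting.** Let $D_0$, $D_\infty$ be the closed inner and outer disks of the unit circle $|z|=1$ on the Riemann sphere, let $\mathcal H(D_0)$, $\mathcal H(D_\infty)$ be the spaces of functions holomorphic on a neighbourhood of $D_0$, $D_\infty$, and let $\dot{\mathcal H}(D_0)$, $\dot{\mathcal H}(D_\infty)$ be the larger spaces in which a simple pole at $0$, respectively $\infty$, is allowed. Put $$M=\{(\lambda,\bar\lambda)\in\dot{\mathcal H}(D_\infty)\oplus\dot{\mathcal H}(D_0)\;:\;\lambda(z)=z+u_0+u_{-1}z^{-1}+\cdots\},$$ $TM=\mathcal H(D_\infty)\oplus\dot{\mathcal H}(D_0)$, $T^*M=\dot{\mathcal H}(D_0)\oplus\mathcal H(D_\infty)$ (the bar is not complex conjugation). Let $\mathcal LM$ be the loop space of smooth maps $x\mapsto(\lambda(\cdot,x),\bar\lambda(\cdot,x))$ from $S^1=\mathbb R/2\pi\mathbb Z$ to $M$. Tangent vectors $\hat\alpha=(\alpha,\bar\alpha)$ and one-forms $\hat\omega=(\omega,\bar\omega)$ on $\mathcal LM$ are smooth maps from $S^1$ to $TM$ and $T^*M$, paired by $$\langle\hat\omega,\hat\alpha\rangle=\frac1{2\pi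 i}\oint_{S^1}\oint_{|z|=1}[\alpha\omega+\bar\alpha\bar\omega]\,dz\,dx .$$ For functions of $z$ and $x$ put $\{f,g\}=z f_z g_x-z g_z f_x$. For $f=\sum_n f_nz^n$ put $(f)_{\ge k}=\sum_{n\ge k}f_nz^n$, and similarly for $\le k$, $>k$; $(f)_+=(f)_{\ge0}$, $(f)_-=(f)_{\le-1}$. A functional $F:\mathcal LM\to\mathbb C$ *has a differential* if there is a one-form $dF$ on $\mathcal LM$, depending smoothly on the point (smooth finite-dimensional families of loops are mapped to smooth families of one-forms), such that $\frac{d}{dt}F(\gamma_t)=\langle dF(\gamma_t),\partial_t\gamma_t\rangle$ along every smooth curve $\gamma_t$ in $\mathcal LM$. A *local functional* is $F=\oint_{S^1}f(x,\gamma,\gamma_x,\dots,\gamma^{(k)})\,dx$ with a density $f$ that is smooth in $x$ and in the $k$-jet, $2\pi$-periodic in $x$, and whose partial differentials with respect to $\gamma,\gamma_x,\dots,\gamma^{(k)}$ are smooth functions with values in $T^*M$. A *Poisson structure* on $\mathcal LM$ is a linear map $P$ from the cotangent to the tangent space at each point of $\mathcal LM$ such that, with $\{F,G\}=\langle dF,P(dG)\rangle$,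 brackets of functionals having a differential again have a differential, and the bracket of such functionals is skew-symmetric and satisfies the Jacobi identity. Two Poisson structures are *compatible* if all their linear combinations are Poisson structures. **Proposition.** Every local functional has a differential. The formulas $$P_1(\hat\omega)=\big(-\{\lambda,(z\omega-z\bar\omega)_-\}+(\{\lambda,z\omega\}+\{\bar\lambda,z\bar\omega\})_{\le0},\ \{\bar\lambda,(z\omega-z\bar\omega)_+\}+(\{\lambda,z\omega\}+\{\bar\lambda,z\bar\omega\})_{>0}\big),$$ $$P_2(\hat\omega)=\big(\{\lambda,(z\lambda\omega+z\bar\lambda\bar\omega)_-\}-\lambda(\{\lambda,z\omega\}+\{\bar\lambda,z\bar\omega\})_{\le0}+z\lambda'\varphi_x,\ -\{\bar\lambda,(z\bar\lambda\bar\omega+z\lambda\omega)_+\}+\bar\lambda(\{\lambda,z\omega\}+\{\bar\lambda,z\bar\omega\})_{>0}+z\bar\lambda'\varphi_x\big),$$ where $'=\partial/\partial z$ and $\varphi=\frac1{2\pi i}\oint_{|z|=1}(z\lambda'\omega+z\bar\lambda'\bar\omega)\,dz$, define a pair of compatible Poisson structures on $\mathcal LM$, with brackets $\{\cdot,\cdot\}_1$,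 $\{\cdot,\cdot\}_2$. The functionals $$H_n=-\frac1{2\pi i}\oint_{S^1}\oint_{|z|=1}\frac{\lambda^{n+1}}{n+1}\frac{dz}z\,dx,\qquad \bar H_n=-\frac1{2\pi i}\oint_{S^1}\oint_{|z|=1}\frac{\bar\lambda^{n+1}}{n+1}\frac{dz}z\,dx\qquad(n\ge0)$$ are local. For every $n\ge1$ the dispersionless 2D Toda flows $$\frac{\partial\lambda}{\partial s_n}=\{(\lambda^n)_+,\lambda\},\quad\frac{\partial\bar\lambda}{\partial s_n}=\{(\lambda^n)_+,\bar\lambda\},\qquad\frac{\partial\lambda}{\partial\bar s_n}=\{(\bar\lambda^n)_-,\lambda\},\quad\frac{\partial\bar\lambda}{\partial\bar s_n}=\{(\bar\lambda^n)_-,\bar\lambda\}$$ are vector fields on $\mathcal LM$ that are Hamiltonian with respect to both Poisson structures: $$\frac{\partial}{\partial s_n}=P_1(dH_n)=-P_2(dH_{n-1}),\qquad\frac{\partial}{\partial\bar s_n}=P_1(d\bar H_n)=P_2(d\bar H_{n-1}),$$ that is, on every functional that has a differential, $$\frac{\partial}{\partial s_n}\,\cdot=\{\cdot,H_n\}_1=-\{\cdot,H_{n-1}\}_2,\qquad\frac{\partial}{\partial\bar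 s_n}\,\cdot=\{\cdot,\bar H_n\}_1=\{\cdot,\bar H_{n-1}\}_2 .$$ -/

import Mathlib

noncomputable section

namespace Toda

/-! ### Functions on the unit circle

A function holomorphic in a neighbourhood of the circle `|z| = 1` is determined by its values on
the circle, so elements of the function spaces below are represented by functions on `Circle`. -/

/-- Pairs `(a(z), b(z))` of functions on the circle `|z| = 1`. -/
abbrev Pair : Type := (Circle → ℂ) × (Circle → ℂ)

section Spaces

variable {E : Type} [NormedAddCommGroup E] [NormedSpace ℝ E]

/-- `a : E → H(D₀)` is a smooth map with values in the space `H(D₀)` of functions holomorphic on a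
neighbourhood of the closed unit disk: `a p z = ∑ cₙ(p) zⁿ` with smooth coefficients, each of whose
derivatives is, locally uniformly in `p`, bounded by a geometric sequence of ratio `r < 1`
(for the derivative of order `0` this is holomorphy on the disk `|z| < 1 / r`). -/
def SmoothH0 (a : E → Circle → ℂ) : Prop :=
  ∃ c : ℕ → E → ℂ,
    (∀ n, ContDiff ℝ (⊤ : ℕ∞) (c n)) ∧
    (∀ K : Set E, IsCompact K → ∀ s : ℕ, ∃ r : ℝ, 0 < r ∧ r < 1 ∧ ∃ C : ℝ,
      ∀ n, ∀ p ∈ K, ‖iteratedFDeriv ℝ s (c n) p‖ ≤ C * r ^ n) ∧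
    ∀ p (z : Circle), HasSum (fun n => c n p * (z : ℂ) ^ n) (a p z)

/-- Smooth maps with values in `H(D_∞)`, the functions holomorphic on a neighbourhood of the outer
disk `|z| ≥ 1`, `z = ∞` included; they are the functions `f(1/z)` with `f` in `H(D₀)`. -/
def SmoothHInf (a : E → Circle → ℂ) : Prop :=
  SmoothH0 fun p z => a p z⁻¹

/-- Smooth maps with values in `M`: pairs `(λ, λ̄)`, where `λ(z) = z + u₀ + u₋₁ / z + ⋯` is
holomorphic on the outer disk except for the simple pole at infinity, and
`λ̄(z) = ū₋₁ / z + ū₀ + ū₁ z + ⋯` on the inner disk except for at most a simple pole at `0`. -/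
def SmoothM (γ : E → Pair) : Prop :=
  SmoothHInf (fun p z => (γ p).1 z - z) ∧ SmoothH0 (fun p z => (z : ℂ) * (γ p).2 z)

/-- Smooth maps with values in `TM = H(D_∞) ⊕ Ḣ(D₀)`; the dot allows a simple pole. -/
def SmoothT (α : E → Pair) : Prop :=
  SmoothHInf (fun p => (α p).1) ∧ SmoothH0 (fun p z => (z : ℂ) * (α p).2 z)

/-- Smooth maps with values in `T*M = Ḣ(D₀) ⊕ H(D_∞)`; the dot allows a simple pole. -/
def SmoothTstar (ω : E → Pair) : Prop :=
  SmoothH0 (fun p z => (z : ℂ) * (ω p).1 z) ∧ SmoothHInf (fun p => (ω p).2)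

/-- Smooth families of points of the loop space, parametrized by `E`. -/
def LoopFamily (γ : E → ℝ → Pair) : Prop :=
  SmoothM (fun p : E × ℝ => γ p.1 p.2) ∧ ∀ t, Function.Periodic (γ t) (2 * Real.pi)

/-- Smooth families of one-forms on the loop space, parametrized by `E`. -/
def FormFamily (ω : E → ℝ → Pair) : Prop :=
  SmoothTstar (fun p : E × ℝ => ω p.1 p.2) ∧ ∀ t, Function.Periodic (ω t) (2 * Real.pi)

end Spaces

/-- The loop space `LM` of smooth maps from `S¹ = ℝ / 2πℤ` to `M`. -/
def LM : Set (ℝ → Pair) := {γ | SmoothM γ ∧ Function.Periodic γ (2 * Real.pi)}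

/-- The tangent space to `LM` (at any point): smooth maps from `S¹` to `TM`. -/
def TLM : Set (ℝ → Pair) := {α | SmoothT α ∧ Function.Periodic α (2 * Real.pi)}

/-- The cotangent space to `LM` (at any point): smooth maps from `S¹` to `T*M`. -/
def TstarLM : Set (ℝ → Pair) := {ω | SmoothTstar ω ∧ Function.Periodic ω (2 * Real.pi)}

/-! ### Calculus on the circle and on the cylinder -/

/-- The contour integral `∮ f(z) dz` over the positively oriented circle `|z| = 1`. -/
def contour (f : Circle → ℂ) : ℂ :=
  ∫ θ in (0 : ℝ)..2 * Real.pi, f (Circle.exp θ) * (Complex.I * (Circle.exp θ : ℂ))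

/-- The Laurent coefficient `fₙ = (2πi)⁻¹ ∮ f(z) z^(-n-1) dz`. -/
def coeff (f : Circle → ℂ) (n : ℤ) : ℂ :=
  (2 * Real.pi * Complex.I)⁻¹ * contour fun z => f z * (z : ℂ) ^ (-n - 1)

/-- The projection `(f)_{≥ k} = ∑_{n ≥ k} fₙ zⁿ`. -/
def projGE (k : ℤ) (f : Circle → ℂ) : Circle → ℂ :=
  fun z => ∑' m : ℕ, coeff f (k + m) * (z : ℂ) ^ (k + m : ℤ)

/-- The projection `(f)_{≤ k} = ∑_{n ≤ k} fₙ zⁿ`. -/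
def projLE (k : ℤ) (f : Circle → ℂ) : Circle → ℂ :=
  fun z => ∑' m : ℕ, coeff f (k - m) * (z : ℂ) ^ (k - m : ℤ)

/-- The operator `z ∂/∂z`. Along the circle `z ∂/∂z = -i ∂/∂θ` for a function that is holomorphic
near the circle. -/
def zD (f : Circle → ℂ) : Circle → ℂ :=
  fun z => -Complex.I * deriv (fun θ : ℝ => f (Circle.exp θ * z)) 0

/-- The derivative `∂f/∂x`. -/
def dX (f : ℝ → Circle → ℂ) : ℝ → Circle → ℂ :=
  fun x z => deriv (fun y => f y z) x

/-- The bracket `{f, g} = z f_z g_x - z g_z f_x` of functions of `z` and `x`. -/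
def brack (f g : ℝ → Circle → ℂ) : ℝ → Circle → ℂ :=
  fun x z => zD (f x) z * dX g x z - zD (g x) z * dX f x z

/-- The derivative of a one-parameter family of pairs of functions, at fixed `z`. -/
def pderiv (γ : ℝ → Pair) : ℝ → Pair :=
  fun t => (fun z => deriv (fun s => (γ s).1 z) t, fun z => deriv (fun s => (γ s).2 z) t)

/-- The residue pairing `(2πi)⁻¹ ∮ (α ω + ᾱ ω̄) dz` of `T*M` with `TM`. -/
def pairing (ω α : Pair) : ℂ :=
  (2 * Real.pi * Complex.I)⁻¹ * contour fun z => α.1 z * ω.1 z + α.2 z * ω.2 z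

/-- The pairing `(2πi)⁻¹ ∮∮ (α ω + ᾱ ω̄) dz dx` of one-forms and vectors on the loop space. -/
def loopPairing (ω α : ℝ → Pair) : ℂ :=
  ∫ x in (0 : ℝ)..2 * Real.pi, pairing (ω x) (α x)

/-! ### Functionals on the loop space -/

/-- `δ` is the differential of the functional `F`: a one-form on `LM` that depends smoothly on the
point and satisfies `d/dt F(γ_t) = ⟨δ(γ_t), ∂_t γ_t⟩` along every smooth curve in `LM`.
Only the values of `F` and `δ` on `LM` matter. -/
def HasDifferential (F : (ℝ → Pair) → ℂ) (δ : (ℝ → Pair) → ℝ → Pair) : Prop :=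
  (∀ γ ∈ LM, δ γ ∈ TstarLM) ∧
  (∀ (E : Type) [NormedAddCommGroup E] [NormedSpace ℝ E] [FiniteDimensional ℝ E]
    (γ : E → ℝ → Pair), LoopFamily γ → FormFamily fun t => δ (γ t)) ∧
  ∀ γ : ℝ → ℝ → Pair, LoopFamily γ → ∀ t,
    HasDerivAt (fun s => F (γ s))
      (loopPairing (δ (γ t)) fun x => pderiv (fun s => γ s x) t) t

/-- The functionals on `LM` that possess a differential. -/
def Admissible (F : (ℝ → Pair) → ℂ) : Prop := ∃ δ, HasDifferential F δ

open Classical in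
/-- The differential of a functional (zero if there is none); on `LM` it is unique. -/
def diff (F : (ℝ → Pair) → ℂ) : (ℝ → Pair) → ℝ → Pair :=
  if h : Admissible F then h.choose else 0

section Jets

variable {E : Type} [NormedAddCommGroup E] [NormedSpace ℝ E]

/-- Smooth families of jets `(γ, γ_x, γ_xx, …)` of order `k` of maps to `M`: the zeroth entry is a
point of `M`, the others are vectors of `TM`. -/
def JetFamily {k : ℕ} (J : E → Fin (k + 1) → Pair) : Prop :=
  SmoothM (fun e => J e 0) ∧ ∀ s : Fin (k + 1), s ≠ 0 → SmoothT (fun e => J e s)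

end Jets

/-- Local functionals `F(γ) = ∮ f(x, γ, γ_x, …, γ^{(k)}) dx`. The density `f` is a smooth function
of `x` and of the jet of order `k`, and its partial differential `g s` with respect to the `s`-th
derivative of `γ` is a smooth function of the same variables with values in `T*M`. -/
def LocalFunctional (F : (ℝ → Pair) → ℂ) : Prop :=
  ∃ (k : ℕ) (f : ℝ → (Fin (k + 1) → Pair) → ℂ)
    (g : Fin (k + 1) → ℝ → (Fin (k + 1) → Pair) → Pair),
    (∀ x j, f (x + 2 * Real.pi) j = f x j) ∧
    (∀ s x j, g s (x + 2 * Real.pi) j = g s x j) ∧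
    (∀ (E : Type) [NormedAddCommGroup E] [NormedSpace ℝ E] [FiniteDimensional ℝ E]
      (ξ : E → ℝ) (J : E → Fin (k + 1) → Pair), ContDiff ℝ (⊤ : ℕ∞) ξ → JetFamily J →
        ContDiff ℝ (⊤ : ℕ∞) (fun e => f (ξ e) (J e)) ∧ ∀ s, SmoothTstar fun e => g s (ξ e) (J e)) ∧
    (∀ (x : ℝ) (J : ℝ → Fin (k + 1) → Pair), JetFamily J → ∀ t,
      HasDerivAt (fun τ => f x (J τ))
        (∑ s, pairing (g s x (J t)) (pderiv (fun τ => J τ s) t)) t) ∧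
    ∀ γ ∈ LM, F γ = ∫ x in (0 : ℝ)..2 * Real.pi, f x fun s => (pderiv^[(s : ℕ)] γ) x

/-! ### Poisson structures on the loop space -/

/-- The bracket `{F, G} = ⟨dF, P(dG)⟩` of functionals. -/
def bracket (P : (ℝ → Pair) → (ℝ → Pair) → ℝ → Pair) (F G : (ℝ → Pair) → ℂ) :
    (ℝ → Pair) → ℂ :=
  fun γ => loopPairing (diff F γ) (P γ (diff G γ))

/-- `P`, a linear map from the cotangent to the tangent space at each point of `LM`, is a Poisson
structure: brackets of functionals with a differential again have a differential, and the bracket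
is skew-symmetric and satisfies the Jacobi identity. -/
structure IsPoisson (P : (ℝ → Pair) → (ℝ → Pair) → ℝ → Pair) : Prop where
  mapsTo : ∀ γ ∈ LM, ∀ ω ∈ TstarLM, P γ ω ∈ TLM
  map_add : ∀ γ ∈ LM, ∀ ω ∈ TstarLM, ∀ η ∈ TstarLM, P γ (ω + η) = P γ ω + P γ η
  map_smul : ∀ γ ∈ LM, ∀ (c : ℂ), ∀ ω ∈ TstarLM, P γ (c • ω) = c • P γ ω
  closed : ∀ F G, Admissible F → Admissible G → Admissible (bracket P F G)
  skew : ∀ F G, Admissible F → Admissible G → ∀ γ ∈ LM, bracket P F G γ = -bracket P G F γ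
  jacobi : ∀ F G H, Admissible F → Admissible G → Admissible H → ∀ γ ∈ LM,
    bracket P (bracket P F G) H γ + bracket P (bracket P G H) F γ
      + bracket P (bracket P H F) G γ = 0

/-- Compatibility: all linear combinations are Poisson structures. -/
def Compatible (P Q : (ℝ → Pair) → (ℝ → Pair) → ℝ → Pair) : Prop :=
  ∀ a b : ℂ, IsPoisson fun γ ω => a • P γ ω + b • Q γ ω

/-- The vector field `X` on `LM` is `c` times the Hamiltonian vector field of `H`, that is
`X = c P(dH)`, and the derivative of every functional `F` along `X` is `c {F, H}`. -/
def HamiltonianFlow (P : (ℝ → Pair) → (ℝ → Pair) → ℝ → Pair) (c : ℂ)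
    (H : (ℝ → Pair) → ℂ) (X : (ℝ → Pair) → ℝ → Pair) : Prop :=
  ∀ γ ∈ LM, X γ ∈ TLM ∧ X γ = c • P γ (diff H γ) ∧
    ∀ F, Admissible F →
      HasDerivAt (fun t : ℝ => F (γ + t • X γ)) (c * bracket P F H γ) 0

/-! ### The two structures, the Toda flows and their Hamiltonians -/

/-- The first Poisson structure
`P₁(ω, ω̄) = (-{λ, (zω - zω̄)₋} + ({λ, zω} + {λ̄, zω̄})_{≤ 0},
  {λ̄, (zω - zω̄)₊} + ({λ, zω} + {λ̄, zω̄})_{> 0})`. -/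
def P₁ (γ ω : ℝ → Pair) : ℝ → Pair :=
  let l : ℝ → Circle → ℂ := fun x => (γ x).1
  let lb : ℝ → Circle → ℂ := fun x => (γ x).2
  let o : ℝ → Circle → ℂ := fun x z => (z : ℂ) * (ω x).1 z
  let ob : ℝ → Circle → ℂ := fun x z => (z : ℂ) * (ω x).2 z
  fun x =>
    (-brack l (fun y => projLE (-1) (o y - ob y)) x + projLE 0 (brack l o x + brack lb ob x),
      brack lb (fun y => projGE 0 (o y - ob y)) x + projGE 1 (brack l o x + brack lb ob x))

/-- The function `φ(x) = (2πi)⁻¹ ∮ (zλ'ω + zλ̄'ω̄) dz`. -/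
def phi (γ ω : ℝ → Pair) (x : ℝ) : ℂ :=
  (2 * Real.pi * Complex.I)⁻¹ *
    contour fun z => zD (γ x).1 z * (ω x).1 z + zD (γ x).2 z * (ω x).2 z

/-- The second Poisson structure
`P₂(ω, ω̄) = ({λ, (zλω + zλ̄ω̄)₋} - λ ({λ, zω} + {λ̄, zω̄})_{≤ 0} + zλ' φ_x,
  -{λ̄, (zλ̄ω̄ + zλω)₊} + λ̄ ({λ, zω} + {λ̄, zω̄})_{> 0} + zλ̄' φ_x)`. -/
def P₂ (γ ω : ℝ → Pair) : ℝ → Pair :=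
  let l : ℝ → Circle → ℂ := fun x => (γ x).1
  let lb : ℝ → Circle → ℂ := fun x => (γ x).2
  let o : ℝ → Circle → ℂ := fun x z => (z : ℂ) * (ω x).1 z
  let ob : ℝ → Circle → ℂ := fun x z => (z : ℂ) * (ω x).2 z
  fun x =>
    (brack l (fun y => projLE (-1) (l y * o y + lb y * ob y)) x
        - l x * projLE 0 (brack l o x + brack lb ob x)
        + fun z => zD (l x) z * deriv (phi γ ω) x,
      -brack lb (fun y => projGE 0 (lb y * ob y + l y * o y)) x
        + lb x * projGE 1 (brack l o x + brack lb ob x)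
        + fun z => zD (lb x) z * deriv (phi γ ω) x)

/-- The Toda vector field `∂/∂sₙ`: `λ ↦ {(λⁿ)₊, λ}`, `λ̄ ↦ {(λⁿ)₊, λ̄}`. -/
def flow (n : ℕ) (γ : ℝ → Pair) : ℝ → Pair :=
  let A : ℝ → Circle → ℂ := fun x => projGE 0 ((γ x).1 ^ n)
  fun x => (brack A (fun y => (γ y).1) x, brack A (fun y => (γ y).2) x)

/-- The Toda vector field `∂/∂s̄ₙ`: `λ ↦ {(λ̄ⁿ)₋, λ}`, `λ̄ ↦ {(λ̄ⁿ)₋, λ̄}`. -/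
def flowBar (n : ℕ) (γ : ℝ → Pair) : ℝ → Pair :=
  let A : ℝ → Circle → ℂ := fun x => projLE (-1) ((γ x).2 ^ n)
  fun x => (brack A (fun y => (γ y).1) x, brack A (fun y => (γ y).2) x)

/-- `Hₙ = -(2πi)⁻¹ ∮∮ λ^(n+1) / (n+1) dz/z dx`. -/
def ham (n : ℕ) (γ : ℝ → Pair) : ℂ :=
  -(2 * Real.pi * Complex.I)⁻¹ *
    ∫ x in (0 : ℝ)..2 * Real.pi, contour fun z => (γ x).1 z ^ (n + 1) / (n + 1 : ℂ) / (z : ℂ)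

/-- `H̄ₙ = -(2πi)⁻¹ ∮∮ λ̄^(n+1) / (n+1) dz/z dx`. -/
def hamBar (n : ℕ) (γ : ℝ → Pair) : ℂ :=
  -(2 * Real.pi * Complex.I)⁻¹ *
    ∫ x in (0 : ℝ)..2 * Real.pi, contour fun z => (γ x).2 z ^ (n + 1) / (n + 1 : ℂ) / (z : ℂ)

end Toda

end

/-!
Poisson structures of the dispersionless 2D Toda hierarchy, from an `R`-operator on Laurent series.

**The algebra.** Smooth families of functions of `(x, z)` that are `2π`-periodic in `x` and
holomorphic near `|z| = 1` form a commutative algebra `LF E` (`E` is the space of parameters of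
the family). It carries the commuting derivations `D = z ∂/∂z` and `X = ∂/∂x`, the derivatives in the
directions of the parameters, the projections `(·)_{≥ k}`, `(·)_{≤ k}`, and the trace
`(2πi)⁻¹ ∮∮ f dz/z dx`, which vanishes on the images of `D` and `X`. Families of loops in `M`, of
tangent vectors and of one-forms are pairs of elements of `LF E` with restrictions on the degrees in
`z`; a one-form `(ω, ω̄)` is represented by `(zω, zω̄)`, so that the pairing becomes the trace of
the product. Hence every assertion about smooth curves and families is an identity in `LF E × LF E`.

**The second structure.** On `LF E × LF E` the operator
`R(f, g) = (f₋ - f₊ + 2g₋, g₋ - g₊ - 2f₊)` solves the modified Yang–Baxter equation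
(`rOp_yangBaxter`), and `2 P₂` is the quadratic tensor
`o ↦ {L, R(L o) + 2φ} + L R*{L, o}` (`todaData_ham`), where the correction `φ` depends on `x`
only. For such a tensor, in any Poisson algebra with an invariant trace, skew-symmetry follows from
the invariance of the trace and the Jacobi identity from the Yang–Baxter equation
(`QuadraticData.tr_mul_ham_skew`, `QuadraticData.schouten`).

**The pencil.** The constants are Casimir functions of the bracket `{f, g}`, so `P₂` at
`(λ + s, λ̄ - s)` is affine in `s`, and its derivative is `-P₁` (`P1A_eq`). Hence `a P₁ + b P₂` is a
combination of `P₂` at two points of this line, and its Schouten bracket vanishes because that of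
`P₂` vanishes at all points of the line (`QuadraticData.schouten_mixed`, `pencil_schouten`).

**Functionals.** The differential of a functional is unique since the pairing is nondegenerate
(`IsCov.eq_zero`). Second derivatives are symmetric (`HasDifferential.dirB_symm`), so the bracket
`⟨dF, P(dG)⟩` has the differential `d²F(P dG) - d²G(P dF) + ⟨dF, P'(dG)⟩`
(`Admissible.hasDifferential_bracket`), where `P'` is the derivative of the tensor in the loop. In
the Jacobi identity the second derivatives cancel in pairs, and what remains is the Schouten bracket
(`bracket_jacobi`). A local functional has the Euler–Lagrange expression of its density as its
differential (`LocalFunctional.exists_hasDifferential`).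

**The flows.** `dHₙ = (-z⁻¹ (λⁿ)_{≥ 0}, 0)` and `dH̄ₙ = (0, -z⁻¹ (λ̄ⁿ)_{≤ 1})`. Since `{λ, λⁿ} = 0`,
substitution into `P₁` and `P₂` yields the Toda vector fields (`P1A_ham`, `P2A_ham`, `P1A_hamBar`,
`P2A_hamBar`).
-/

noncomputable section

namespace Toda

/-! ### Series of smooth functions -/

section Series

variable {V : Type} [NormedAddCommGroup V] [NormedSpace ℝ V] [FiniteDimensional ℝ V]

/-- Termwise differentiation of a series all of whose derivatives are dominated, on each compact
set separately, by summable sequences. -/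
theorem hasFDerivAt_tsum_of_isCompact {F ι : Type} [NormedAddCommGroup F] [NormedSpace ℝ F]
    [CompleteSpace F] (f : ι → V → F) (hf : ∀ i, ContDiff ℝ (⊤ : ℕ∞) (f i))
    (hb : ∀ K : Set V, IsCompact K → ∀ s : ℕ, ∃ u : ι → ℝ, Summable u ∧
      ∀ i, ∀ p ∈ K, ‖iteratedFDeriv ℝ s (f i) p‖ ≤ u i) (p : V) :
    HasFDerivAt (fun p => ∑' i, f i p) (∑' i, fderiv ℝ (f i) p) p := by
  have hK : IsCompact (Metric.closedBall p 1) := isCompact_closedBall p 1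
  obtain ⟨u, hu, hub⟩ := hb _ hK 1
  obtain ⟨v, hv, hvb⟩ := hb _ hK 0
  refine hasFDerivAt_tsum_of_isPreconnected (f' := fun i q => fderiv ℝ (f i) q)
    (s := Metric.ball p 1) (x₀ := p) hu Metric.isOpen_ball
    (convex_ball p 1).isPreconnected ?_ ?_ (Metric.mem_ball_self one_pos) ?_
    (Metric.mem_ball_self one_pos)
  · intro i q _
    exact ((hf i).differentiable (by simp) q).hasFDerivAt
  · intro i q hq
    have := hub i q (Metric.ball_subset_closedBall hq)
    rwa [← zero_add 1, ← norm_iteratedFDeriv_fderiv, norm_iteratedFDeriv_zero] at this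
  · refine Summable.of_norm_bounded hv fun i => ?_
    have := hvb i p (Metric.mem_closedBall_self zero_le_one)
    rwa [norm_iteratedFDeriv_zero] at this

theorem contDiff_tsum_of_isCompact {F ι : Type} [NormedAddCommGroup F] [NormedSpace ℝ F]
    [CompleteSpace F] (f : ι → V → F) (hf : ∀ i, ContDiff ℝ (⊤ : ℕ∞) (f i))
    (hb : ∀ K : Set V, IsCompact K → ∀ s : ℕ, ∃ u : ι → ℝ, Summable u ∧
      ∀ i, ∀ p ∈ K, ‖iteratedFDeriv ℝ s (f i) p‖ ≤ u i) :
    ContDiff ℝ (⊤ : ℕ∞) (fun p => ∑' i, f i p) := by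
  rw [contDiff_infty]
  intro n
  induction n generalizing F with
  | zero =>
    exact contDiff_zero.2 (continuous_iff_continuousAt.2 fun p =>
      (hasFDerivAt_tsum_of_isCompact f hf hb p).continuousAt)
  | succ n ih =>
    push_cast
    rw [contDiff_succ_iff_fderiv]
    refine ⟨fun p => (hasFDerivAt_tsum_of_isCompact f hf hb p).differentiableAt, by simp, ?_⟩
    have : fderiv ℝ (fun p => ∑' i, f i p) = fun p => ∑' i, fderiv ℝ (f i) p :=
      funext fun p => (hasFDerivAt_tsum_of_isCompact f hf hb p).fderiv
    rw [this]
    refine ih (fun i => fderiv ℝ (f i)) (fun i => (hf i).fderiv_right (by simp)) ?_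
    intro K hK s
    obtain ⟨u, hu, hub⟩ := hb K hK (s + 1)
    exact ⟨u, hu, fun i p hp => by rw [norm_iteratedFDeriv_fderiv]; exact hub i p hp⟩

theorem norm_iteratedFDeriv_tsum_le {F ι : Type} [NormedAddCommGroup F] [NormedSpace ℝ F]
    [CompleteSpace F] (f : ι → V → F) (hf : ∀ i, ContDiff ℝ (⊤ : ℕ∞) (f i))
    (hb : ∀ K : Set V, IsCompact K → ∀ s : ℕ, ∃ u : ι → ℝ, Summable u ∧
      ∀ i, ∀ p ∈ K, ‖iteratedFDeriv ℝ s (f i) p‖ ≤ u i) (s : ℕ) (p : V) {u : ι → ℝ}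
    (hu : Summable u) (hub : ∀ i, ‖iteratedFDeriv ℝ s (f i) p‖ ≤ u i) :
    ‖iteratedFDeriv ℝ s (fun p => ∑' i, f i p) p‖ ≤ ∑' i, u i := by
  induction s generalizing F with
  | zero =>
    rw [norm_iteratedFDeriv_zero]
    exact tsum_of_norm_bounded hu.hasSum fun i => by simpa using hub i
  | succ s ih =>
    rw [← norm_iteratedFDeriv_fderiv]
    have : fderiv ℝ (fun p => ∑' i, f i p) = fun p => ∑' i, fderiv ℝ (f i) p :=
      funext fun p => (hasFDerivAt_tsum_of_isCompact f hf hb p).fderiv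
    rw [this]
    refine ih (fun i => fderiv ℝ (f i)) (fun i => (hf i).fderiv_right (by simp)) ?_ ?_
    · intro K hK s
      obtain ⟨u, hu, hub⟩ := hb K hK (s + 1)
      exact ⟨u, hu, fun i p hp => by rw [norm_iteratedFDeriv_fderiv]; exact hub i p hp⟩
    · intro i
      rw [norm_iteratedFDeriv_fderiv]
      exact hub i

end Series

theorem summable_pow_natAbs {r : ℝ} (h0 : 0 ≤ r) (h1 : r < 1) :
    Summable fun n : ℤ => r ^ n.natAbs := by
  refine Summable.of_nat_of_neg ?_ ?_ <;> simpa using summable_geometric_of_lt_one h0 h1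

/-- A linear factor is absorbed by a slightly larger ratio. -/
theorem exists_linear_mul_pow_le {r : ℝ} (h0 : 0 < r) (h1 : r < 1) :
    ∃ r' : ℝ, 0 < r' ∧ r' < 1 ∧ ∃ C : ℝ, 0 ≤ C ∧ ∀ n : ℕ, (1 + (n : ℝ)) * r ^ n ≤ C * r' ^ n := by
  obtain ⟨q, hq, hq1⟩ := exists_between h1
  have hq0 : 0 < q := h0.trans hq
  have hlt : r / q < 1 := (div_lt_one hq0).2 hq
  have hpos : 0 ≤ r / q := (div_pos h0 hq0).le
  have ht := (summable_geometric_of_lt_one hpos hlt).add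
    (show Summable fun n : ℕ => (n : ℝ) * (r / q) ^ n by
      simpa using summable_pow_mul_geometric_of_norm_lt_one 1
        (show ‖r / q‖ < 1 by rwa [Real.norm_of_nonneg hpos]))
  refine ⟨q, hq0, hq1, ∑' n : ℕ, ((r / q) ^ n + (n : ℝ) * (r / q) ^ n),
    tsum_nonneg fun n => by positivity, fun n => ?_⟩
  have := ht.le_tsum n fun j _ => by positivity
  calc (1 + (n : ℝ)) * r ^ n = ((r / q) ^ n + (n : ℝ) * (r / q) ^ n) * q ^ n := by
        rw [div_pow]; field_simp
    _ ≤ _ := by gcongr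

/-! ### Smooth families of coefficient sequences -/

section Geo

variable {V : Type} [NormedAddCommGroup V] [NormedSpace ℝ V]

/-- A two-sided sequence of smooth functions each of whose derivatives is, locally uniformly,
bounded by a geometric sequence in `|n|`: the Laurent coefficients of a smooth family of functions
holomorphic near the unit circle. -/
def GeoSmooth (c : ℤ → V → ℂ) : Prop :=
  (∀ n, ContDiff ℝ (⊤ : ℕ∞) (c n)) ∧
  ∀ K : Set V, IsCompact K → ∀ s : ℕ, ∃ r : ℝ, 0 < r ∧ r < 1 ∧ ∃ C : ℝ,
    ∀ n, ∀ p ∈ K, ‖iteratedFDeriv ℝ s (c n) p‖ ≤ C * r ^ n.natAbs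

variable {c d : ℤ → V → ℂ}

theorem GeoSmooth.exists_bound (hc : GeoSmooth c) {K : Set V} (hK : IsCompact K) (s : ℕ) :
    ∃ r : ℝ, 0 < r ∧ r < 1 ∧ ∃ C : ℝ, 0 ≤ C ∧
      ∀ i ≤ s, ∀ n, ∀ p ∈ K, ‖iteratedFDeriv ℝ i (c n) p‖ ≤ C * r ^ n.natAbs := by
  induction s with
  | zero =>
    obtain ⟨r, h0, h1, C, hC⟩ := hc.2 K hK 0
    refine ⟨r, h0, h1, |C|, abs_nonneg C, fun i hi n p hp => ?_⟩
    obtain rfl : i = 0 := by omega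
    exact (hC n p hp).trans (by gcongr; exact le_abs_self C)
  | succ s ih =>
    obtain ⟨r, h0, h1, C, hC0, hC⟩ := ih
    obtain ⟨r', h0', h1', C', hC'⟩ := hc.2 K hK (s + 1)
    refine ⟨max r r', lt_max_of_lt_left h0, max_lt h1 h1', C + |C'|, by positivity,
      fun i hi n p hp => ?_⟩
    have hm : 0 ≤ max r r' := (lt_max_of_lt_left h0).le
    rcases Nat.le_succ_iff.1 hi with hi | rfl
    · refine (hC i hi n p hp).trans (mul_le_mul (le_add_of_nonneg_right (abs_nonneg _))
        (pow_le_pow_left₀ h0.le (le_max_left _ _) _) (by positivity) (by positivity))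
    · refine (hC' n p hp).trans (mul_le_mul ((le_abs_self C').trans (le_add_of_nonneg_left hC0))
        (pow_le_pow_left₀ h0'.le (le_max_right _ _) _) (by positivity) (by positivity))

theorem GeoSmooth.summable (hc : GeoSmooth c) (p : V) : Summable fun n => ‖c n p‖ := by
  obtain ⟨r, h0, h1, C, hC⟩ := hc.2 {p} isCompact_singleton 0
  refine Summable.of_nonneg_of_le (fun _ => norm_nonneg _) (fun n => ?_)
    ((summable_pow_natAbs h0.le h1).mul_left C)
  simpa using hC n p rfl

theorem GeoSmooth.add (hc : GeoSmooth c) (hd : GeoSmooth d) :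
    GeoSmooth fun n p => c n p + d n p := by
  refine ⟨fun n => (hc.1 n).add (hd.1 n), fun K hK s => ?_⟩
  obtain ⟨r, h0, h1, C, hC0, hC⟩ := hc.exists_bound hK s
  obtain ⟨r', h0', h1', C', hC0', hC'⟩ := hd.exists_bound hK s
  have hm : 0 < max r r' := lt_max_of_lt_left h0
  refine ⟨max r r', hm, max_lt h1 h1', C + C', fun n p hp => ?_⟩
  have : iteratedFDeriv ℝ s (fun p => c n p + d n p) p
      = iteratedFDeriv ℝ s (c n) p + iteratedFDeriv ℝ s (d n) p :=
    iteratedFDeriv_add_apply ((hc.1 n).of_le (by exact_mod_cast le_top)).contDiffAt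
      ((hd.1 n).of_le (by exact_mod_cast le_top)).contDiffAt
  rw [this, add_mul]
  refine (norm_add_le _ _).trans (add_le_add ?_ ?_)
  · exact (hC s le_rfl n p hp).trans (mul_le_mul_of_nonneg_left
      (pow_le_pow_left₀ h0.le (le_max_left _ _) _) hC0)
  · exact (hC' s le_rfl n p hp).trans (mul_le_mul_of_nonneg_left
      (pow_le_pow_left₀ h0'.le (le_max_right _ _) _) hC0')

/-- Coefficientwise multipliers of at most linear growth: this covers scalars, the projections
`(·)_{≥ k}`, `(·)_{≤ k}`, and `z ∂/∂z`. -/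
theorem GeoSmooth.multiplier (hc : GeoSmooth c) (m : ℤ → ℂ) (B : ℝ)
    (hm : ∀ n, ‖m n‖ ≤ B * (1 + n.natAbs)) : GeoSmooth fun n p => m n * c n p := by
  refine ⟨fun n => contDiff_const.mul (hc.1 n), fun K hK s => ?_⟩
  obtain ⟨r, h0, h1, C, hC0, hC⟩ := hc.exists_bound hK s
  obtain ⟨r', h0', h1', C', hC0', hC'⟩ := exists_linear_mul_pow_le h0 h1
  have hB : 0 ≤ B := by simpa using (norm_nonneg _).trans (hm 0)
  refine ⟨r', h0', h1', B * C * C', fun n p hp => ?_⟩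
  have : iteratedFDeriv ℝ s (fun p => m n * c n p) p = m n • iteratedFDeriv ℝ s (c n) p := by
    rw [← iteratedFDeriv_const_smul_apply ((hc.1 n).of_le (by exact_mod_cast le_top)).contDiffAt]
    rfl
  rw [this, norm_smul]
  calc ‖m n‖ * ‖iteratedFDeriv ℝ s (c n) p‖
      ≤ (B * (1 + n.natAbs)) * (C * r ^ n.natAbs) := by
        gcongr
        · exact hm n
        · exact hC s le_rfl n p hp
    _ = B * C * ((1 + (n.natAbs : ℝ)) * r ^ n.natAbs) := by ring
    _ ≤ B * C * (C' * r' ^ n.natAbs) :=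
        mul_le_mul_of_nonneg_left (hC' _) (by positivity)
    _ = _ := by ring

theorem GeoSmooth.const_mul (hc : GeoSmooth c) (a : ℂ) : GeoSmooth fun n p => a * c n p :=
  hc.multiplier (fun _ => a) ‖a‖ fun n => by
    nlinarith [norm_nonneg a, (Nat.cast_nonneg n.natAbs : (0 : ℝ) ≤ n.natAbs)]

/-- A projection onto a set of exponents. -/
theorem GeoSmooth.indicator (hc : GeoSmooth c) (S : ℤ → Prop) [DecidablePred S] :
    GeoSmooth fun n p => if S n then c n p else 0 := by
  have := hc.multiplier (fun n => if S n then 1 else 0) 1 fun n => by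
    split_ifs <;> simp
    positivity
  simpa using this

theorem GeoSmooth.fderiv (hc : GeoSmooth c) (w : V) :
    GeoSmooth fun n p => fderiv ℝ (c n) p w := by
  refine ⟨fun n => ((hc.1 n).fderiv_right (by simp)).clm_apply contDiff_const, fun K hK s => ?_⟩
  obtain ⟨r, h0, h1, C, hC⟩ := hc.2 K hK (s + 1)
  refine ⟨r, h0, h1, ‖w‖ * C, fun n p hp => ?_⟩
  have hs : ContDiff ℝ (⊤ : ℕ∞) (_root_.fderiv ℝ (c n)) := (hc.1 n).fderiv_right (by simp)
  refine (norm_iteratedFDeriv_clm_apply_const (n := s) hs.contDiffAt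
    (by exact_mod_cast le_top)).trans ?_
  rw [norm_iteratedFDeriv_fderiv, mul_assoc]
  exact mul_le_mul_of_nonneg_left (hC n p hp) (norm_nonneg _)

theorem GeoSmooth.comp {W : Type} [NormedAddCommGroup W] [NormedSpace ℝ W] (hc : GeoSmooth c)
    {g : W → V} (hg : ContDiff ℝ (⊤ : ℕ∞) g) : GeoSmooth fun n q => c n (g q) := by
  refine ⟨fun n => (hc.1 n).comp hg, fun K hK s => ?_⟩
  obtain ⟨r, h0, h1, C, hC0, hC⟩ := hc.exists_bound (hK.image hg.continuous) s
  have hD : ∃ D : ℝ, 1 ≤ D ∧ ∀ i ≤ s, ∀ q ∈ K, ‖iteratedFDeriv ℝ i g q‖ ≤ D := by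
    clear hC
    induction s with
    | zero =>
      obtain ⟨D, hD⟩ := hK.exists_bound_of_continuousOn
        (hg.continuous_iteratedFDeriv (m := 0) (by simp)).continuousOn
      refine ⟨max 1 D, le_max_left _ _, fun i hi q hq => ?_⟩
      obtain rfl : i = 0 := by omega
      exact (hD q hq).trans (le_max_right _ _)
    | succ s ih =>
      obtain ⟨D, hD1, hD⟩ := ih
      obtain ⟨D', hD'⟩ := hK.exists_bound_of_continuousOn
        (hg.continuous_iteratedFDeriv (m := s + 1) (by exact_mod_cast le_top)).continuousOn
      refine ⟨max D D', hD1.trans (le_max_left _ _), fun i hi q hq => ?_⟩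
      rcases Nat.le_succ_iff.1 hi with hi | rfl
      · exact (hD i hi q hq).trans (le_max_left _ _)
      · exact (hD' q hq).trans (le_max_right _ _)
  obtain ⟨D, hD1, hD⟩ := hD
  refine ⟨r, h0, h1, s.factorial * C * D ^ s, fun n q hq => ?_⟩
  have := norm_iteratedFDeriv_comp_le (hc.1 n) hg (n := s) (by exact_mod_cast le_top) q
    (C := C * r ^ n.natAbs) (D := D) (fun i hi => hC i hi n _ ⟨q, hq, rfl⟩)
    (fun i hi his => (hD i his q hq).trans (le_self_pow₀ hD1 (by omega)))
  refine this.trans (le_of_eq (by ring))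

/-- The geometric bound for the terms of a convolution. -/
theorem pow_natAbs_mul_pow_natAbs_le {q : ℝ} (h0 : 0 ≤ q) (h1 : q ≤ 1) (k n : ℤ) :
    (q ^ 2) ^ k.natAbs * (q ^ 2) ^ (n - k).natAbs ≤ q ^ n.natAbs * q ^ k.natAbs := by
  rw [← pow_mul, ← pow_mul, ← pow_add, ← pow_add]
  exact pow_le_pow_of_le_one h0 h1 (by omega)

theorem GeoSmooth.norm_iteratedFDeriv_mul_le (hc : GeoSmooth c) (hd : GeoSmooth d)
    {K : Set V} (hK : IsCompact K) (s : ℕ) :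
    ∃ q : ℝ, 0 < q ∧ q < 1 ∧ ∃ C : ℝ, ∀ n k, ∀ p ∈ K,
      ‖iteratedFDeriv ℝ s (fun p => c k p * d (n - k) p) p‖ ≤ C * (q ^ n.natAbs * q ^ k.natAbs) := by
  obtain ⟨r, h0, h1, C, hC0, hC⟩ := hc.exists_bound hK s
  obtain ⟨r', h0', h1', C', hC0', hC'⟩ := hd.exists_bound hK s
  have hm : 0 < max r r' := lt_max_of_lt_left h0
  have hm1 : max r r' < 1 := max_lt h1 h1'
  set q := Real.sqrt (max r r') with hq
  have hq2 : q ^ 2 = max r r' := Real.sq_sqrt hm.le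
  have hq0 : 0 < q := Real.sqrt_pos.2 hm
  have hq1 : q < 1 := by nlinarith
  refine ⟨q, hq0, hq1, ∑ i ∈ Finset.range (s + 1), (s.choose i : ℝ) * (C * C'),
    fun n k p hp => ?_⟩
  refine (_root_.norm_iteratedFDeriv_mul_le (hc.1 k) (hd.1 (n - k)) p (n := s)
    (by exact_mod_cast le_top)).trans ?_
  rw [Finset.sum_mul]
  refine Finset.sum_le_sum fun i hi => ?_
  have hi : i ≤ s := by simpa [Nat.lt_succ_iff] using hi
  calc (s.choose i : ℝ) * ‖iteratedFDeriv ℝ i (c k) p‖ * ‖iteratedFDeriv ℝ (s - i) (d (n - k)) p‖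
      ≤ (s.choose i : ℝ) * (C * (q ^ 2) ^ k.natAbs) * (C' * (q ^ 2) ^ (n - k).natAbs) := by
        rw [hq2]
        gcongr
        · exact (hC i hi k p hp).trans (by gcongr; exact le_max_left _ _)
        · exact (hC' _ (Nat.sub_le s i) _ p hp).trans (by gcongr; exact le_max_right _ _)
    _ = (s.choose i : ℝ) * (C * C') * ((q ^ 2) ^ k.natAbs * (q ^ 2) ^ (n - k).natAbs) := by ring
    _ ≤ _ := mul_le_mul_of_nonneg_left (pow_natAbs_mul_pow_natAbs_le hq0.le hq1.le k n)
        (by positivity)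

/-- The Laurent coefficients of a product. The convolution decays geometrically because each factor
does, at the price of replacing the ratio by its square root. -/
theorem GeoSmooth.conv [FiniteDimensional ℝ V] (hc : GeoSmooth c) (hd : GeoSmooth d) :
    GeoSmooth fun n p => ∑' k : ℤ, c k p * d (n - k) p := by
  have hsm : ∀ n k, ContDiff ℝ (⊤ : ℕ∞) fun p => c k p * d (n - k) p := fun n k =>
    (hc.1 k).mul (hd.1 (n - k))
  have hb : ∀ n : ℤ, ∀ K : Set V, IsCompact K → ∀ s : ℕ, ∃ u : ℤ → ℝ, Summable u ∧
      ∀ k, ∀ p ∈ K, ‖iteratedFDeriv ℝ s (fun p => c k p * d (n - k) p) p‖ ≤ u k := by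
    intro n K hK s
    obtain ⟨q, h0, h1, C, hC⟩ := hc.norm_iteratedFDeriv_mul_le hd hK s
    exact ⟨_, ((summable_pow_natAbs h0.le h1).mul_left _).mul_left C, hC n⟩
  refine ⟨fun n => contDiff_tsum_of_isCompact _ (hsm n) (hb n), fun K hK s => ?_⟩
  obtain ⟨q, h0, h1, C, hC⟩ := hc.norm_iteratedFDeriv_mul_le hd hK s
  refine ⟨q, h0, h1, C * ∑' k : ℤ, q ^ k.natAbs, fun n p hp => ?_⟩
  refine (norm_iteratedFDeriv_tsum_le _ (hsm n) (hb n) s p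
    (((summable_pow_natAbs h0.le h1).mul_left _).mul_left C) fun k => hC n k p hp).trans ?_
  rw [tsum_mul_left, tsum_mul_left]
  exact le_of_eq (by ring)

end Geo

/-! ### Laurent coefficients of functions on the circle -/

section Coeff

theorem norm_zpow_circle (z : Circle) (n : ℤ) : ‖(z : ℂ) ^ n‖ = 1 := by
  rw [norm_zpow, Circle.norm_coe, one_zpow]

theorem circle_zpow_add (z : Circle) (m n : ℤ) : (z : ℂ) ^ (m + n) = (z : ℂ) ^ m * (z : ℂ) ^ n :=
  zpow_add₀ (Circle.coe_ne_zero z) m n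

theorem integral_exp_zpow (k : ℤ) :
    ∫ θ in (0 : ℝ)..2 * Real.pi, (Circle.exp θ : ℂ) ^ k
      = if k = 0 then (2 * Real.pi : ℂ) else 0 := by
  have h : ∀ θ : ℝ, (Circle.exp θ : ℂ) ^ k = Complex.exp ((k * Complex.I) * θ) := fun θ => by
    rw [Circle.coe_exp, ← Complex.exp_int_mul]; congr 1; ring
  simp_rw [h]
  split_ifs with hk
  · simp [hk]
  · rw [integral_exp_mul_complex (mul_ne_zero (by exact_mod_cast hk) Complex.I_ne_zero)]
    have : Complex.exp ((k * Complex.I) * ((2 * Real.pi : ℝ) : ℂ)) = 1 := by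
      rw [← Complex.exp_int_mul_two_pi_mul_I k]; congr 1; push_cast; ring
    rw [this]; simp

theorem coeff_eq_integral (f : Circle → ℂ) (n : ℤ) :
    coeff f n = (2 * Real.pi : ℂ)⁻¹ *
      ∫ θ in (0 : ℝ)..2 * Real.pi, f (Circle.exp θ) * (Circle.exp θ : ℂ) ^ (-n) := by
  have h : ∀ θ : ℝ, f (Circle.exp θ) * (Circle.exp θ : ℂ) ^ (-n - 1)
      * (Complex.I * (Circle.exp θ : ℂ))
      = Complex.I * (f (Circle.exp θ) * (Circle.exp θ : ℂ) ^ (-n)) := fun θ => by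
    rw [zpow_sub_one₀ (Circle.coe_ne_zero _)]
    field_simp [Circle.coe_ne_zero]
  rw [coeff, contour]
  simp_rw [h]
  rw [intervalIntegral.integral_const_mul]
  field_simp

/-- The coefficients of an absolutely convergent Laurent series are recovered by contour
integration. -/
theorem coeff_eq_of_hasSum {f : Circle → ℂ} {c : ℤ → ℂ} (hc : Summable fun n => ‖c n‖)
    (h : ∀ z : Circle, HasSum (fun n => c n * (z : ℂ) ^ n) (f z)) (n : ℤ) : coeff f n = c n := by
  rw [coeff_eq_integral]
  have hs := intervalIntegral.hasSum_integral_of_dominated_convergence (a := 0)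
    (b := 2 * Real.pi) (μ := MeasureTheory.volume)
    (F := fun (m : ℤ) (θ : ℝ) => c m * (Circle.exp θ : ℂ) ^ (m + -n))
    (f := fun θ : ℝ => f (Circle.exp θ) * (Circle.exp θ : ℂ) ^ (-n))
    (fun m _ => ‖c m‖) (fun m => by
      refine Continuous.aestronglyMeasurable ?_
      refine continuous_const.mul (Continuous.zpow₀ (by fun_prop) _ fun θ => ?_)
      exact Or.inl (Circle.coe_ne_zero _))
    (fun m => Filter.Eventually.of_forall fun θ _ => by
      rw [norm_mul, norm_zpow_circle, mul_one])
    (Filter.Eventually.of_forall fun θ _ => hc) (by simp)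
    (Filter.Eventually.of_forall fun θ _ => by
      simp_rw [circle_zpow_add, ← mul_assoc]
      exact (h _).mul_right _)
  simp_rw [intervalIntegral.integral_const_mul, integral_exp_zpow] at hs
  have h2 : HasSum (fun m => c m * if m + -n = 0 then (2 * Real.pi : ℂ) else 0)
      (c n * (2 * Real.pi : ℂ)) := by
    convert hasSum_single n fun m hm => ?_ using 1
    · simp
    · rw [if_neg (by omega), mul_zero]
  rw [hs.unique h2]
  have : (Real.pi : ℂ) ≠ 0 := by exact_mod_cast Real.pi_ne_zero
  field_simp

theorem coeff_zero_eq_contour (f : Circle → ℂ) :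
    coeff (fun z => z * f z) 0 = (2 * Real.pi * Complex.I)⁻¹ * contour f := by
  rw [coeff]
  congr 2
  funext z
  rw [neg_zero, zero_sub, zpow_neg_one]
  field_simp [Circle.coe_ne_zero]

theorem coeff_mul_zpow (f : Circle → ℂ) (k n : ℤ) :
    coeff (fun z => (z : ℂ) ^ k * f z) n = coeff f (n - k) := by
  rw [coeff, coeff]
  congr 2
  funext z
  rw [show -(n - k) - 1 = k + (-n - 1) by ring, circle_zpow_add]
  ring

theorem coeff_const_mul (a : ℂ) (f : Circle → ℂ) (n : ℤ) :
    coeff (fun z => a * f z) n = a * coeff f n := by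
  rw [coeff_eq_integral, coeff_eq_integral]
  simp_rw [mul_assoc]
  rw [intervalIntegral.integral_const_mul]
  ring

theorem coeff_comp_inv (f : Circle → ℂ) (n : ℤ) :
    coeff (fun z => f z⁻¹) n = coeff f (-n) := by
  rw [coeff_eq_integral, coeff_eq_integral]
  congr 1
  have h1 : ∀ θ : ℝ, f (Circle.exp θ)⁻¹ * (Circle.exp θ : ℂ) ^ (-n)
      = (fun t : ℝ => f (Circle.exp t) * (Circle.exp t : ℂ) ^ (- -n)) (-θ) := fun θ => by
    simp only [Circle.exp_neg, Circle.coe_inv, inv_zpow, neg_neg, zpow_neg]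
  simp_rw [h1]
  rw [intervalIntegral.integral_comp_neg
    (fun t : ℝ => f (Circle.exp t) * (Circle.exp t : ℂ) ^ (- -n))]
  have hp : Function.Periodic (fun t : ℝ => f (Circle.exp t) * (Circle.exp t : ℂ) ^ (- -n))
      (2 * Real.pi) := fun t => by simp only [Circle.periodic_exp t]
  have := hp.intervalIntegral_add_eq (-(2 * Real.pi)) 0
  simpa using this

end Coeff

/-! ### Smooth families of functions holomorphic near the circle -/

section SmoothL

variable {V : Type} [NormedAddCommGroup V] [NormedSpace ℝ V]

/-- Smooth families of functions holomorphic in a neighbourhood of the circle `|z| = 1`: the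
Laurent coefficients, defined by contour integrals, depend smoothly on the parameter and decay
geometrically together with their derivatives, and the Laurent series converges to the function. -/
def SmoothL (a : V → Circle → ℂ) : Prop :=
  GeoSmooth (fun n p => coeff (a p) n) ∧
    ∀ p (z : Circle), HasSum (fun n => coeff (a p) n * (z : ℂ) ^ n) (a p z)

variable {a b : V → Circle → ℂ} {c : ℤ → V → ℂ}

theorem GeoSmooth.summable_mul_zpow (hc : GeoSmooth c) (p : V) (z : Circle) :
    Summable fun n => c n p * (z : ℂ) ^ n :=
  Summable.of_norm (by simp_rw [norm_mul, norm_zpow_circle, mul_one]; exact hc.summable p)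

theorem GeoSmooth.coeff_eq (hc : GeoSmooth c)
    (h : ∀ p (z : Circle), HasSum (fun n => c n p * (z : ℂ) ^ n) (a p z)) (p : V) (n : ℤ) :
    coeff (a p) n = c n p :=
  coeff_eq_of_hasSum (c := fun n => c n p) (hc.summable p) (h p) n

theorem GeoSmooth.smoothL (hc : GeoSmooth c)
    (h : ∀ p (z : Circle), HasSum (fun n => c n p * (z : ℂ) ^ n) (a p z)) : SmoothL a := by
  have : (fun n p => coeff (a p) n) = c := by
    funext n p; exact hc.coeff_eq h p n
  refine ⟨by rwa [this], fun p z => ?_⟩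
  simp_rw [hc.coeff_eq h]
  exact h p z

theorem SmoothL.summable (ha : SmoothL a) (p : V) : Summable fun n => ‖coeff (a p) n‖ :=
  ha.1.summable p

theorem SmoothL.contDiff_coeff (ha : SmoothL a) (n : ℤ) :
    ContDiff ℝ (⊤ : ℕ∞) fun p => coeff (a p) n := ha.1.1 n

theorem SmoothL.ext_coeff (ha : SmoothL a) (hb : SmoothL b) {p : V}
    (h : ∀ n, coeff (a p) n = coeff (b p) n) : a p = b p := by
  funext z
  refine (ha.2 p z).unique ?_
  simp_rw [h]
  exact hb.2 p z

theorem SmoothL.coeff_add (ha : SmoothL a) (hb : SmoothL b) (p : V) (n : ℤ) :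
    coeff (a p + b p) n = coeff (a p) n + coeff (b p) n :=
  (ha.1.add hb.1).coeff_eq (a := fun p => a p + b p)
    (fun p z => by simpa [add_mul] using (ha.2 p z).add (hb.2 p z)) p n

theorem SmoothL.add (ha : SmoothL a) (hb : SmoothL b) : SmoothL fun p => a p + b p :=
  (ha.1.add hb.1).smoothL fun p z => by simpa [add_mul] using (ha.2 p z).add (hb.2 p z)

theorem SmoothL.const_mul (ha : SmoothL a) (w : ℂ) : SmoothL fun p z => w * a p z :=
  (ha.1.const_mul w).smoothL fun p z => by simpa [mul_assoc] using (ha.2 p z).mul_left w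

theorem hasSum_monomial (g : ℂ) (k : ℤ) (z : Circle) :
    HasSum (fun n : ℤ => (if n = k then g else 0) * (z : ℂ) ^ n) (g * (z : ℂ) ^ k) := by
  convert hasSum_single k fun m hm => ?_ using 1
  · simp
  · rw [if_neg hm, zero_mul]

theorem geoSmooth_monomial {g : V → ℂ} (hg : ContDiff ℝ (⊤ : ℕ∞) g) (k : ℤ) :
    GeoSmooth fun n p => if n = k then g p else 0 := by
  refine ⟨fun n => ?_, fun K hK s => ?_⟩
  · by_cases h : n = k
    · simpa only [if_pos h] using hg
    · simpa only [if_neg h] using contDiff_const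
  · obtain ⟨C, hC⟩ := hK.exists_bound_of_continuousOn
        (hg.continuous_iteratedFDeriv (m := s) (by exact_mod_cast le_top)).continuousOn
    refine ⟨1 / 2, by norm_num, by norm_num, |C| * 2 ^ k.natAbs, fun n p hp => ?_⟩
    by_cases h : n = k
    · simp only [if_pos h]
      rw [h, mul_assoc, ← mul_pow]
      norm_num
      exact (hC p hp).trans (le_abs_self C)
    · simp only [if_neg h]
      have : iteratedFDeriv ℝ s (fun _ : V => (0 : ℂ)) p = 0 := by
        simp
      rw [this, norm_zero]
      positivity

theorem SmoothL.monomial {g : V → ℂ} (hg : ContDiff ℝ (⊤ : ℕ∞) g) (k : ℤ) :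
    SmoothL fun p z => g p * (z : ℂ) ^ k :=
  (geoSmooth_monomial hg k).smoothL fun p z => hasSum_monomial (g p) k z

theorem coeff_monomial (g : ℂ) (k n : ℤ) :
    coeff (fun z => g * (z : ℂ) ^ k) n = if n = k then g else 0 := by
  have := (geoSmooth_monomial (V := ℝ) (contDiff_const (c := g)) k).coeff_eq
    (a := fun _ z => g * (z : ℂ) ^ k) (fun p z => hasSum_monomial g k z) 0 n
  exact this

theorem SmoothL.const (w : ℂ) : SmoothL fun (_ : V) (_ : Circle) => w := by
  simpa using SmoothL.monomial (V := V) (contDiff_const (c := w)) 0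

theorem hasSum_cauchyProduct {A B : ℤ → ℂ} (hA : Summable fun n => ‖A n‖)
    (hB : Summable fun n => ‖B n‖) {x y : ℂ} (hx : HasSum A x) (hy : HasSum B y) :
    HasSum (fun n : ℤ => ∑' k : ℤ, A k * B (n - k)) (x * y) := by
  have h : Summable fun q : ℤ × ℤ => A q.1 * B q.2 := summable_mul_of_summable_norm hA hB
  have hM : HasSum (fun q : ℤ × ℤ => A q.1 * B q.2) (x * y) := by
    rw [← hx.tsum_eq, ← hy.tsum_eq, tsum_mul_tsum_of_summable_norm hA hB]
    exact h.hasSum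
  let e : ℤ × ℤ ≃ ℤ × ℤ :=
    { toFun := fun q => (q.2, q.1 - q.2), invFun := fun q => (q.1 + q.2, q.1)
      left_inv := fun q => Prod.ext (by simp) rfl, right_inv := fun q => Prod.ext rfl (by simp) }
  have hM' : HasSum (fun q : ℤ × ℤ => A q.2 * B (q.1 - q.2)) (x * y) := (e.hasSum_iff).2 hM
  exact hM'.prod_fiberwise fun n => (hM'.summable.prod_factor n).hasSum

/-- The Cauchy product of two absolutely convergent Laurent series. -/
theorem hasSum_mul_zpow {c d : ℤ → ℂ} (hc : Summable fun n => ‖c n‖) (hd : Summable fun n => ‖d n‖)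
    {z : Circle} {x y : ℂ} (hx : HasSum (fun n => c n * (z : ℂ) ^ n) x)
    (hy : HasSum (fun n => d n * (z : ℂ) ^ n) y) :
    HasSum (fun n : ℤ => (∑' k : ℤ, c k * d (n - k)) * (z : ℂ) ^ n) (x * y) := by
  have hA : Summable fun n => ‖c n * (z : ℂ) ^ n‖ := by
    simp_rw [norm_mul, norm_zpow_circle, mul_one]; exact hc
  have hB : Summable fun n => ‖d n * (z : ℂ) ^ n‖ := by
    simp_rw [norm_mul, norm_zpow_circle, mul_one]; exact hd
  have h := hasSum_cauchyProduct hA hB hx hy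
  have hterm : ∀ n k : ℤ, (c k * (z : ℂ) ^ k) * (d (n - k) * (z : ℂ) ^ (n - k))
      = c k * d (n - k) * (z : ℂ) ^ n := fun n k => by
    have : (z : ℂ) ^ n = (z : ℂ) ^ k * (z : ℂ) ^ (n - k) := by
      rw [← circle_zpow_add, add_sub_cancel]
    rw [this]; ring
  simp_rw [hterm, tsum_mul_right] at h
  exact h

theorem SmoothL.mul_aux (ha : SmoothL a) (hb : SmoothL b) (p : V)
    (z : Circle) : HasSum (fun n : ℤ => (∑' k : ℤ, coeff (a p) k * coeff (b p) (n - k)) * (z : ℂ) ^ n)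
      (a p z * b p z) :=
  hasSum_mul_zpow (ha.summable p) (hb.summable p) (ha.2 p z) (hb.2 p z)

theorem SmoothL.mul [FiniteDimensional ℝ V] (ha : SmoothL a) (hb : SmoothL b) :
    SmoothL fun p => a p * b p :=
  (ha.1.conv hb.1).smoothL fun p z => ha.mul_aux hb p z

theorem SmoothL.coeff_mul [FiniteDimensional ℝ V] (ha : SmoothL a) (hb : SmoothL b) (p : V)
    (n : ℤ) : coeff (a p * b p) n = ∑' k : ℤ, coeff (a p) k * coeff (b p) (n - k) :=
  (ha.1.conv hb.1).coeff_eq (a := fun p => a p * b p) (fun p z => ha.mul_aux hb p z) p n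

theorem SmoothL.comp {W : Type} [NormedAddCommGroup W] [NormedSpace ℝ W] (ha : SmoothL a)
    {g : W → V} (hg : ContDiff ℝ (⊤ : ℕ∞) g) : SmoothL fun q => a (g q) :=
  ⟨ha.1.comp hg, fun q => ha.2 (g q)⟩

theorem SmoothL.indicator (ha : SmoothL a) (S : ℤ → Prop) [DecidablePred S]
    (h : ∀ p (z : Circle),
      HasSum (fun n => (if S n then coeff (a p) n else 0) * (z : ℂ) ^ n) (b p z)) :
    SmoothL b ∧ ∀ p n, coeff (b p) n = if S n then coeff (a p) n else 0 :=
  ⟨(ha.1.indicator S).smoothL h, (ha.1.indicator S).coeff_eq h⟩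

theorem SmoothL.hasSum_projGE (ha : SmoothL a) (k : ℤ) (p : V) (z : Circle) :
    HasSum (fun n => (if k ≤ n then coeff (a p) n else 0) * (z : ℂ) ^ n) (projGE k (a p) z) := by
  have hi : Function.Injective fun m : ℕ => k + (m : ℤ) := fun m n h => by simpa using h
  have hs : Summable fun m : ℕ => coeff (a p) (k + m) * (z : ℂ) ^ (k + m : ℤ) :=
    (ha.2 p z).summable.comp_injective hi
  refine (hi.hasSum_iff (fun n hn => ?_)).1 ?_
  · rw [if_neg, zero_mul]
    exact fun h => hn ⟨(n - k).toNat, by simp [h]⟩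
  · refine hs.hasSum.congr_fun fun m => ?_
    simp [Function.comp]

theorem SmoothL.hasSum_projLE (ha : SmoothL a) (k : ℤ) (p : V) (z : Circle) :
    HasSum (fun n => (if n ≤ k then coeff (a p) n else 0) * (z : ℂ) ^ n) (projLE k (a p) z) := by
  have hi : Function.Injective fun m : ℕ => k - (m : ℤ) := fun m n h => by simpa using h
  have hs : Summable fun m : ℕ => coeff (a p) (k - m) * (z : ℂ) ^ (k - m : ℤ) :=
    (ha.2 p z).summable.comp_injective hi
  refine (hi.hasSum_iff (fun n hn => ?_)).1 ?_
  · rw [if_neg, zero_mul]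
    exact fun h => hn ⟨(k - n).toNat, by simp [h]⟩
  · refine hs.hasSum.congr_fun fun m => ?_
    simp [Function.comp]

theorem SmoothL.projGE (ha : SmoothL a) (k : ℤ) : SmoothL fun p => projGE k (a p) :=
  (ha.indicator (fun n => k ≤ n) (ha.hasSum_projGE k)).1

theorem SmoothL.projLE (ha : SmoothL a) (k : ℤ) : SmoothL fun p => projLE k (a p) :=
  (ha.indicator (fun n => n ≤ k) (ha.hasSum_projLE k)).1

theorem SmoothL.coeff_projGE (ha : SmoothL a) (k : ℤ) (p : V) (n : ℤ) :
    coeff (Toda.projGE k (a p)) n = if k ≤ n then coeff (a p) n else 0 :=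
  (ha.indicator (fun n => k ≤ n) (ha.hasSum_projGE k)).2 p n

theorem SmoothL.coeff_projLE (ha : SmoothL a) (k : ℤ) (p : V) (n : ℤ) :
    coeff (Toda.projLE k (a p)) n = if n ≤ k then coeff (a p) n else 0 :=
  (ha.indicator (fun n => n ≤ k) (ha.hasSum_projLE k)).2 p n

theorem GeoSmooth.int_mul (hc : GeoSmooth c) : GeoSmooth fun n p => (n : ℂ) * c n p :=
  hc.multiplier (fun n => n) 1 fun n => by
    have : ‖(n : ℂ)‖ = n.natAbs := by
      rw [Complex.norm_intCast, Nat.cast_natAbs, Int.cast_abs]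
    rw [this]; linarith

theorem SmoothL.hasSum_zD (ha : SmoothL a) (p : V) (z : Circle) :
    HasSum (fun n : ℤ => ((n : ℂ) * coeff (a p) n) * (z : ℂ) ^ n) (zD (a p) z) := by
  have hsum := ha.1.int_mul.summable p
  have hE : ∀ (n : ℤ) (θ : ℝ), HasDerivAt
      (fun θ : ℝ => coeff (a p) n * ((Circle.exp θ * z : Circle) : ℂ) ^ n)
      (Complex.I * ((n * coeff (a p) n) * ((Circle.exp θ * z : Circle) : ℂ) ^ n)) θ := by
    intro n θ
    have h1 : HasDerivAt (fun θ : ℝ => Complex.exp ((n * Complex.I) * θ))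
        (Complex.exp ((n * Complex.I) * θ) * (n * Complex.I)) θ := by
      have := ((hasDerivAt_id (θ : ℂ)).const_mul (n * Complex.I)).cexp.comp_ofReal
      simpa using this
    have h2 : ∀ θ : ℝ, ((Circle.exp θ * z : Circle) : ℂ) ^ n
        = Complex.exp ((n * Complex.I) * θ) * (z : ℂ) ^ n := fun θ => by
      rw [Circle.coe_mul, mul_zpow, Circle.coe_exp, ← Complex.exp_int_mul, mul_assoc (n : ℂ),
        mul_comm Complex.I]
    simp_rw [h2]
    exact ((h1.mul_const ((z : ℂ) ^ n)).const_mul (coeff (a p) n)).congr_deriv (by ring)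
  have hd := hasDerivAt_tsum (u := fun n : ℤ => ‖(n : ℂ) * coeff (a p) n‖) hsum hE
    (fun n θ => by rw [norm_mul, norm_mul, Complex.norm_I, norm_zpow_circle, one_mul, mul_one])
    (y₀ := 0) (ha.2 p _).summable 0
  have hf : (fun θ : ℝ => ∑' n : ℤ, coeff (a p) n * ((Circle.exp θ * z : Circle) : ℂ) ^ n)
      = fun θ : ℝ => a p (Circle.exp θ * z) := funext fun θ => (ha.2 p _).tsum_eq
  rw [hf] at hd
  rw [zD, hd.deriv, tsum_mul_left]
  simp only [Circle.exp_zero, one_mul]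
  rw [← mul_assoc, neg_mul, Complex.I_mul_I, neg_neg, one_mul]
  exact (ha.1.int_mul.summable_mul_zpow p z).hasSum

theorem SmoothL.zD (ha : SmoothL a) : SmoothL fun p => zD (a p) :=
  ha.1.int_mul.smoothL ha.hasSum_zD

theorem SmoothL.coeff_zD (ha : SmoothL a) (p : V) (n : ℤ) :
    coeff (Toda.zD (a p)) n = n * coeff (a p) n :=
  ha.1.int_mul.coeff_eq (a := fun p => Toda.zD (a p)) ha.hasSum_zD p n

/-- The directional derivative, at fixed `z`, of a family of functions on the circle. -/
def dir (w : V) (a : V → Circle → ℂ) : V → Circle → ℂ :=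
  fun p z => fderiv ℝ (fun q => a q z) p w

theorem SmoothL.term_aux (ha : SmoothL a) (z : Circle) :
    (∀ n : ℤ, ContDiff ℝ (⊤ : ℕ∞) fun p => coeff (a p) n * (z : ℂ) ^ n) ∧
    ∀ K : Set V, IsCompact K → ∀ s : ℕ, ∃ u : ℤ → ℝ, Summable u ∧
      ∀ n, ∀ p ∈ K, ‖iteratedFDeriv ℝ s (fun p => coeff (a p) n * (z : ℂ) ^ n) p‖ ≤ u n := by
  refine ⟨fun n => (ha.1.1 n).mul contDiff_const, fun K hK s => ?_⟩
  obtain ⟨r, h0, h1, C, hC⟩ := ha.1.2 K hK s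
  refine ⟨_, (summable_pow_natAbs h0.le h1).mul_left C, fun n p hp => ?_⟩
  have : iteratedFDeriv ℝ s (fun p => coeff (a p) n * (z : ℂ) ^ n) p
      = (z : ℂ) ^ n • iteratedFDeriv ℝ s (fun p => coeff (a p) n) p := by
    rw [← iteratedFDeriv_const_smul_apply ((ha.1.1 n).of_le (by exact_mod_cast le_top)).contDiffAt]
    congr 1
    funext p
    simp [mul_comm]
  rw [this, norm_smul, norm_zpow_circle, one_mul]
  exact hC n p hp

variable [FiniteDimensional ℝ V]

theorem SmoothL.contDiff_apply (ha : SmoothL a) (z : Circle) :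
    ContDiff ℝ (⊤ : ℕ∞) fun p => a p z := by
  have := contDiff_tsum_of_isCompact _ (ha.term_aux z).1 (ha.term_aux z).2
  have hf : (fun p => ∑' n : ℤ, coeff (a p) n * (z : ℂ) ^ n) = fun p => a p z :=
    funext fun p => (ha.2 p z).tsum_eq
  rwa [hf] at this

theorem SmoothL.hasSum_dir (ha : SmoothL a) (w : V) (p : V) (z : Circle) :
    HasSum (fun n : ℤ => fderiv ℝ (fun q => coeff (a q) n) p w * (z : ℂ) ^ n) (dir w a p z) := by
  have h := hasFDerivAt_tsum_of_isCompact _ (ha.term_aux z).1 (ha.term_aux z).2 p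
  have hf : (fun p => ∑' n : ℤ, coeff (a p) n * (z : ℂ) ^ n) = fun p => a p z :=
    funext fun p => (ha.2 p z).tsum_eq
  rw [hf] at h
  obtain ⟨u, hu, hub⟩ := (ha.term_aux z).2 {p} isCompact_singleton 1
  have hs : Summable fun n : ℤ => fderiv ℝ (fun q => coeff (a q) n * (z : ℂ) ^ n) p := by
    refine Summable.of_norm_bounded hu fun n => ?_
    have := hub n p rfl
    rwa [← zero_add 1, ← norm_iteratedFDeriv_fderiv, norm_iteratedFDeriv_zero] at this
  have := hs.hasSum.mapL (ContinuousLinearMap.apply ℝ ℂ w)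
  rw [dir, h.fderiv]
  refine this.congr_fun fun n => ?_
  have hd : DifferentiableAt ℝ (fun q => coeff (a q) n) p := (ha.1.1 n).differentiable (by simp) p
  have := (hd.hasFDerivAt.mul_const ((z : ℂ) ^ n)).fderiv
  simp only [ContinuousLinearMap.apply_apply, this]
  simp [mul_comm]

theorem SmoothL.dir (ha : SmoothL a) (w : V) : SmoothL (dir w a) :=
  (ha.1.fderiv w).smoothL (ha.hasSum_dir w)

theorem SmoothL.coeff_dir (ha : SmoothL a) (w : V) (p : V) (n : ℤ) :
    coeff (Toda.dir w a p) n = _root_.fderiv ℝ (fun q => coeff (a q) n) p w :=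
  (ha.1.fderiv w).coeff_eq (ha.hasSum_dir w) p n

end SmoothL

/-! ### Holomorphy in the inner and the outer disk -/

section Holomorphy

variable {V : Type} [NormedAddCommGroup V] [NormedSpace ℝ V] {a : V → Circle → ℂ}

/-- The families holomorphic on the closed inner disk are the families holomorphic near the circle
that have no negative Laurent coefficients. -/
theorem smoothH0_iff :
    SmoothH0 a ↔ SmoothL a ∧ ∀ p, ∀ n < 0, coeff (a p) n = 0 := by
  constructor
  · rintro ⟨c, hc, hb, hs⟩
    have hg : GeoSmooth fun n p => if 0 ≤ n then c n.toNat p else 0 := by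
      refine ⟨fun n => ?_, fun K hK s => ?_⟩
      · by_cases h : 0 ≤ n
        · simpa only [if_pos h] using hc _
        · simpa only [if_neg h] using contDiff_const
      · obtain ⟨r, h0, h1, C, hC⟩ := hb K hK s
        refine ⟨r, h0, h1, |C|, fun n p hp => ?_⟩
        by_cases h : 0 ≤ n
        · simp only [if_pos h]
          refine (hC n.toNat p hp).trans ?_
          rw [show n.toNat = n.natAbs by omega]
          gcongr
          exact le_abs_self C
        · simp only [if_neg h]
          have : iteratedFDeriv ℝ s (fun _ : V => (0 : ℂ)) p = 0 := by
            simp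
          rw [this, norm_zero]
          positivity
    have hsum : ∀ p (z : Circle), HasSum
        (fun n : ℤ => (if 0 ≤ n then c n.toNat p else 0) * (z : ℂ) ^ n) (a p z) := by
      intro p z
      refine (Nat.cast_injective (R := ℤ).hasSum_iff (fun n hn => ?_)).1 ?_
      · rw [if_neg, zero_mul]
        exact fun h => hn ⟨n.toNat, by simp [h]⟩
      · simpa [Function.comp_def] using hs p z
    exact ⟨hg.smoothL hsum, fun p n hn => by rw [hg.coeff_eq hsum, if_neg (by omega)]⟩
  · rintro ⟨ha, h0⟩
    refine ⟨fun n p => coeff (a p) n, fun n => ha.1.1 n, fun K hK s => ?_, fun p z => ?_⟩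
    · obtain ⟨r, h0, h1, C, hC⟩ := ha.1.2 K hK s
      exact ⟨r, h0, h1, C, fun n p hp => by simpa using hC n p hp⟩
    · have := (Nat.cast_injective (R := ℤ).hasSum_iff (fun n hn => ?_)).2 (ha.2 p z)
      · simpa [Function.comp_def] using this
      · rw [h0 p n, zero_mul]
        by_contra h
        exact hn ⟨n.toNat, by simp at h ⊢; exact h⟩

theorem SmoothL.inv (ha : SmoothL a) : SmoothL fun p z => a p z⁻¹ := by
  have hg : GeoSmooth fun n p => coeff (a p) (-n) := by
    refine ⟨fun n => ha.1.1 (-n), fun K hK s => ?_⟩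
    obtain ⟨r, h0, h1, C, hC⟩ := ha.1.2 K hK s
    exact ⟨r, h0, h1, C, fun n p hp => by simpa using hC (-n) p hp⟩
  refine hg.smoothL fun p z => ?_
  refine ((Equiv.neg ℤ).hasSum_iff.1 ?_)
  refine (ha.2 p z⁻¹).congr_fun fun n => ?_
  simp [Function.comp]

/-- The families holomorphic on the closed outer disk are the families holomorphic near the circle
that have no positive Laurent coefficients. -/
theorem smoothHInf_iff :
    SmoothHInf a ↔ SmoothL a ∧ ∀ p, ∀ n > 0, coeff (a p) n = 0 := by
  rw [SmoothHInf, smoothH0_iff]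
  constructor
  · rintro ⟨h1, h2⟩
    refine ⟨by simpa using h1.inv, fun p n hn => ?_⟩
    have := h2 p (-n) (by omega)
    rwa [coeff_comp_inv, neg_neg] at this
  · rintro ⟨h1, h2⟩
    refine ⟨h1.inv, fun p n hn => ?_⟩
    rw [coeff_comp_inv]
    exact h2 p (-n) (by omega)

end Holomorphy

/-! ### Quadratic Poisson structures on a Poisson algebra with trace -/

/-- A commutative algebra of functions of `z` and `x`, abstractly: two commuting derivations
`D = z ∂/∂z` and `X = ∂/∂x`, and a trace killing their images. -/
structure PoissonTrace (B C : Type*) [CommRing B] [CommRing C] where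
  D : B →+ B
  X : B →+ B
  tr : B →+ C
  D_mul : ∀ f g, D (f * g) = D f * g + f * D g
  X_mul : ∀ f g, X (f * g) = X f * g + f * X g
  D_X : ∀ f, D (X f) = X (D f)
  tr_D : ∀ f, tr (D f) = 0
  tr_X : ∀ f, tr (X f) = 0

/-- The data of a quadratic Poisson structure on a Poisson algebra with trace: an operator `R`
with adjoint `Rs` that commutes with `D` and solves the modified Yang–Baxter equation, and a
self-adjoint operator `Z` with values in the kernel of `D`, over which `R` is linear. -/
structure QuadraticData (B C : Type*) [CommRing B] [CommRing C] extends PoissonTrace B C where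
  R : B →+ B
  Rs : B →+ B
  Z : B →+ B
  R_adj : ∀ f g, tr (R f * g) = tr (f * Rs g)
  R_D : ∀ f, R (D f) = D (R f)
  yangBaxter : ∀ a b, R ((D (R a) * X b - D b * X (R a)) + (D a * X (R b) - D (R b) * X a))
    = (D (R a) * X (R b) - D (R b) * X (R a)) + (D a * X b - D b * X a)
  Z_adj : ∀ f g, tr (Z f * g) = tr (f * Z g)
  D_Z : ∀ f, D (Z f) = 0
  X_Z : ∀ f, X (Z f) = Z (X f)
  R_mul_Z : ∀ f g, R (f * Z g) = R f * Z g

namespace PoissonTrace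

variable {B C : Type*} [CommRing B] [CommRing C] (S : PoissonTrace B C)

/-- The Poisson bracket `{f, g} = z f_z g_x - z g_z f_x`. -/
def br (f g : B) : B := S.D f * S.X g - S.D g * S.X f

theorem br_add_left (f f' g : B) : S.br (f + f') g = S.br f g + S.br f' g := by
  simp only [br, map_add]; ring

theorem br_add_right (f g g' : B) : S.br f (g + g') = S.br f g + S.br f g' := by
  simp only [br, map_add]; ring

theorem br_skew (f g : B) : S.br f g = -S.br g f := by
  simp only [br]; ring

theorem tr_br (f g : B) : S.tr (S.br f g) = 0 := by
  have : S.br f g = S.D (f * S.X g) - S.X (f * S.D g) := by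
    simp only [br, S.D_mul, S.X_mul, S.D_X]; ring
  rw [this, map_sub, S.tr_D, S.tr_X, sub_zero]

/-- The invariance of the trace. -/
theorem tr_mul_br (f g h : B) : S.tr (f * S.br g h) = S.tr (S.br f g * h) := by
  rw [← sub_eq_zero, ← map_sub]
  have : f * S.br g h - S.br f g * h = S.X (f * S.D g * h) - S.D (f * S.X g * h) := by
    simp only [br, S.D_mul, S.X_mul, S.D_X]; ring
  rw [this, map_sub, S.tr_D, S.tr_X, sub_zero]

end PoissonTrace

namespace QuadraticData

variable {B C : Type*} [CommRing B] [CommRing C] (S : QuadraticData B C)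

/-- `R(L o) + φ`, where `φ = Z(z L' o)`. -/
def rho (L o : B) : B := S.R (L * o) + S.Z (S.D L * o)

/-- `R*{L, o}`. -/
def sig (L o : B) : B := S.Rs (S.br L o)

/-- The quadratic Poisson tensor at `L`, applied to the covector `o`. -/
def ham (L o : B) : B := S.br L (S.rho L o) + L * S.sig L o

/-- The derivative of the Poisson tensor at `L` in the direction `α`, applied to `o`. -/
def hamDeriv (L α o : B) : B :=
  S.br α (S.rho L o) + S.br L (S.rho α o) + (α * S.sig L o + L * S.sig α o)

/-- The differential at `L` of the function `L ↦ ⟨o₁, P(o₂)⟩`. -/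
def cov (L o₁ o₂ : B) : B :=
  S.br o₂ (S.rho L o₁) - S.br o₁ (S.rho L o₂) + (o₁ * S.sig L o₂ - o₂ * S.sig L o₁)

theorem rho_add_left (L L' o : B) : S.rho (L + L') o = S.rho L o + S.rho L' o := by
  simp only [rho, add_mul, map_add]; ring

theorem sig_add_left (L L' o : B) : S.sig (L + L') o = S.sig L o + S.sig L' o := by
  simp only [sig, S.br_add_left, map_add]

theorem cov_add_left (L L' o₁ o₂ : B) :
    S.cov (L + L') o₁ o₂ = S.cov L o₁ o₂ + S.cov L' o₁ o₂ := by
  simp only [cov, rho_add_left, sig_add_left, S.br_add_right]; ring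

theorem tr_mul_ham (L o₁ o₂ : B) : S.tr (o₁ * S.ham L o₂) =
    S.tr (L * S.br o₂ (S.R (L * o₁))) - S.tr (L * S.br o₁ (S.R (L * o₂)))
      + S.tr (S.D L * o₁ * S.X (S.Z (S.D L * o₂))) := by
  have h1 := S.R_adj (L * o₁) (S.br L o₂)
  have h2 := S.tr_mul_br o₁ L (S.R (L * o₂))
  have h3 := S.tr_mul_br L o₁ (S.R (L * o₂))
  have h4 := S.tr_mul_br L o₂ (S.R (L * o₁))
  have e : o₁ * S.ham L o₂ = o₁ * S.br L (S.R (L * o₂)) + L * o₁ * S.Rs (S.br L o₂)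
      + S.D L * o₁ * S.X (S.Z (S.D L * o₂)) := by
    simp only [ham, rho, sig, PoissonTrace.br, map_add, S.D_Z]; ring
  rw [S.br_skew o₁ L, neg_mul, map_neg] at h2
  rw [e, map_add, map_add, ← h1, h2, h3, h4, mul_comm (S.R _)]
  ring

/-- Skew-symmetry of the quadratic Poisson tensor. -/
theorem tr_mul_ham_skew (L o₁ o₂ : B) : S.tr (o₁ * S.ham L o₂) = -S.tr (o₂ * S.ham L o₁) := by
  rw [tr_mul_ham, tr_mul_ham]
  have h1 : S.tr (S.D L * o₁ * S.X (S.Z (S.D L * o₂)))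
      = -S.tr (S.D L * o₂ * S.X (S.Z (S.D L * o₁))) := by
    rw [S.X_Z, ← S.Z_adj, eq_neg_iff_add_eq_zero, ← map_add]
    have : S.Z (S.D L * o₁) * S.X (S.D L * o₂) + S.D L * o₂ * S.X (S.Z (S.D L * o₁))
        = S.X (S.Z (S.D L * o₁) * (S.D L * o₂)) := by
      simp only [S.X_mul]; ring
    rw [this, S.tr_X]
  rw [h1]; ring

/-- `cov` is the differential of `L ↦ ⟨o₁, P(o₂)⟩`. -/
theorem tr_mul_hamDeriv (L α o₁ o₂ : B) :
    S.tr (o₁ * S.hamDeriv L α o₂) = S.tr (α * S.cov L o₁ o₂) := by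
  set r := S.R (α * o₂) with hr
  set p := S.R (L * o₁) with hp
  set f := S.Z (S.D L * o₁) with hf
  have h1 := S.R_adj (L * o₁) (S.br α o₂)
  have h2 := S.R_adj (α * o₂) (S.br L o₁)
  have h3 := S.Z_adj (S.D L * o₁) (S.X (S.D α * o₂))
  rw [← sub_eq_zero, ← map_sub] at h1 h2 h3 ⊢
  have hXf : S.D (S.X f) = 0 := by rw [S.D_X, hf, S.D_Z, map_zero]
  -- `o₁ P'(o₂) - α cov` is a sum of total derivatives and of adjunction defects of `R` and `Z`
  have key : o₁ * S.hamDeriv L α o₂ - α * S.cov L o₁ o₂ =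
      S.br (α * o₁) (S.rho L o₂) + S.br L (o₁ * r) + S.br (α * p) o₂
      + S.X (f * (S.D α * o₂)) - S.D (α * o₂ * S.X f)
      - (r * S.br L o₁ - α * o₂ * S.Rs (S.br L o₁))
      - (p * S.br α o₂ - L * o₁ * S.Rs (S.br α o₂))
      - (f * S.X (S.D α * o₂) - S.D L * o₁ * S.Z (S.X (S.D α * o₂))) := by
    have e1 : S.rho L o₁ = p + f := rfl
    have e2 : S.rho α o₂ = r + S.Z (S.D α * o₂) := rfl
    simp only [hamDeriv, cov, sig, e1, e2, ← S.X_Z]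
    simp only [PoissonTrace.br, map_add, S.D_mul, S.X_mul, S.D_Z, hXf,
      show S.D f = 0 from S.D_Z _]
    ring
  rw [key]
  simp only [map_add, map_sub, S.tr_br, S.tr_D, S.tr_X] at h1 h2 h3 ⊢
  linear_combination -h1 - h2 - h3

theorem R_br_Z (f g : B) : S.R (S.br f (S.Z g)) = S.br (S.R f) (S.Z g) := by
  simp only [PoissonTrace.br, S.D_Z, zero_mul, sub_zero, S.X_Z, S.R_mul_Z, S.R_D]

/-- The Yang–Baxter equation extended to `rho`: the summand `Z` takes values in the kernel of `D`,
and `R` is linear over these values. -/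
theorem R_cov_aux (L o₁ o₂ : B) :
    S.R (S.br (L * o₂) (S.rho L o₁) - S.br (L * o₁) (S.rho L o₂))
      = S.br (S.rho L o₂) (S.rho L o₁) + S.br (L * o₂) (L * o₁) := by
  have h := S.yangBaxter (L * o₂) (L * o₁)
  have e : S.br (L * o₂) (S.rho L o₁) - S.br (L * o₁) (S.rho L o₂) =
      ((S.D (S.R (L * o₂)) * S.X (L * o₁) - S.D (L * o₁) * S.X (S.R (L * o₂)))
        + (S.D (L * o₂) * S.X (S.R (L * o₁)) - S.D (S.R (L * o₁)) * S.X (L * o₂)))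
      + S.br (L * o₂) (S.Z (S.D L * o₁)) - S.br (L * o₁) (S.Z (S.D L * o₂)) := by
    simp only [rho, PoissonTrace.br, map_add]; ring
  rw [e, map_sub, map_add, h, R_br_Z, R_br_Z]
  simp only [rho, PoissonTrace.br, map_add, S.D_Z]; ring

/-- The Jacobi identity, in the form of the vanishing of the Schouten bracket `[P, P]` on three
covectors. -/
theorem schouten (L o₁ o₂ o₃ : B) :
    S.tr (S.cov L o₁ o₂ * S.ham L o₃) + S.tr (S.cov L o₂ o₃ * S.ham L o₁)
      + S.tr (S.cov L o₃ o₁ * S.ham L o₂) = 0 := by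
  have a1 := S.R_adj (S.br (L * o₃) (S.rho L o₂) - S.br (L * o₂) (S.rho L o₃)) (S.br L o₁)
  have a2 := S.R_adj (S.br (L * o₁) (S.rho L o₃) - S.br (L * o₃) (S.rho L o₁)) (S.br L o₂)
  have a3 := S.R_adj (S.br (L * o₂) (S.rho L o₁) - S.br (L * o₁) (S.rho L o₂)) (S.br L o₃)
  rw [R_cov_aux] at a1 a2 a3
  rw [← map_add, ← map_add]
  have key : S.cov L o₁ o₂ * S.ham L o₃ + S.cov L o₂ o₃ * S.ham L o₁ + S.cov L o₃ o₁ * S.ham L o₂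
      = ((S.br (L * o₃) (S.rho L o₂) - S.br (L * o₂) (S.rho L o₃)) * S.Rs (S.br L o₁)
          - (S.br (S.rho L o₃) (S.rho L o₂) + S.br (L * o₃) (L * o₂)) * S.br L o₁)
        + ((S.br (L * o₁) (S.rho L o₃) - S.br (L * o₃) (S.rho L o₁)) * S.Rs (S.br L o₂)
          - (S.br (S.rho L o₁) (S.rho L o₃) + S.br (L * o₁) (L * o₃)) * S.br L o₂)
        + ((S.br (L * o₂) (S.rho L o₁) - S.br (L * o₁) (S.rho L o₂)) * S.Rs (S.br L o₃)
          - (S.br (S.rho L o₂) (S.rho L o₁) + S.br (L * o₂) (L * o₁)) * S.br L o₃) := by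
    have hs : ∀ o, S.Rs (S.br L o) = S.sig L o := fun _ => rfl
    simp only [hs]
    simp only [cov, ham]
    generalize S.sig L o₁ = s₁
    generalize S.sig L o₂ = s₂
    generalize S.sig L o₃ = s₃
    generalize S.rho L o₁ = r₁
    generalize S.rho L o₂ = r₂
    generalize S.rho L o₃ = r₃
    simp only [PoissonTrace.br, S.D_mul, S.X_mul]
    ring
  rw [key]
  simp only [map_add, map_sub, a1, a2, a3, sub_self, add_zero]

/-- Shifting `L` by a constant changes the Poisson tensor affinely. -/
theorem ham_add_const (L e o : B) (hD : S.D e = 0) (hX : S.X e = 0) :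
    S.ham (L + e) o + S.ham (L - e) o = S.ham L o + S.ham L o := by
  have h0 : ∀ f, S.br e f = 0 := fun f => by simp [PoissonTrace.br, hD, hX]
  have hr : S.rho (L - e) o = S.rho L o - S.rho e o := by
    simp only [rho, sub_mul, map_sub]; ring
  have hb : ∀ f, S.br (L - e) f = S.br L f := fun f => by
    simp [PoissonTrace.br, hD, hX]
  simp only [ham, sig, S.br_add_left, h0, hb, rho_add_left, hr, add_zero]
  simp only [PoissonTrace.br, map_add, map_sub]; ring

/-- The mixed Schouten bracket of the Poisson tensors at `L` and at `L + e` vanishes for constant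
`e`: it is a combination of the Schouten brackets at `L - e`, `L` and `L + e`, since the tensor is
affine along this line. -/
theorem schouten_mixed (L e o₁ o₂ o₃ : B) (hD : S.D e = 0) (hX : S.X e = 0) :
    2 * (S.tr (S.cov L o₁ o₂ * S.ham (L + e) o₃) + S.tr (S.cov L o₂ o₃ * S.ham (L + e) o₁)
      + S.tr (S.cov L o₃ o₁ * S.ham (L + e) o₂)
      + S.tr (S.cov (L + e) o₁ o₂ * S.ham L o₃) + S.tr (S.cov (L + e) o₂ o₃ * S.ham L o₁)
      + S.tr (S.cov (L + e) o₃ o₁ * S.ham L o₂)) = 0 := by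
  have hh : ∀ o, S.ham (L - e) o = S.ham L o + S.ham L o - S.ham (L + e) o := fun o => by
    rw [← S.ham_add_const L e o hD hX]; ring
  have hc : ∀ o o', S.cov (L - e) o o' = S.cov L o o' + S.cov L o o' - S.cov (L + e) o o' := by
    intro o o'
    have := S.cov_add_left (L + e) (L - e) o o'
    rw [show L + e + (L - e) = L + L by ring, S.cov_add_left] at this
    rw [this]; ring
  have h1 := S.schouten (L - e) o₁ o₂ o₃
  have h2 := S.schouten L o₁ o₂ o₃
  have h3 := S.schouten (L + e) o₁ o₂ o₃
  simp only [hh, hc, add_mul, sub_mul, mul_add, mul_sub, map_add, map_sub] at h1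
  linear_combination -h1 + 4 * h2 + h3

end QuadraticData

theorem coeff_zero (n : ℤ) : coeff 0 n = 0 := by
  simpa using! coeff_const_mul 0 (fun _ => 0) n

/-! ### The algebra of Laurent families -/

section LF

variable (E : Type) [NormedAddCommGroup E] [NormedSpace ℝ E] [FiniteDimensional ℝ E]

/-- The algebra of families, smoothly parametrized by `E`, of functions of `x ∈ ℝ / 2πℤ` and `z`
that are smooth in `x` and holomorphic near the circle `|z| = 1`. -/
def laurentFamilies : Subalgebra ℂ (E × ℝ → Circle → ℂ) where
  carrier := {a | SmoothL a ∧ ∀ e x, a (e, x + 2 * Real.pi) = a (e, x)}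
  mul_mem' := fun ⟨h1, p1⟩ ⟨h2, p2⟩ => ⟨h1.mul h2, fun e x => by simp [p1 e x, p2 e x]⟩
  add_mem' := fun ⟨h1, p1⟩ ⟨h2, p2⟩ => ⟨h1.add h2, fun e x => by simp [p1 e x, p2 e x]⟩
  algebraMap_mem' := fun r => ⟨SmoothL.const r, fun _ _ => rfl⟩

/-- The type of elements of `laurentFamilies E`. -/
def LF : Type := laurentFamilies E

instance : CommRing (LF E) := inferInstanceAs (CommRing (laurentFamilies E))

instance : Algebra ℂ (LF E) := inferInstanceAs (Algebra ℂ (laurentFamilies E))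

variable {E}

namespace LF

variable (f g : LF E) (p : E × ℝ) (n : ℤ)

/-- The underlying family of functions. -/
def fn : E × ℝ → Circle → ℂ := f.1

/-- An element of the algebra, from a family of functions. -/
def mk (a : E × ℝ → Circle → ℂ) (h : SmoothL a)
    (hp : ∀ e x, a (e, x + 2 * Real.pi) = a (e, x)) : LF E := ⟨a, h, hp⟩

theorem smooth : SmoothL f.fn := f.2.1

theorem periodic (e : E) (x : ℝ) : f.fn (e, x + 2 * Real.pi) = f.fn (e, x) := f.2.2 e x

variable {f g} in
theorem ext_fn (h : f.fn = g.fn) : f = g := Subtype.ext h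

theorem fn_add : (f + g).fn p = f.fn p + g.fn p := rfl

theorem fn_sub : (f - g).fn p = f.fn p - g.fn p := rfl

theorem fn_neg : (-f).fn p = -f.fn p := rfl

theorem fn_mul : (f * g).fn p = f.fn p * g.fn p := rfl

theorem fn_smul (c : ℂ) : (c • f).fn p = c • f.fn p := rfl

theorem fn_pow (k : ℕ) : (f ^ k).fn p = f.fn p ^ k := rfl

/-- The Laurent coefficient of `zⁿ`. -/
def cf : ℂ := coeff (f.fn p) n

variable {f g} in
theorem ext_cf (h : ∀ p n, cf f p n = cf g p n) : f = g :=
  ext_fn (funext fun p => f.smooth.ext_coeff g.smooth (h p))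

theorem cf_add : cf (f + g) p n = cf f p n + cf g p n := f.smooth.coeff_add g.smooth p n

theorem cf_smul (c : ℂ) : cf (c • f) p n = c * cf f p n := coeff_const_mul c _ n

theorem cf_neg : cf (-f) p n = -cf f p n := by
  rw [← neg_one_smul ℂ f, cf_smul]; ring

theorem cf_sub : cf (f - g) p n = cf f p n - cf g p n := by
  rw [sub_eq_add_neg, cf_add, cf_neg]; ring

theorem cf_zero : cf (0 : LF E) p n = 0 := coeff_zero n

theorem cf_mul : cf (f * g) p n = ∑' k : ℤ, cf f p k * cf g p (n - k) :=
  f.smooth.coeff_mul g.smooth p n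

theorem cf_one : cf (1 : LF E) p n = if n = 0 then 1 else 0 := by
  have := coeff_monomial 1 0 n
  simp only [zpow_zero, mul_one] at this
  exact this

theorem contDiff_cf : ContDiff ℝ (⊤ : ℕ∞) fun p => cf f p n := f.smooth.contDiff_coeff n

/-- The directional derivative of a family. -/
def dirL (w : E × ℝ) : LF E →ₗ[ℂ] LF E where
  toFun f := mk (dir w f.fn) (f.smooth.dir w) fun e x => by
    funext z
    have h : (fun q : E × ℝ => f.fn (q + (0, 2 * Real.pi)) z) = fun q => f.fn q z :=
      funext fun q => by
        have := congrFun (f.periodic q.1 q.2) z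
        simpa [Prod.add_def] using this
    have := fderiv_comp_add_right (𝕜 := ℝ) (f := fun q => f.fn q z) (x := (e, x))
      (0, 2 * Real.pi)
    rw [h] at this
    simp only [dir, this]
    simp
  map_add' f g := by
    refine ext_fn (funext fun p => funext fun z => ?_)
    have hf := (f.smooth.contDiff_apply z).differentiable (by simp) p
    have hg := (g.smooth.contDiff_apply z).differentiable (by simp) p
    exact congrArg (fun A => A w) (fderiv_add hf hg)
  map_smul' c f := by
    refine ext_fn (funext fun p => funext fun z => ?_)
    have hf := (f.smooth.contDiff_apply z).differentiable (by simp) p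
    exact congrArg (fun A => A w) (fderiv_const_smul hf c)

theorem cf_dirL (w : E × ℝ) : cf (dirL w f) p n = fderiv ℝ (fun q => cf f q n) p w :=
  f.smooth.coeff_dir w p n

theorem dirL_mul (w : E × ℝ) : dirL w (f * g) = dirL w f * g + f * dirL w g := by
  refine ext_fn (funext fun p => funext fun z => ?_)
  have hf := (f.smooth.contDiff_apply z).differentiable (by simp) p
  have hg := (g.smooth.contDiff_apply z).differentiable (by simp) p
  have := congrArg (fun A => A w) (fderiv_mul hf hg)
  refine this.trans ?_
  simp only [add_apply, smul_apply, smul_eq_mul]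
  exact (add_comm _ _).trans (congrArg (· + _) (mul_comm _ _))

/-- A linear operator that multiplies the coefficient of `zⁿ` by `m n`. -/
def ofMultiplier (T : LF E → LF E) (m : ℤ → ℂ) (h : ∀ f p n, cf (T f) p n = m n * cf f p n) :
    LF E →ₗ[ℂ] LF E where
  toFun := T
  map_add' f g := ext_cf fun p n => by simp only [h, cf_add]; ring
  map_smul' c f := ext_cf fun p n => by simp only [h, cf_smul, RingHom.id_apply]; ring

/-- The operator `z ∂/∂z`. -/
def D : LF E →ₗ[ℂ] LF E :=
  ofMultiplier (fun f => mk (fun p => zD (f.fn p)) f.smooth.zD fun e x => by rw [f.periodic])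
    (fun n => n) fun f p n => f.smooth.coeff_zD p n

theorem fn_D : (D f).fn p = zD (f.fn p) := rfl

theorem cf_D : cf (D f) p n = n * cf f p n := f.smooth.coeff_zD p n

/-- The projection `(·)_{≥ k}`. -/
def ge (k : ℤ) : LF E →ₗ[ℂ] LF E :=
  ofMultiplier (fun f => mk (fun p => projGE k (f.fn p)) (f.smooth.projGE k)
      fun e x => by rw [f.periodic])
    (fun n => if k ≤ n then 1 else 0) fun f p n => by
      rw [ite_mul, one_mul, zero_mul]; exact f.smooth.coeff_projGE k p n

theorem fn_ge (k : ℤ) : (ge k f).fn p = projGE k (f.fn p) := rfl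

theorem cf_ge (k : ℤ) : cf (ge k f) p n = if k ≤ n then cf f p n else 0 :=
  f.smooth.coeff_projGE k p n

/-- The projection `(·)_{≤ k}`. -/
def le (k : ℤ) : LF E →ₗ[ℂ] LF E :=
  ofMultiplier (fun f => mk (fun p => projLE k (f.fn p)) (f.smooth.projLE k)
      fun e x => by rw [f.periodic])
    (fun n => if n ≤ k then 1 else 0) fun f p n => by
      rw [ite_mul, one_mul, zero_mul]; exact f.smooth.coeff_projLE k p n

theorem fn_le (k : ℤ) : (le k f).fn p = projLE k (f.fn p) := rfl

theorem cf_le (k : ℤ) : cf (le k f) p n = if n ≤ k then cf f p n else 0 :=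
  f.smooth.coeff_projLE k p n

theorem ge_eq_sub (k : ℤ) : ge k f = f - le (k - 1) f := ext_cf fun p n => by
  rw [cf_ge, cf_sub, cf_le]
  split_ifs <;> first | omega | simp

/-- The constant term in `z`. -/
def pz : LF E →ₗ[ℂ] LF E := (le 0).comp (ge 0)

theorem cf_pz : cf (pz f) p n = if n = 0 then cf f p n else 0 := by
  rw [pz, LinearMap.comp_apply, cf_le, cf_ge]
  split_ifs <;> first | omega | rfl

/-- The element `g zᵏ`, where `g` depends on `x` and on the parameters. -/
def mono (k : ℤ) (g : E × ℝ → ℂ) (hg : ContDiff ℝ (⊤ : ℕ∞) g)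
    (hp : ∀ e x, g (e, x + 2 * Real.pi) = g (e, x)) : LF E :=
  mk (fun p z => g p * (z : ℂ) ^ k) (SmoothL.monomial hg k) fun e x => by simp only [hp]

theorem cf_mono (k : ℤ) (u : E × ℝ → ℂ) (hg : ContDiff ℝ (⊤ : ℕ∞) u)
    (hp : ∀ e x, u (e, x + 2 * Real.pi) = u (e, x)) :
    cf (mono k u hg hp) p n = if n = k then u p else 0 := coeff_monomial _ _ _

/-- Functions without Laurent coefficients above degree `k`. -/
def Le (k : ℤ) (f : LF E) : Prop := ∀ p, ∀ n > k, cf f p n = 0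

/-- Functions without Laurent coefficients below degree `k`. -/
def Ge (k : ℤ) (f : LF E) : Prop := ∀ p, ∀ n < k, cf f p n = 0

variable {f g} {k l : ℤ}

theorem Le.add (hf : Le k f) (hg : Le k g) : Le k (f + g) := fun p n hn => by
  rw [cf_add, hf p n hn, hg p n hn, add_zero]

theorem Ge.add (hf : Ge k f) (hg : Ge k g) : Ge k (f + g) := fun p n hn => by
  rw [cf_add, hf p n hn, hg p n hn, add_zero]

theorem Le.neg (hf : Le k f) : Le k (-f) := fun p n hn => by rw [cf_neg, hf p n hn, neg_zero]

theorem Ge.neg (hf : Ge k f) : Ge k (-f) := fun p n hn => by rw [cf_neg, hf p n hn, neg_zero]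

theorem Le.sub (hf : Le k f) (hg : Le k g) : Le k (f - g) := sub_eq_add_neg f g ▸ hf.add hg.neg

theorem Ge.sub (hf : Ge k f) (hg : Ge k g) : Ge k (f - g) := sub_eq_add_neg f g ▸ hf.add hg.neg

theorem Le.smul (hf : Le k f) (c : ℂ) : Le k (c • f) := fun p n hn => by
  rw [cf_smul, hf p n hn, mul_zero]

theorem Ge.smul (hf : Ge k f) (c : ℂ) : Ge k (c • f) := fun p n hn => by
  rw [cf_smul, hf p n hn, mul_zero]

theorem Le.mono (hf : Le k f) (h : k ≤ l) : Le l f := fun p n hn => hf p n (by omega)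

theorem Ge.mono (hf : Ge k f) (h : l ≤ k) : Ge l f := fun p n hn => hf p n (by omega)

theorem Le.mul (hf : Le k f) (hg : Le l g) : Le (k + l) (f * g) := fun p n hn => by
  rw [cf_mul]
  refine (tsum_congr fun j => ?_).trans tsum_zero
  by_cases h : j > k
  · rw [hf p j h, zero_mul]
  · rw [hg p (n - j) (by omega), mul_zero]

theorem Ge.mul (hf : Ge k f) (hg : Ge l g) : Ge (k + l) (f * g) := fun p n hn => by
  rw [cf_mul]
  refine (tsum_congr fun j => ?_).trans tsum_zero
  by_cases h : j < k
  · rw [hf p j h, zero_mul]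
  · rw [hg p (n - j) (by omega), mul_zero]

theorem Le.D (hf : Le k f) : Le k (D f) := fun p n hn => by rw [cf_D, hf p n hn, mul_zero]

theorem Ge.D (hf : Ge k f) : Ge k (D f) := fun p n hn => by rw [cf_D, hf p n hn, mul_zero]

theorem Le.dirL (hf : Le k f) (w : E × ℝ) : Le k (dirL w f) := fun p n hn => by
  rw [cf_dirL, show (fun q => cf f q n) = fun _ => 0 from funext fun q => hf q n hn]
  simp

theorem Ge.dirL (hf : Ge k f) (w : E × ℝ) : Ge k (dirL w f) := fun p n hn => by
  rw [cf_dirL, show (fun q => cf f q n) = fun _ => 0 from funext fun q => hf q n hn]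
  simp

theorem Le.le (f : LF E) (k : ℤ) : Le k (le k f) := fun p n hn => by
  rw [cf_le, if_neg (by omega)]

theorem Ge.ge (f : LF E) (k : ℤ) : Ge k (ge k f) := fun p n hn => by
  rw [cf_ge, if_neg (by omega)]

theorem Le.pz (f : LF E) : Le 0 (pz f) := fun p n hn => by rw [cf_pz, if_neg (by omega)]

theorem Ge.pz (f : LF E) : Ge 0 (pz f) := fun p n hn => by rw [cf_pz, if_neg (by omega)]

theorem Le.le_eq (hf : Le k f) (h : k ≤ l) : LF.le l f = f := ext_cf fun p n => by
  rw [cf_le]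
  split_ifs with h1
  · rfl
  · rw [hf p n (by omega)]

theorem Ge.ge_eq (hf : Ge k f) (h : l ≤ k) : LF.ge l f = f := ext_cf fun p n => by
  rw [cf_ge]
  split_ifs with h1
  · rfl
  · rw [hf p n (by omega)]

theorem Ge.le_eq (hf : Ge k f) (h : l < k) : LF.le l f = 0 := ext_cf fun p n => by
  rw [cf_le, cf_zero]
  split_ifs with h1
  · rw [hf p n (by omega)]
  · rfl

theorem Le.ge_eq (hf : Le k f) (h : k < l) : LF.ge l f = 0 := ext_cf fun p n => by
  rw [cf_ge, cf_zero]
  split_ifs with h1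
  · rw [hf p n (by omega)]
  · rfl

theorem Ge.pz_eq (hf : Ge k f) (h : 0 < k) : LF.pz f = 0 := ext_cf fun p n => by
  rw [cf_pz, cf_zero]
  split_ifs with h1
  · rw [hf p n (by omega)]
  · rfl

theorem Le.pz_eq (hf : Le k f) (h : k < 0) : LF.pz f = 0 := ext_cf fun p n => by
  rw [cf_pz, cf_zero]
  split_ifs with h1
  · rw [hf p n (by omega)]
  · rfl

theorem le_add_ge (f : LF E) (k : ℤ) : le k f + ge (k + 1) f = f := ext_cf fun p n => by
  rw [cf_add, cf_le, cf_ge]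
  split_ifs <;> first | omega | simp

theorem neg_add_nonneg (f : LF E) : le (-1) f + ge 0 f = f := le_add_ge f (-1)

theorem D_dirL (f : LF E) (w : E × ℝ) : D (dirL w f) = dirL w (D f) := ext_cf fun p n => by
  rw [cf_D, cf_dirL, cf_dirL]
  simp only [cf_D]
  rw [fderiv_const_mul ((f.contDiff_cf n).differentiable (by simp) p)]
  rfl

theorem le_dirL (f : LF E) (w : E × ℝ) : le k (dirL w f) = dirL w (le k f) := ext_cf fun p n => by
  rw [cf_le, cf_dirL, cf_dirL]
  simp only [cf_le]
  split_ifs <;> simp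

theorem ge_dirL (f : LF E) (w : E × ℝ) : ge k (dirL w f) = dirL w (ge k f) := ext_cf fun p n => by
  rw [cf_ge, cf_dirL, cf_dirL]
  simp only [cf_ge]
  split_ifs <;> simp

theorem pz_dirL (f : LF E) (w : E × ℝ) : pz (dirL w f) = dirL w (pz f) := by
  rw [pz, LinearMap.comp_apply, ge_dirL, le_dirL]; rfl

theorem le_D (f : LF E) : le k (D f) = D (le k f) := ext_cf fun p n => by
  simp only [cf_le, cf_D]; split_ifs <;> simp

theorem ge_D (f : LF E) : ge k (D f) = D (ge k f) := ext_cf fun p n => by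
  simp only [cf_ge, cf_D]; split_ifs <;> simp

theorem D_pz (f : LF E) : D (pz f) = 0 := ext_cf fun p n => by
  simp only [cf_pz, cf_D, cf_zero]; split_ifs with h <;> simp [h]

theorem pz_D (f : LF E) : pz (D f) = 0 := ext_cf fun p n => by
  simp only [cf_pz, cf_D, cf_zero]; split_ifs with h <;> simp [h]

theorem dirL_comm (f : LF E) (v w : E × ℝ) : dirL v (dirL w f) = dirL w (dirL v f) :=
  ext_cf fun p n => by
    have hc : ContDiff ℝ (⊤ : ℕ∞) fun q => cf f q n := f.contDiff_cf n
    have hd : DifferentiableAt ℝ (fderiv ℝ fun q => cf f q n) p :=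
      (hc.fderiv_right (m := (⊤ : ℕ∞)) (by simp)).differentiable (by simp) p
    simp only [cf_dirL]
    rw [fderiv_clm_apply hd (by fun_prop), fderiv_clm_apply hd (by fun_prop)]
    have hs := (hc.contDiffAt (x := p)).isSymmSndFDerivAt (by simp; exact WithTop.coe_le_coe.2 le_top)
    simp only [fderiv_fun_const, Pi.zero_apply, ContinuousLinearMap.comp_zero, zero_add,
      ContinuousLinearMap.flip_apply]
    exact hs.eq v w

theorem le_mul_pz (f g : LF E) : le k (f * pz g) = le k f * pz g := by
  have h1 := ((Le.le f k).mul (Le.pz g)).le_eq (l := k) (by omega)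
  have h2 := ((Ge.ge f (k + 1)).mul (Ge.pz g)).le_eq (l := k) (by omega)
  conv_lhs => rw [← le_add_ge f k, add_mul, map_add, h1, h2, add_zero]

theorem ge_mul_pz (f g : LF E) : ge k (f * pz g) = ge k f * pz g := by
  rw [ge_eq_sub, ge_eq_sub, le_mul_pz]; ring

/-- The Leibniz rule for `z ∂/∂z`, read off from the Laurent coefficients of the product. -/
theorem D_mul (f g : LF E) : D (f * g) = D f * g + f * D g := by
  refine ext_cf fun p n => ?_
  have hs : ∀ a b : LF E, Summable fun k : ℤ => cf a p k * cf b p (n - k) := fun a b => by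
    have h1 := a.smooth.summable p
    refine Summable.of_norm_bounded (h1.mul_right (∑' m, ‖cf b p m‖)) fun k => ?_
    rw [norm_mul]
    exact mul_le_mul_of_nonneg_left
      ((b.smooth.summable p).le_tsum (n - k) fun _ _ => norm_nonneg _) (norm_nonneg _)
  rw [cf_D, cf_add, cf_mul, cf_mul, cf_mul, ← (hs _ _).tsum_add (hs _ _), ← tsum_mul_left]
  refine tsum_congr fun k => ?_
  rw [cf_D, cf_D]
  push_cast
  ring

end LF
end LF

/-! ### The trace and the Poisson bracket -/

section Trace

variable {E : Type} [NormedAddCommGroup E] [NormedSpace ℝ E]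

theorem continuous_intervalIntegral_of_contDiff {G : E × ℝ → ℂ} (hG : ContDiff ℝ (⊤ : ℕ∞) G)
    (a b : ℝ) : Continuous fun e => ∫ x in a..b, G (e, x) :=
  intervalIntegral.continuous_parametric_intervalIntegral_of_continuous'
    (f := fun e x => G (e, x)) hG.continuous a b

variable [FiniteDimensional ℝ E]

/-- Differentiation under the integral sign over a compact interval. -/
theorem hasFDerivAt_intervalIntegral_of_contDiff {G : E × ℝ → ℂ} (hG : ContDiff ℝ (⊤ : ℕ∞) G)
    (a b : ℝ) (e : E) :
    HasFDerivAt (fun e => ∫ x in a..b, G (e, x))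
      (∫ x in a..b, (fderiv ℝ G (e, x)).comp (ContinuousLinearMap.inl ℝ E ℝ)) e := by
  have hG1 : Continuous fun p : E × ℝ => (fderiv ℝ G p).comp (ContinuousLinearMap.inl ℝ E ℝ) :=
    (hG.continuous_fderiv (by simp)).clm_comp continuous_const
  obtain ⟨C, hC⟩ := ((isCompact_closedBall e 1).prod (isCompact_uIcc (a := a) (b := b))
    ).exists_bound_of_continuousOn hG1.continuousOn
  refine intervalIntegral.hasFDerivAt_integral_of_dominated_of_fderiv_le (μ := MeasureTheory.volume)
    (𝕜 := ℝ) (bound := fun _ => C)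
    (F' := fun e x => (fderiv ℝ G (e, x)).comp (ContinuousLinearMap.inl ℝ E ℝ))
    (Metric.ball_mem_nhds e one_pos) ?_ ?_ ?_ ?_ ?_ ?_
  · exact Filter.Eventually.of_forall fun e' =>
      (hG.continuous.comp (by fun_prop)).aestronglyMeasurable
  · exact (hG.continuous.comp (by fun_prop)).intervalIntegrable _ _
  · exact (hG1.comp (by fun_prop : Continuous fun x : ℝ => (e, x))).aestronglyMeasurable
  · exact Filter.Eventually.of_forall fun x hx e' he' =>
      hC (e', x) ⟨Metric.ball_subset_closedBall he', Set.uIoc_subset_uIcc hx⟩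
  · simp
  · refine Filter.Eventually.of_forall fun x _ e' _ => ?_
    have h1 : HasFDerivAt G (fderiv ℝ G (e', x)) (e', x) :=
      (hG.differentiable (by simp) _).hasFDerivAt
    exact h1.comp e' (hasFDerivAt_prodMk_left e' x)

namespace LF

variable (f g : LF E)

/-- The derivative `∂/∂x`. -/
def X : LF E →ₗ[ℂ] LF E := dirL (0, 1)

/-- The trace `(2πi)⁻¹ ∮∮ f dz/z dx`, a function of the parameters. -/
def tr : LF E →+ (E → ℂ) where
  toFun f e := ∫ x in (0 : ℝ)..2 * Real.pi, cf f (e, x) 0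
  map_zero' := by simp only [cf_zero]; simp; rfl
  map_add' f g := by
    funext e
    simp only [cf_add, Pi.add_apply]
    exact intervalIntegral.integral_add
      (((f.contDiff_cf 0).continuous.comp (by fun_prop)).intervalIntegrable _ _)
      (((g.contDiff_cf 0).continuous.comp (by fun_prop)).intervalIntegrable _ _)

theorem tr_apply (e : E) : tr f e = ∫ x in (0 : ℝ)..2 * Real.pi, cf f (e, x) 0 := rfl

theorem tr_smul (c : ℂ) : tr (c • f) = c • tr f := by
  funext e
  simp only [tr_apply, cf_smul, Pi.smul_apply, smul_eq_mul]
  exact intervalIntegral.integral_const_mul _ _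

theorem continuous_tr : Continuous (tr f) :=
  continuous_intervalIntegral_of_contDiff (f.contDiff_cf 0) _ _

theorem exists_hasFDerivAt_tr (e : E) : ∃ A : E →L[ℝ] ℂ, HasFDerivAt (tr f) A e ∧
    ∀ v, A v = tr (dirL (v, 0) f) e := by
  refine ⟨_, hasFDerivAt_intervalIntegral_of_contDiff (f.contDiff_cf 0) _ _ e, fun v => ?_⟩
  have hG1 : Continuous fun x : ℝ => (fderiv ℝ (fun p => cf f p 0) (e, x)).comp
      (ContinuousLinearMap.inl ℝ E ℝ) :=
    (((f.contDiff_cf 0).continuous_fderiv (by simp)).comp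
      (by fun_prop : Continuous fun x : ℝ => (e, x))).clm_comp continuous_const
  rw [ContinuousLinearMap.intervalIntegral_apply (hG1.intervalIntegrable _ _), tr_apply]
  refine intervalIntegral.integral_congr fun x _ => ?_
  simp only [cf_dirL]
  rfl

theorem hasDerivAt_cf_x (f : LF E) (e : E) (x : ℝ) (n : ℤ) :
    HasDerivAt (fun y => cf f (e, y) n) (cf (X f) (e, x) n) x := by
  have h1 := ((f.contDiff_cf n).differentiable (by simp) (e, x)).hasFDerivAt
  have h2 : HasDerivAt (fun y : ℝ => (e, y)) ((0 : E), (1 : ℝ)) x :=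
    (hasDerivAt_const x e).prodMk (hasDerivAt_id x)
  have := h1.comp_hasDerivAt x h2
  rw [X, cf_dirL]
  exact this

theorem tr_X : tr (X f) = 0 := by
  funext e
  rw [tr_apply, intervalIntegral.integral_eq_sub_of_hasDerivAt (f := fun x => cf f (e, x) 0)
    (fun x _ => hasDerivAt_cf_x f e x 0)
    ((((X f).contDiff_cf 0).continuous.comp (by fun_prop)).intervalIntegrable _ _)]
  have := f.periodic e 0
  rw [zero_add] at this
  simp only [cf, this, sub_self, Pi.zero_apply]

theorem tr_D : tr (D f) = 0 := by
  funext e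
  simp [tr_apply, cf_D]

variable {f g} {k l : ℤ}

theorem Le.tr_eq_zero (hf : Le k f) (h : k < 0) : tr f = 0 := by
  funext e
  simp [tr_apply, hf _ 0 h]

theorem Ge.tr_eq_zero (hf : Ge k f) (h : 0 < k) : tr f = 0 := by
  funext e
  simp [tr_apply, hf _ 0 h]

variable (f g)

theorem tr_mul_ge (k : ℤ) : tr (ge k f * g) = tr (f * le (-k) g) := by
  have e : ge k f * g - f * le (-k) g
      = ge k f * ge (-k + 1) g - le (k - 1) f * le (-k) g := by
    have h1 := le_add_ge f (k - 1)
    have h2 := le_add_ge g (-k)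
    rw [sub_add_cancel] at h1
    linear_combination le (-k) g * h1 - ge k f * h2
  rw [← sub_eq_zero, ← map_sub, e, map_sub,
    ((Ge.ge f k).mul (Ge.ge g (-k + 1))).tr_eq_zero (by omega),
    ((Le.le f (k - 1)).mul (Le.le g (-k))).tr_eq_zero (by omega), sub_zero]

theorem tr_mul_le (k : ℤ) : tr (le k f * g) = tr (f * ge (-k) g) := by
  rw [mul_comm f, tr_mul_ge, neg_neg, mul_comm]

theorem tr_mul_pz : tr (pz f * g) = tr (f * pz g) := by
  have : ∀ h : LF E, pz h = le 0 (ge 0 h) := fun _ => rfl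
  have h2 : pz g = ge 0 (le 0 g) := ext_cf fun p n => by
    rw [cf_pz, cf_ge, cf_le]; split_ifs <;> first | omega | rfl
  have h3 := tr_mul_le (ge 0 f) g 0
  have h4 := tr_mul_ge f (ge 0 g) 0
  rw [neg_zero] at h3 h4
  rw [this f, h3, h4, ← this]

/-- The bracket `{f, g}`. -/
def br : LF E := D f * X g - D g * X f

theorem X_mul : X (f * g) = X f * g + f * X g := dirL_mul f g _

theorem D_X : D (X f) = X (D f) := D_dirL f _

theorem pz_X : pz (X f) = X (pz f) := pz_dirL f _

variable {f g}

theorem Le.br (hf : Le k f) (hg : Le l g) : Le (k + l) (br f g) :=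
  (hf.D.mul (hg.dirL _)).sub (add_comm k l ▸ hg.D.mul (hf.dirL _))

theorem Ge.br (hf : Ge k f) (hg : Ge l g) : Ge (k + l) (br f g) :=
  (hf.D.mul (hg.dirL _)).sub (add_comm k l ▸ hg.D.mul (hf.dirL _))

theorem br_add_left (f f' g : LF E) : LF.br (f + f') g = LF.br f g + LF.br f' g := by
  simp only [LF.br, map_add]; ring

theorem br_add_right (f g g' : LF E) : LF.br f (g + g') = LF.br f g + LF.br f g' := by
  simp only [LF.br, map_add]; ring

theorem br_sub_left (f f' g : LF E) : LF.br (f - f') g = LF.br f g - LF.br f' g := by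
  simp only [LF.br, map_sub]; ring

theorem br_sub_right (f g g' : LF E) : LF.br f (g - g') = LF.br f g - LF.br f g' := by
  simp only [LF.br, map_sub]; ring

theorem br_neg_right (f g : LF E) : LF.br f (-g) = -LF.br f g := by
  simp only [LF.br, map_neg]; ring

theorem br_zero_right (f : LF E) : LF.br f 0 = 0 := by
  simp only [LF.br, map_zero, mul_zero, zero_mul, sub_zero]

theorem br_skew (f g : LF E) : LF.br f g = -LF.br g f := by
  simp only [LF.br]; ring

theorem br_mul_right (f g h : LF E) : LF.br f (g * h) = LF.br f g * h + g * LF.br f h := by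
  simp only [LF.br, D_mul, X_mul]; ring

theorem br_self (f : LF E) : LF.br f f = 0 := by
  simp only [LF.br]; ring

theorem br_pow (f : LF E) (n : ℕ) : LF.br f (f ^ n) = 0 := by
  induction n with
  | zero =>
    have h1 : D (1 : LF E) = 0 := by
      have := D_mul (1 : LF E) 1
      simpa using this
    have h2 : X (1 : LF E) = 0 := by
      have := X_mul (1 : LF E) 1
      simpa using this
    simp [LF.br, h1, h2]
  | succ n ih => rw [pow_succ, br_mul_right, ih, br_self]; ring

end LF

end Trace

/-! ### The `R`-operator on pairs -/

section Doubled

variable (E : Type) [NormedAddCommGroup E] [NormedSpace ℝ E] [FiniteDimensional ℝ E]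

open LF

/-- The `R`-operator `R(f, g) = (f₋ - f₊ + 2g₋, g₋ - g₊ - 2f₊)` on pairs. -/
def rOp : LF E × LF E →+ LF E × LF E :=
  AddMonoidHom.mk' (fun f => (le (-1) f.1 - ge 0 f.1 + 2 * le (-1) f.2,
    le (-1) f.2 - ge 0 f.2 - 2 * ge 0 f.1)) fun f g => by
      ext <;> simp only [Prod.fst_add, Prod.snd_add, map_add] <;> ring_nf

/-- The adjoint of `rOp`. -/
def rAdj : LF E × LF E →+ LF E × LF E :=
  AddMonoidHom.mk' (fun f => (ge 1 f.1 - le 0 f.1 - 2 * le 0 f.2,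
    ge 1 f.2 - le 0 f.2 + 2 * ge 1 f.1)) fun f g => by
      ext <;> simp only [Prod.fst_add, Prod.snd_add, map_add] <;> ring_nf

/-- Twice the diagonal pair of the constant term (in `z`) of `f + g`. -/
def zOp : LF E × LF E →+ LF E × LF E :=
  AddMonoidHom.mk' (fun f => (2 * pz (f.1 + f.2), 2 * pz (f.1 + f.2))) fun f g => by
      ext <;> simp only [Prod.fst_add, Prod.snd_add, map_add] <;> ring_nf

variable {E}

theorem rOp_apply (f : LF E × LF E) : rOp E f = (le (-1) f.1 - ge 0 f.1 + 2 * le (-1) f.2,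
    le (-1) f.2 - ge 0 f.2 - 2 * ge 0 f.1) := rfl

theorem rAdj_apply (f : LF E × LF E) : rAdj E f = (ge 1 f.1 - le 0 f.1 - 2 * le 0 f.2,
    ge 1 f.2 - le 0 f.2 + 2 * ge 1 f.1) := rfl

theorem zOp_apply (f : LF E × LF E) :
    zOp E f = (2 * pz (f.1 + f.2), 2 * pz (f.1 + f.2)) := rfl

/-- The trace on pairs. -/
def trB : LF E × LF E →+ (E → ℂ) := tr.coprod tr

theorem trB_apply (f : LF E × LF E) : trB f = tr f.1 + tr f.2 := rfl

theorem LF.tr_two_mul (f : LF E) : tr (2 * f) = 2 * tr f := by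
  rw [two_mul, two_mul, map_add]

theorem LF.le_two_mul (k : ℤ) (f : LF E) : le k (2 * f) = 2 * le k f := by
  rw [two_mul, two_mul, map_add]

theorem LF.ge_two_mul (k : ℤ) (f : LF E) : ge k (2 * f) = 2 * ge k f := by
  rw [two_mul, two_mul, map_add]

theorem LF.D_two_mul (f : LF E) : D (2 * f) = 2 * D f := by
  rw [two_mul, two_mul, map_add]

theorem LF.X_two_mul (f : LF E) : X (2 * f) = 2 * X f := by
  rw [two_mul, two_mul, map_add]

theorem rOp_adj (f g : LF E × LF E) : trB (rOp E f * g) = trB (f * rAdj E g) := by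
  obtain ⟨f, f'⟩ := f
  obtain ⟨g, g'⟩ := g
  have h : ∀ a b : LF E, tr (le (-1) a * b) = tr (a * ge 1 b) := fun a b => tr_mul_le a b (-1)
  have h' : ∀ a b : LF E, tr (ge 0 a * b) = tr (a * le 0 b) := fun a b => by
    simpa using tr_mul_ge a b 0
  simp only [rOp_apply, rAdj_apply, trB_apply, Prod.fst_mul, Prod.snd_mul, sub_mul, add_mul,
    mul_sub, mul_add, map_add, map_sub, mul_assoc, mul_left_comm _ (2 : LF E), tr_two_mul, h, h']
  ring

/-- The modified Yang–Baxter equation. It holds because the bracket preserves the negative powers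
of `z` and the nonnegative ones. -/
theorem rOp_yangBaxter (f g : LF E × LF E) :
    let b : LF E × LF E → LF E × LF E → LF E × LF E := fun u v => (br u.1 v.1, br u.2 v.2)
    rOp E (b (rOp E f) g + b f (rOp E g)) = b (rOp E f) (rOp E g) + b f g := by
  obtain ⟨f, f'⟩ := f
  obtain ⟨g, g'⟩ := g
  have split : ∀ h : LF E, ∃ a A, h = a + A ∧ le (-1) h = a ∧ ge 0 h = A ∧ Le (-1) a ∧ Ge 0 A :=
    fun h => ⟨_, _, (neg_add_nonneg h).symm, rfl, rfl, Le.le h _, Ge.ge h _⟩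
  obtain ⟨a, A, hf, f1, f2, ha, hA⟩ := split f
  obtain ⟨a', A', hf', f1', f2', ha', hA'⟩ := split f'
  obtain ⟨b, B, hg, g1, g2, hb, hB⟩ := split g
  obtain ⟨b', B', hg', g1', g2', hb', hB'⟩ := split g'
  have l1 : ∀ {a b : LF E}, Le (-1) a → Le (-1) b → le (-1) (br a b) = br a b :=
    fun ha hb => (ha.br hb).le_eq (by norm_num)
  have l3 : ∀ {a b : LF E}, Ge 0 a → Ge 0 b → le (-1) (br a b) = 0 :=
    fun ha hb => (ha.br hb).le_eq (by norm_num)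
  have l5 : ∀ a : LF E, ge 0 a = a - le (-1) a := fun a => ge_eq_sub a 0
  have hb2 : ∀ a b : LF E, br (2 * a) b = 2 * br a b := fun a b => by
    rw [two_mul, two_mul, br_add_left]
  have hb2' : ∀ a b : LF E, br a (2 * b) = 2 * br a b := fun a b => by
    rw [two_mul, two_mul, br_add_right]
  intro br₂
  -- both sides are expanded over the negative and nonnegative parts of the four functions
  have e1 : rOp E (f, f') = (a - A + 2 * a', a' - A' - 2 * A) := by
    rw [rOp_apply, f1, f2, f1', f2']
  have e2 : rOp E (g, g') = (b - B + 2 * b', b' - B' - 2 * B) := by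
    rw [rOp_apply, g1, g2, g1', g2']
  rw [e1, e2, hf, hf', hg, hg']
  simp only [br₂, rOp_apply, Prod.mk_add_mk, br_add_left, br_add_right, br_sub_left, br_sub_right,
    hb2, hb2', map_add, map_sub, le_two_mul, l5, l1, l3, ha, hA, ha', hA', hb, hB, hb', hB']
  ext : 1 <;> ring

end Doubled

/-! ### The Poisson tensors of the Toda hierarchy and their pencil -/

/-- A derivation of all the data acts on the quadratic tensor by the Leibniz rule. -/
theorem QuadraticData.map_ham {B C : Type*} [CommRing B] [CommRing C] (S : QuadraticData B C)
    (δ : B →+ B) (hmul : ∀ f g, δ (f * g) = δ f * g + f * δ g) (hD : ∀ f, δ (S.D f) = S.D (δ f))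
    (hX : ∀ f, δ (S.X f) = S.X (δ f)) (hR : ∀ f, δ (S.R f) = S.R (δ f))
    (hRs : ∀ f, δ (S.Rs f) = S.Rs (δ f)) (hZ : ∀ f, δ (S.Z f) = S.Z (δ f)) (L o : B) :
    δ (S.ham L o) = S.ham L (δ o) + S.hamDeriv L (δ L) o := by
  simp only [QuadraticData.ham, QuadraticData.hamDeriv, QuadraticData.rho, QuadraticData.sig,
    PoissonTrace.br, map_add, map_sub, hmul, hD, hX, hR, hRs, hZ]
  ring

section Pencil

variable {E : Type} [NormedAddCommGroup E] [NormedSpace ℝ E] [FiniteDimensional ℝ E]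

open LF

variable (E) in
/-- The `R`-matrix data of the Toda hierarchy; its quadratic Poisson tensor is `2 P₂`. -/
def todaData : QuadraticData (LF E × LF E) (E → ℂ) where
  D := D.toAddMonoidHom.prodMap D.toAddMonoidHom
  X := X.toAddMonoidHom.prodMap X.toAddMonoidHom
  tr := trB
  D_mul f g := Prod.ext (D_mul f.1 g.1) (D_mul f.2 g.2)
  X_mul f g := Prod.ext (X_mul f.1 g.1) (X_mul f.2 g.2)
  D_X f := Prod.ext (D_X f.1) (D_X f.2)
  tr_D f := by
    change tr (D f.1) + tr (D f.2) = 0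
    rw [tr_D, tr_D, add_zero]
  tr_X f := by
    change tr (X f.1) + tr (X f.2) = 0
    rw [tr_X, tr_X, add_zero]
  R := rOp E
  Rs := rAdj E
  Z := zOp E
  R_adj := rOp_adj
  R_D f := by
    change rOp E (D f.1, D f.2) = (D (rOp E f).1, D (rOp E f).2)
    simp only [rOp_apply, map_add, map_sub, D_two_mul, le_D, ge_D]
  yangBaxter := rOp_yangBaxter
  Z_adj f g := by
    have h := tr_mul_pz (f.1 + f.2) (g.1 + g.2)
    simp only [zOp_apply, trB_apply, Prod.fst_mul, Prod.snd_mul, mul_assoc,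
      mul_left_comm _ (2 : LF E), tr_two_mul]
    rw [← mul_add, ← mul_add, ← map_add, ← map_add, ← mul_add, ← add_mul, h]
  D_Z f := by
    change (D (2 * pz (f.1 + f.2)), D (2 * pz (f.1 + f.2))) = 0
    rw [D_two_mul, D_pz, mul_zero]; rfl
  X_Z f := by
    change (X (2 * pz (f.1 + f.2)), X (2 * pz (f.1 + f.2))) = zOp E (X f.1, X f.2)
    rw [X_two_mul, ← pz_X, map_add, zOp_apply]
  R_mul_Z f g := by
    have e : f * zOp E g = (2 * (f.1 * pz (g.1 + g.2)), 2 * (f.2 * pz (g.1 + g.2))) := by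
      ext : 1 <;> simp only [zOp_apply, Prod.fst_mul, Prod.snd_mul] <;> ring
    rw [e]
    ext : 1 <;>
      simp only [rOp_apply, zOp_apply, le_two_mul, ge_two_mul, le_mul_pz, ge_mul_pz, Prod.fst_mul,
        Prod.snd_mul] <;> ring

/-- The first Poisson tensor of the Toda hierarchy in terms of the covector `o = (zω, zω̄)`. -/
def P1A (L o : LF E × LF E) : LF E × LF E :=
  (-br L.1 (le (-1) (o.1 - o.2)) + le 0 (br L.1 o.1 + br L.2 o.2),
    br L.2 (ge 0 (o.1 - o.2)) + ge 1 (br L.1 o.1 + br L.2 o.2))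

/-- The second Poisson tensor of the Toda hierarchy in terms of the covector `o = (zω, zω̄)`. -/
def P2A (L o : LF E × LF E) : LF E × LF E :=
  (br L.1 (le (-1) (L.1 * o.1 + L.2 * o.2)) - L.1 * le 0 (br L.1 o.1 + br L.2 o.2)
      + D L.1 * X (pz (D L.1 * o.1 + D L.2 * o.2)),
    -br L.2 (ge 0 (L.2 * o.2 + L.1 * o.1)) + L.2 * ge 1 (br L.1 o.1 + br L.2 o.2)
      + D L.2 * X (pz (D L.1 * o.1 + D L.2 * o.2)))

theorem todaData_br (f g : LF E × LF E) : (todaData E).br f g = (br f.1 g.1, br f.2 g.2) := rfl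

/-- The quadratic tensor of the `R`-operator is `2 P₂`. -/
theorem todaData_ham (L o : LF E × LF E) : (todaData E).ham L o = P2A L o + P2A L o := by
  have hd : (todaData E).D L = (D L.1, D L.2) := rfl
  have hr : (todaData E).R = rOp E := rfl
  have hs : (todaData E).Rs = rAdj E := rfl
  have hz : (todaData E).Z = zOp E := rfl
  have hb2' : ∀ a b : LF E, br a (2 * b) = 2 * br a b := fun a b => by
    rw [two_mul, two_mul, br_add_right]
  have hbz : ∀ a b : LF E, br a (pz b) = D a * X (pz b) := fun a b => by
    rw [br, D_pz, zero_mul, sub_zero]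
  simp only [QuadraticData.ham, QuadraticData.rho, QuadraticData.sig, todaData_br, hd, hr, hs, hz,
    rOp_apply, rAdj_apply, zOp_apply, P2A, Prod.fst_mul, Prod.snd_mul, Prod.fst_add,
    Prod.snd_add]
  have g0 : ∀ a : LF E, ge 0 a = a - le (-1) a := fun a => ge_eq_sub a 0
  have g1 : ∀ a : LF E, ge 1 a = a - le 0 a := fun a => ge_eq_sub a 1
  ext : 1
  · simp only [Prod.fst_add, Prod.fst_mul, map_add, br_add_right, br_sub_right, hb2', hbz, g0, g1,
      br_mul_right, br_self]
    ring
  · simp only [Prod.snd_add, Prod.snd_mul, map_add, br_add_right, br_sub_right, hb2', hbz, g0, g1,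
      br_mul_right, br_self]
    ring

variable (E) in
/-- The direction `(1, -1)` of the shift `(λ, λ̄) ↦ (λ + 1, λ̄ - 1)` that relates the two
Poisson structures. -/
def shiftDir : LF E × LF E := (1, -1)

theorem LF.D_one : D (1 : LF E) = 0 := by simpa using D_mul (1 : LF E) 1

theorem LF.X_one : X (1 : LF E) = 0 := by simpa using X_mul (1 : LF E) 1

theorem todaData_D_shiftDir : (todaData E).D (shiftDir E) = 0 := by
  change (D (1 : LF E), D (-1 : LF E)) = 0
  rw [map_neg, D_one, neg_zero]; rfl

theorem todaData_X_shiftDir : (todaData E).X (shiftDir E) = 0 := by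
  change (X (1 : LF E), X (-1 : LF E)) = 0
  rw [map_neg, X_one, neg_zero]; rfl

/-- The first Poisson tensor is the derivative of the second one along `-shiftDir`. -/
theorem P1A_eq (L o : LF E × LF E) : P1A L o = P2A L o - P2A (L + shiftDir E) o := by
  have h1 : ∀ f g : LF E, br (f + 1) g = br f g := fun f g => by
    rw [br, br, map_add, map_add, D_one, X_one, add_zero, add_zero]
  have h2 : ∀ f g : LF E, br (f + -1) g = br f g := fun f g => by
    rw [br, br, map_add, map_add, map_neg, map_neg, D_one, X_one, neg_zero, add_zero, add_zero]
  have h3 : ∀ f : LF E, D (f + 1) = D f := fun f => by rw [map_add, D_one, add_zero]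
  have h4 : ∀ f : LF E, D (f + -1) = D f := fun f => by
    rw [map_add, map_neg, D_one, neg_zero, add_zero]
  ext : 1 <;>
    simp only [P1A, P2A, shiftDir, Prod.fst_add, Prod.snd_add, Prod.fst_sub, Prod.snd_sub, h1, h2,
      h3, h4, add_mul, map_add, map_sub, br_add_right, br_sub_right, one_mul, neg_mul, map_neg,
      br_neg_right] <;> ring

/-- The linear combination `a P₁ + b P₂`. -/
def pencil (a b : ℂ) (L o : LF E × LF E) : LF E × LF E := a • P1A L o + b • P2A L o

theorem pencil_eq (a b : ℂ) (L o : LF E × LF E) : pencil a b L o =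
    ((a + b) / 2) • (todaData E).ham L o - (a / 2) • (todaData E).ham (L + shiftDir E) o := by
  rw [pencil, P1A_eq, todaData_ham, todaData_ham]
  module

/-- The differential of `L ↦ ⟨o₁, (a P₁ + b P₂)(o₂)⟩`. -/
def pencilCov (a b : ℂ) (L o₁ o₂ : LF E × LF E) : LF E × LF E :=
  ((a + b) / 2) • (todaData E).cov L o₁ o₂ - (a / 2) • (todaData E).cov (L + shiftDir E) o₁ o₂

theorem trB_smul (c : ℂ) (f : LF E × LF E) : trB (c • f) = c • trB f := by
  rw [trB_apply, trB_apply, Prod.smul_fst, Prod.smul_snd, tr_smul, tr_smul, smul_add]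

theorem trB_pencil_skew (a b : ℂ) (L o₁ o₂ : LF E × LF E) :
    trB (o₁ * pencil a b L o₂) = -trB (o₂ * pencil a b L o₁) := by
  have h : ∀ L, trB (o₁ * (todaData E).ham L o₂) = -trB (o₂ * (todaData E).ham L o₁) := fun L =>
    (todaData E).tr_mul_ham_skew L o₁ o₂
  simp only [pencil_eq, mul_sub, mul_smul_comm, map_sub, trB_smul, h]
  module

/-- The vanishing of the Schouten bracket of `a P₁ + b P₂` on three covectors. Both `P₁` and `P₂`
are combinations of the quadratic tensor at `L` and at `L + shiftDir`. -/
theorem pencil_schouten (a b : ℂ) (L o₁ o₂ o₃ : LF E × LF E) :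
    trB (pencilCov a b L o₁ o₂ * pencil a b L o₃) + trB (pencilCov a b L o₂ o₃ * pencil a b L o₁)
      + trB (pencilCov a b L o₃ o₁ * pencil a b L o₂) = 0 := by
  have h1 := (todaData E).schouten L o₁ o₂ o₃
  have h2 := (todaData E).schouten (L + shiftDir E) o₁ o₂ o₃
  have h3 := (todaData E).schouten_mixed L (shiftDir E) o₁ o₂ o₃ todaData_D_shiftDir
    todaData_X_shiftDir
  change trB _ + trB _ + trB _ = 0 at h1 h2
  change 2 * (trB _ + trB _ + trB _ + trB _ + trB _ + trB _) = 0 at h3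
  funext e
  replace h1 := congrFun h1 e
  replace h2 := congrFun h2 e
  replace h3 := congrFun h3 e
  simp only [pencil_eq, pencilCov, sub_mul, mul_sub, smul_mul_assoc, mul_smul_comm, map_sub,
    trB_smul, Pi.add_apply, Pi.sub_apply, Pi.smul_apply, Pi.mul_apply,
    Pi.ofNat_apply, smul_eq_mul] at h1 h2 h3 ⊢
  linear_combination ((a + b) / 2) ^ 2 * h1 + (a / 2) ^ 2 * h2 - ((a + b) / 2) * (a / 2) / 2 * h3

/-- The derivative of a pair of families in the direction of a parameter. -/
def dirB (v : E) : LF E × LF E →+ LF E × LF E :=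
  (dirL (v, 0)).toAddMonoidHom.prodMap (dirL (v, 0)).toAddMonoidHom

theorem dirB_apply (v : E) (f : LF E × LF E) : dirB v f = (dirL (v, 0) f.1, dirL (v, 0) f.2) := rfl

theorem dirB_smul (v : E) (c : ℂ) (f : LF E × LF E) : dirB v (c • f) = c • dirB v f := by
  rw [dirB_apply, dirB_apply, Prod.smul_fst, Prod.smul_snd, map_smul, map_smul]; rfl

theorem dirB_mul (v : E) (f g : LF E × LF E) : dirB v (f * g) = dirB v f * g + f * dirB v g :=
  Prod.ext (dirL_mul f.1 g.1 _) (dirL_mul f.2 g.2 _)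

theorem dirB_ham (v : E) (L o : LF E × LF E) : dirB v ((todaData E).ham L o) =
    (todaData E).ham L (dirB v o) + (todaData E).hamDeriv L (dirB v L) o := by
  have h2 : ∀ f : LF E, dirL (v, 0) (2 * f) = 2 * dirL (v, 0) f := fun f => by
    rw [two_mul, two_mul, map_add]
  refine (todaData E).map_ham (dirB v) (dirB_mul v) (fun f => ?_) (fun f => ?_) (fun f => ?_)
    (fun f => ?_) (fun f => ?_) L o
  · exact Prod.ext (D_dirL _ _).symm (D_dirL _ _).symm
  · exact Prod.ext (dirL_comm _ _ _) (dirL_comm _ _ _)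
  · change dirB v (rOp E f) = rOp E (dirB v f)
    simp only [rOp_apply, dirB_apply, map_add, map_sub, h2, le_dirL, ge_dirL]
  · change dirB v (rAdj E f) = rAdj E (dirB v f)
    simp only [rAdj_apply, dirB_apply, map_add, map_sub, h2, le_dirL, ge_dirL]
  · change dirB v (zOp E f) = zOp E (dirB v f)
    simp only [zOp_apply, dirB_apply, map_add, h2, pz_dirL]

theorem dirB_shiftDir (v : E) : dirB v (shiftDir E) = 0 := by
  have h := (dirL_mul (1 : LF E) 1 (v, 0))
  simp only [mul_one, one_mul, left_eq_add] at h
  change (dirL (v, 0) (1 : LF E), dirL (v, 0) (-1 : LF E)) = 0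
  rw [map_neg, h, neg_zero]; rfl

/-- The derivative of the tensor along a family of loops, paired with a covector. -/
theorem trB_mul_dirB_pencil (a b : ℂ) (v : E) (L o₁ o₂ : LF E × LF E) :
    trB (o₁ * dirB v (pencil a b L o₂)) = trB (o₁ * pencil a b L (dirB v o₂))
      + trB (dirB v L * pencilCov a b L o₁ o₂) := by
  have h : ∀ L α, trB (o₁ * (todaData E).hamDeriv L α o₂) = trB (α * (todaData E).cov L o₁ o₂) :=
    fun L α => (todaData E).tr_mul_hamDeriv L α o₁ o₂
  simp only [pencil_eq, pencilCov, map_sub, dirB_smul, dirB_ham, mul_sub, mul_smul_comm, trB_smul,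
    mul_add, map_add, h, dirB_shiftDir, add_zero]
  module

end Pencil

/-! ### Families of loops, vectors and one-forms as elements of the algebra -/

theorem contDiff_prodMk_const {E : Type} [NormedAddCommGroup E] [NormedSpace ℝ E] (e : E) :
    ContDiff ℝ (⊤ : ℕ∞) fun x : ℝ => (e, x) := contDiff_const.prodMk contDiff_id

theorem contDiff_prodMk_zero {E : Type} [NormedAddCommGroup E] [NormedSpace ℝ E] :
    ContDiff ℝ (⊤ : ℕ∞) fun e : E => (e, (0 : ℝ)) := contDiff_id.prodMk contDiff_const

section Spaces

variable {V : Type} [NormedAddCommGroup V] [NormedSpace ℝ V] [FiniteDimensional ℝ V]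

theorem SmoothL.zpow_mul {a : V → Circle → ℂ} (ha : SmoothL a) (k : ℤ) :
    SmoothL fun p z => (z : ℂ) ^ k * a p z := by
  have := (SmoothL.monomial (V := V) (contDiff_const (c := (1 : ℂ))) k).mul ha
  simpa only [one_mul] using! this

theorem SmoothL.z_mul {a : V → Circle → ℂ} (ha : SmoothL a) :
    SmoothL fun p z => (z : ℂ) * a p z := by
  simpa only [zpow_one] using! ha.zpow_mul 1

theorem SmoothL.of_z_mul {a : V → Circle → ℂ} (ha : SmoothL fun p z => (z : ℂ) * a p z) :
    SmoothL a := by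
  have := ha.zpow_mul (-1)
  have e : (fun (p : V) (z : Circle) => (z : ℂ) ^ (-1 : ℤ) * ((z : ℂ) * a p z)) = a := by
    funext p z
    rw [zpow_neg_one, inv_mul_cancel_left₀ (Circle.coe_ne_zero z)]
  rwa [e] at this

theorem coeff_z_mul (f : Circle → ℂ) (n : ℤ) :
    coeff (fun z => (z : ℂ) * f z) n = coeff f (n - 1) := by
  simpa only [zpow_one] using! coeff_mul_zpow f 1 n

theorem smoothM_iff {γ : V → Pair} : SmoothM γ ↔ SmoothL (fun p => (γ p).1) ∧
    SmoothL (fun p => (γ p).2) ∧ (∀ p, coeff (γ p).1 1 = 1) ∧ (∀ p, ∀ n > 1, coeff (γ p).1 n = 0) ∧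
    ∀ p, ∀ n < -1, coeff (γ p).2 n = 0 := by
  have hz : SmoothL fun (_ : V) (z : Circle) => (z : ℂ) := by
    simpa using SmoothL.monomial (V := V) (contDiff_const (c := (1 : ℂ))) 1
  have cz : ∀ n, coeff (fun z : Circle => (z : ℂ)) n = if n = 1 then 1 else 0 := fun n => by
    simpa using coeff_monomial 1 1 n
  rw [SmoothM, smoothHInf_iff, smoothH0_iff]
  constructor
  · rintro ⟨⟨h1, h2⟩, h3, h4⟩
    have e : ∀ p, (fun z => (γ p).1 z - z) + (fun z : Circle => (z : ℂ)) = (γ p).1 := fun p => by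
      funext z; simp
    have hc : ∀ p n, coeff (γ p).1 n
        = coeff (fun z => (γ p).1 z - z) n + if n = 1 then 1 else 0 := fun p n => by
      rw [← cz, ← h1.coeff_add hz p n, e]
    refine ⟨?_, h3.of_z_mul, fun p => ?_, fun p n hn => ?_, fun p n hn => ?_⟩
    · have := h1.add hz
      simpa only [e] using this
    · rw [hc, h2 p 1 one_pos, if_pos rfl, zero_add]
    · rw [hc, h2 p n (by omega), if_neg (by omega), zero_add]
    · have := h4 p (n + 1) (by omega)
      rwa [coeff_z_mul, add_sub_cancel_right] at this
  · rintro ⟨h1, h2, h3, h4, h5⟩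
    have e : ∀ p, (γ p).1 + (fun z : Circle => (-1 : ℂ) * (z : ℂ)) = fun z => (γ p).1 z - z :=
      fun p => by funext z; simp [sub_eq_add_neg]
    have hz' : SmoothL fun (_ : V) (z : Circle) => (-1 : ℂ) * (z : ℂ) := hz.const_mul (-1)
    have hc : ∀ p n, coeff (fun z => (γ p).1 z - z) n
        = coeff (γ p).1 n - if n = 1 then 1 else 0 := fun p n => by
      rw [← e, h1.coeff_add hz' p n, coeff_const_mul, cz]; ring
    refine ⟨⟨?_, fun p n hn => ?_⟩, h2.z_mul, fun p n hn => ?_⟩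
    · have := h1.add hz'
      simpa only [e] using this
    · rw [hc]
      by_cases h : n = 1
      · rw [h, h3, if_pos rfl, sub_self]
      · rw [h4 p n (by omega), if_neg h, sub_self]
    · rw [coeff_z_mul, h5 p _ (by omega)]

theorem smoothT_iff {α : V → Pair} : SmoothT α ↔ SmoothL (fun p => (α p).1) ∧
    SmoothL (fun p => (α p).2) ∧ (∀ p, ∀ n > 0, coeff (α p).1 n = 0) ∧
    ∀ p, ∀ n < -1, coeff (α p).2 n = 0 := by
  rw [SmoothT, smoothHInf_iff, smoothH0_iff]
  constructor
  · rintro ⟨⟨h1, h2⟩, h3, h4⟩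
    refine ⟨h1, h3.of_z_mul, h2, fun p n hn => ?_⟩
    have := h4 p (n + 1) (by omega)
    rwa [coeff_z_mul, add_sub_cancel_right] at this
  · rintro ⟨h1, h2, h3, h4⟩
    refine ⟨⟨h1, h3⟩, h2.z_mul, fun p n hn => ?_⟩
    rw [coeff_z_mul, h4 p _ (by omega)]

theorem smoothTstar_iff {ω : V → Pair} : SmoothTstar ω ↔
    SmoothL (fun p z => (z : ℂ) * (ω p).1 z) ∧ SmoothL (fun p z => (z : ℂ) * (ω p).2 z) ∧
    (∀ p, ∀ n < 0, coeff (fun z => (z : ℂ) * (ω p).1 z) n = 0) ∧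
    ∀ p, ∀ n > 1, coeff (fun z => (z : ℂ) * (ω p).2 z) n = 0 := by
  rw [SmoothTstar, smoothHInf_iff, smoothH0_iff]
  constructor
  · rintro ⟨⟨h1, h2⟩, h3, h4⟩
    refine ⟨h1, h3.z_mul, h2, fun p n hn => ?_⟩
    rw [coeff_z_mul, h4 p _ (by omega)]
  · rintro ⟨h1, h2, h3, h4⟩
    refine ⟨⟨h1, h3⟩, h2.of_z_mul, fun p n hn => ?_⟩
    have := h4 p (n + 1) (by omega)
    rwa [coeff_z_mul, add_sub_cancel_right] at this

variable {W : Type} [NormedAddCommGroup W] [NormedSpace ℝ W] [FiniteDimensional ℝ W]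

theorem SmoothM.comp {γ : V → Pair} (h : SmoothM γ) {g : W → V} (hg : ContDiff ℝ (⊤ : ℕ∞) g) :
    SmoothM fun q => γ (g q) := by
  rw [smoothM_iff] at h ⊢
  exact ⟨h.1.comp hg, h.2.1.comp hg, fun _ => h.2.2.1 _, fun _ => h.2.2.2.1 _,
    fun _ => h.2.2.2.2 _⟩

theorem SmoothT.comp {γ : V → Pair} (h : SmoothT γ) {g : W → V} (hg : ContDiff ℝ (⊤ : ℕ∞) g) :
    SmoothT fun q => γ (g q) := by
  rw [smoothT_iff] at h ⊢
  exact ⟨h.1.comp hg, h.2.1.comp hg, fun _ => h.2.2.1 _, fun _ => h.2.2.2 _⟩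

theorem SmoothTstar.comp {γ : V → Pair} (h : SmoothTstar γ) {g : W → V}
    (hg : ContDiff ℝ (⊤ : ℕ∞) g) : SmoothTstar fun q => γ (g q) := by
  rw [smoothTstar_iff] at h ⊢
  exact ⟨h.1.comp hg, h.2.1.comp hg, fun _ => h.2.2.1 _, fun _ => h.2.2.2 _⟩

end Spaces

section Families

variable {E : Type} [NormedAddCommGroup E] [NormedSpace ℝ E] [FiniteDimensional ℝ E]

open LF

/-- Pairs `(λ, λ̄)` that are families of points of the loop space. -/
def IsPt (L : LF E × LF E) : Prop := Le 1 L.1 ∧ (∀ p, cf L.1 p 1 = 1) ∧ Ge (-1) L.2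

/-- Pairs `(α, ᾱ)` that are families of tangent vectors. -/
def IsTan (α : LF E × LF E) : Prop := Le 0 α.1 ∧ Ge (-1) α.2

/-- Pairs `(zω, zω̄)` for families of one-forms `(ω, ω̄)`. -/
def IsCov (o : LF E × LF E) : Prop := Ge 0 o.1 ∧ Le 1 o.2

/-- The family of pairs of functions given by a pair of elements of the algebra. -/
def toPair (L : LF E × LF E) (e : E) (x : ℝ) : Pair := (L.1.fn (e, x), L.2.fn (e, x))

/-- The family of one-forms `(ω, ω̄)` with given `(zω, zω̄)`. -/
def toForm (o : LF E × LF E) (e : E) (x : ℝ) : Pair :=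
  (fun z => (z : ℂ)⁻¹ * o.1.fn (e, x) z, fun z => (z : ℂ)⁻¹ * o.2.fn (e, x) z)

/-- Smooth families of tangent vectors to the loop space. -/
def TanFamily (α : E → ℝ → Pair) : Prop :=
  SmoothT (fun p : E × ℝ => α p.1 p.2) ∧ ∀ t, Function.Periodic (α t) (2 * Real.pi)

theorem loopFamily_toPair {L : LF E × LF E} (h : IsPt L) : LoopFamily (toPair L) :=
  ⟨smoothM_iff.2 ⟨L.1.smooth, L.2.smooth, h.2.1, h.1, h.2.2⟩,
    fun e x => Prod.ext (L.1.periodic e x) (L.2.periodic e x)⟩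

theorem tanFamily_toPair {α : LF E × LF E} (h : IsTan α) : TanFamily (toPair α) :=
  ⟨smoothT_iff.2 ⟨α.1.smooth, α.2.smooth, h.1, h.2⟩,
    fun e x => Prod.ext (α.1.periodic e x) (α.2.periodic e x)⟩

theorem z_mul_toForm_fst (o : LF E × LF E) (e : E) (x : ℝ) (z : Circle) :
    (z : ℂ) * (toForm o e x).1 z = o.1.fn (e, x) z :=
  mul_inv_cancel_left₀ (Circle.coe_ne_zero z) _

theorem z_mul_toForm_snd (o : LF E × LF E) (e : E) (x : ℝ) (z : Circle) :
    (z : ℂ) * (toForm o e x).2 z = o.2.fn (e, x) z :=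
  mul_inv_cancel_left₀ (Circle.coe_ne_zero z) _

theorem formFamily_toForm {o : LF E × LF E} (h : IsCov o) : FormFamily (toForm o) := by
  refine ⟨smoothTstar_iff.2 ?_, fun e x => ?_⟩
  · simp only [z_mul_toForm_fst, z_mul_toForm_snd]
    exact ⟨o.1.smooth, o.2.smooth, h.1, h.2⟩
  · simp only [toForm, o.1.periodic, o.2.periodic]

theorem LoopFamily.exists_eq {γ : E → ℝ → Pair} (h : LoopFamily γ) :
    ∃ L, IsPt L ∧ γ = toPair L := by
  obtain ⟨h1, h2, h3, h4, h5⟩ := smoothM_iff.1 h.1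
  exact ⟨(LF.mk _ h1 fun e x => congrArg Prod.fst (h.2 e x),
    LF.mk _ h2 fun e x => congrArg Prod.snd (h.2 e x)), ⟨h4, h3, h5⟩, rfl⟩

theorem TanFamily.exists_eq {α : E → ℝ → Pair} (h : TanFamily α) :
    ∃ L, IsTan L ∧ α = toPair L := by
  obtain ⟨h1, h2, h3, h4⟩ := smoothT_iff.1 h.1
  exact ⟨(LF.mk _ h1 fun e x => congrArg Prod.fst (h.2 e x),
    LF.mk _ h2 fun e x => congrArg Prod.snd (h.2 e x)), ⟨h3, h4⟩, rfl⟩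

theorem FormFamily.exists_eq {ω : E → ℝ → Pair} (h : FormFamily ω) :
    ∃ o, IsCov o ∧ ω = toForm o := by
  obtain ⟨h1, h2, h3, h4⟩ := smoothTstar_iff.1 h.1
  refine ⟨(LF.mk _ h1 fun e x => ?_, LF.mk _ h2 fun e x => ?_), ⟨h3, h4⟩, ?_⟩
  · simp only [show ω e (x + 2 * Real.pi) = ω e x from h.2 e x]
  · simp only [show ω e (x + 2 * Real.pi) = ω e x from h.2 e x]
  · funext e x
    exact Prod.ext (funext fun z => (inv_mul_cancel_left₀ (Circle.coe_ne_zero z) _).symm)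
      (funext fun z => (inv_mul_cancel_left₀ (Circle.coe_ne_zero z) _).symm)

theorem LoopFamily.mem {γ : E → ℝ → Pair} (h : LoopFamily γ) (e : E) : γ e ∈ LM :=
  ⟨h.1.comp (contDiff_prodMk_const e), h.2 e⟩

theorem TanFamily.mem {γ : E → ℝ → Pair} (h : TanFamily γ) (e : E) : γ e ∈ TLM :=
  ⟨h.1.comp (contDiff_prodMk_const e), h.2 e⟩

theorem FormFamily.mem {γ : E → ℝ → Pair} (h : FormFamily γ) (e : E) : γ e ∈ TstarLM :=
  ⟨h.1.comp (contDiff_prodMk_const e), h.2 e⟩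

theorem loopFamily_const {γ : ℝ → Pair} (h : γ ∈ LM) : LoopFamily fun _ : E => γ :=
  ⟨h.1.comp contDiff_snd, fun _ => h.2⟩

theorem tanFamily_const {γ : ℝ → Pair} (h : γ ∈ TLM) : TanFamily fun _ : E => γ :=
  ⟨h.1.comp contDiff_snd, fun _ => h.2⟩

theorem formFamily_const {γ : ℝ → Pair} (h : γ ∈ TstarLM) : FormFamily fun _ : E => γ :=
  ⟨h.1.comp contDiff_snd, fun _ => h.2⟩

theorem LF.cf_eq_contour (f : LF E) (p : E × ℝ) {h : Circle → ℂ}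
    (hh : ∀ z : Circle, (z : ℂ) * h z = f.fn p z) :
    (2 * Real.pi * Complex.I)⁻¹ * contour h = cf f p 0 := by
  rw [← coeff_zero_eq_contour, cf]
  congr 1
  exact funext hh

theorem pairing_toForm (o α : LF E × LF E) (e : E) (x : ℝ) :
    pairing (toForm o e x) (toPair α e x) = cf (o.1 * α.1 + o.2 * α.2) (e, x) 0 := by
  refine LF.cf_eq_contour _ _ fun z => ?_
  have hz := Circle.coe_ne_zero z
  simp only [toForm, toPair, fn_add, fn_mul, Pi.add_apply, Pi.mul_apply]
  field_simp

theorem loopPairing_toForm (o α : LF E × LF E) (e : E) :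
    loopPairing (toForm o e) (toPair α e) = trB (o * α) e := by
  rw [trB_apply, ← map_add, tr_apply, loopPairing]
  exact intervalIntegral.integral_congr fun x _ => pairing_toForm o α e x

theorem LF.fn_pz (f : LF E) (p : E × ℝ) (z : Circle) : (pz f).fn p z = cf f p 0 := by
  refine ((pz f).smooth.2 p z).unique ?_
  have := hasSum_monomial (cf f p 0) 0 z
  rw [zpow_zero, mul_one] at this
  refine this.congr_fun fun n => ?_
  congr 1
  exact (cf_pz f p n).trans (by split_ifs with h <;> simp [h])

theorem LF.hasDerivAt_fn_x (f : LF E) (e : E) (x : ℝ) (z : Circle) :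
    HasDerivAt (fun y => f.fn (e, y) z) ((X f).fn (e, x) z) x := by
  have h1 := ((f.smooth.contDiff_apply z).differentiable (by simp) (e, x)).hasFDerivAt
  have h2 : HasDerivAt (fun y : ℝ => (e, y)) ((0 : E), (1 : ℝ)) x :=
    (hasDerivAt_const x e).prodMk (hasDerivAt_id x)
  exact h1.comp_hasDerivAt x h2

theorem LF.brack_fn (f g : LF E) (e : E) (x : ℝ) :
    brack (fun y => f.fn (e, y)) (fun y => g.fn (e, y)) x = (br f g).fn (e, x) := by
  funext z
  simp only [brack, dX, (hasDerivAt_fn_x _ e x z).deriv]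
  rfl

theorem phi_toForm (L o : LF E × LF E) (e : E) (x : ℝ) :
    phi (toPair L e) (toForm o e) x = cf (D L.1 * o.1 + D L.2 * o.2) (e, x) 0 := by
  refine LF.cf_eq_contour _ _ fun z => ?_
  have hz := Circle.coe_ne_zero z
  simp only [toForm, toPair, fn_add, fn_mul, Pi.add_apply, Pi.mul_apply, fn_D]
  field_simp

theorem P₁_toPair (L o : LF E × LF E) (e : E) :
    P₁ (toPair L e) (toForm o e) = toPair (P1A L o) e := by
  funext x
  simp only [P₁, z_mul_toForm_fst, z_mul_toForm_snd]
  simp only [toPair, brack_fn, ← fn_sub, ← fn_le, ← fn_ge, ← fn_add, ← fn_neg]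
  rfl

theorem P₂_toPair (L o : LF E × LF E) (e : E) :
    P₂ (toPair L e) (toForm o e) = toPair (P2A L o) e := by
  have hphi : ∀ (f : LF E) (x : ℝ), (fun z : Circle => zD (f.fn (e, x)) z *
      deriv (phi (toPair L e) (toForm o e)) x)
      = (D f * X (pz (D L.1 * o.1 + D L.2 * o.2))).fn (e, x) := fun f x => by
    funext z
    rw [funext (phi_toForm L o e), (hasDerivAt_cf_x _ e x 0).deriv, ← pz_X, fn_mul, Pi.mul_apply,
      fn_pz]
    rfl
  funext x
  simp only [P₂, z_mul_toForm_fst, z_mul_toForm_snd]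
  simp only [toPair] at hphi ⊢
  simp only [hphi, brack_fn, ← fn_sub, ← fn_le, ← fn_ge, ← fn_add, ← fn_neg, ← fn_mul]
  rfl

theorem isTan_P1A {L o : LF E × LF E} (hL : IsPt L) : IsTan (P1A L o) :=
  ⟨((hL.1.br (Le.le _ (-1))).mono (by norm_num)).neg.add (Le.le _ 0),
    ((hL.2.2.br (Ge.ge _ 0)).mono (by norm_num)).add ((Ge.ge _ 1).mono (by norm_num))⟩

/-- The constant term of `{λ, zω} + {λ̄, zω̄}` is `φ_x`. -/
theorem pz_br_add (L o : LF E × LF E) : pz (br L.1 o.1 + br L.2 o.2)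
    = X (pz (D L.1 * o.1 + D L.2 * o.2)) := by
  have h : ∀ f g : LF E, br f g = X (D f * g) - D (g * X f) := fun f g => by
    rw [X_mul, D_mul, D_X, br]; ring
  rw [h, h, map_add, map_sub, map_sub, pz_D, pz_D, pz_X, pz_X, map_add, map_add]
  ring

/-- `zλ_z - λ` has no term of degree one, since `λ = z + u₀ + ⋯`. -/
theorem IsPt.le_D_sub {L : LF E × LF E} (h : IsPt L) : Le 0 (D L.1 - L.1) := fun p n hn => by
  rw [cf_sub, cf_D]
  by_cases h1 : n = 1
  · simp [h1]
  · rw [h.1 p n (by omega)]; simp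

theorem isTan_P2A {L o : LF E × LF E} (hL : IsPt L) : IsTan (P2A L o) := by
  constructor
  · have hw : ∀ w : LF E, le 0 w = le (-1) w + pz w := fun w => ext_cf fun p n => by
      rw [cf_add, cf_le, cf_le, cf_pz]; split_ifs <;> first | omega | simp
    -- the terms of degree one of `-λ w_{≤ 0}` and `zλ' φ_x` cancel since `w₀ = φ_x`
    have e : (P2A L o).1 = br L.1 (le (-1) (L.1 * o.1 + L.2 * o.2))
        - L.1 * le (-1) (br L.1 o.1 + br L.2 o.2)
        + (D L.1 - L.1) * X (pz (D L.1 * o.1 + D L.2 * o.2)) := by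
      simp only [P2A, hw, pz_br_add]; ring
    rw [e]
    refine (((hL.1.br (Le.le _ (-1))).mono (by norm_num)).sub
      ((hL.1.mul (Le.le _ (-1))).mono (by norm_num))).add ?_
    exact (hL.le_D_sub.mul ((Le.pz _).dirL _)).mono (by norm_num)
  · refine (((hL.2.2.br (Ge.ge _ 0)).mono (by norm_num)).neg.add
      ((hL.2.2.mul (Ge.ge _ 1)).mono (by norm_num))).add ?_
    exact (hL.2.2.D.mul ((Ge.pz _).dirL _)).mono (by norm_num)

theorem IsTan.add {α β : LF E × LF E} (h : IsTan α) (h' : IsTan β) : IsTan (α + β) :=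
  ⟨h.1.add h'.1, h.2.add h'.2⟩

theorem IsTan.smul {α : LF E × LF E} (h : IsTan α) (c : ℂ) : IsTan (c • α) :=
  ⟨h.1.smul c, h.2.smul c⟩

theorem IsPt.add {L α : LF E × LF E} (h : IsPt L) (h' : IsTan α) : IsPt (L + α) :=
  ⟨h.1.add (h'.1.mono zero_le_one), fun p => by
    rw [Prod.fst_add, cf_add, h.2.1, h'.1 p 1 one_pos, add_zero], h.2.2.add h'.2⟩

theorem IsPt.dirB {L : LF E × LF E} (h : IsPt L) (v : E) : IsTan (dirB v L) := by
  refine ⟨fun p n hn => ?_, h.2.2.dirL _⟩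
  by_cases h1 : n = 1
  · rw [dirB_apply, cf_dirL, h1, funext h.2.1]; simp
  · exact h.1.dirL (v, 0) p n (by omega)

theorem IsCov.dirB {L : LF E × LF E} (h : IsCov L) (v : E) : IsCov (dirB v L) :=
  ⟨h.1.dirL _, h.2.dirL _⟩

theorem IsCov.add {α β : LF E × LF E} (h : IsCov α) (h' : IsCov β) : IsCov (α + β) :=
  ⟨h.1.add h'.1, h.2.add h'.2⟩

theorem IsCov.sub {α β : LF E × LF E} (h : IsCov α) (h' : IsCov β) : IsCov (α - β) :=
  ⟨h.1.sub h'.1, h.2.sub h'.2⟩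

/-- The tensor `a P₁ + b P₂`. -/
def pencilP (a b : ℂ) (γ ω : ℝ → Pair) : ℝ → Pair := a • P₁ γ ω + b • P₂ γ ω

theorem pencilP_toPair (a b : ℂ) (L o : LF E × LF E) (e : E) :
    pencilP a b (toPair L e) (toForm o e) = toPair (pencil a b L o) e := by
  rw [pencilP, P₁_toPair, P₂_toPair]; rfl

theorem isTan_pencil (a b : ℂ) {L o : LF E × LF E} (hL : IsPt L) : IsTan (pencil a b L o) :=
  ((isTan_P1A hL).smul a).add ((isTan_P2A hL).smul b)

theorem toForm_add (o o' : LF E × LF E) (e : E) : toForm (o + o') e = toForm o e + toForm o' e := by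
  funext x
  exact Prod.ext (funext fun z => mul_add _ _ _) (funext fun z => mul_add _ _ _)

theorem toForm_smul (c : ℂ) (o : LF E × LF E) (e : E) : toForm (c • o) e = c • toForm o e := by
  funext x
  exact Prod.ext (funext fun z => mul_left_comm _ _ _) (funext fun z => mul_left_comm _ _ _)

/-- The change of parameters along a smooth map. -/
def LF.pull {E' : Type} [NormedAddCommGroup E'] [NormedSpace ℝ E'] [FiniteDimensional ℝ E']
    (g : E' → E) (hg : ContDiff ℝ (⊤ : ℕ∞) g) (f : LF E) : LF E' :=
  LF.mk (fun p => f.fn (g p.1, p.2))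
    (f.smooth.comp (g := fun p : E' × ℝ => (g p.1, p.2)) (by fun_prop)) fun e x => f.periodic _ x

end Families

/-! ### Change of parameters -/

section Pull

variable {E : Type} [NormedAddCommGroup E] [NormedSpace ℝ E] [FiniteDimensional ℝ E]
variable {E' : Type} [NormedAddCommGroup E'] [NormedSpace ℝ E'] [FiniteDimensional ℝ E']

open LF

theorem LF.cf_pull (g : E' → E) (hg : ContDiff ℝ (⊤ : ℕ∞) g) (f : LF E) (e : E') (x : ℝ) (n : ℤ) :
    cf (pull g hg f) (e, x) n = cf f (g e, x) n := rfl

theorem LF.dirL_pull {g : E' → E} (hg : ContDiff ℝ (⊤ : ℕ∞) g) {g' : E' →L[ℝ] E}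
    (hg' : ∀ e, HasFDerivAt g g' e) (f : LF E) (v : E') (t : ℝ) :
    dirL (v, t) (pull g hg f) = pull g hg (dirL (g' v, t) f) := ext_cf fun p n => by
  obtain ⟨e, x⟩ := p
  rw [cf_dirL, cf_pull, cf_dirL]
  have h1 := ((f.contDiff_cf n).differentiable (by simp) (g e, x)).hasFDerivAt
  have h2 : HasFDerivAt (fun p : E' × ℝ => (g p.1, p.2)) (g'.prodMap (.id ℝ ℝ)) (e, x) :=
    ((hg' e).comp (e, x) hasFDerivAt_fst).prodMk hasFDerivAt_snd
  have h3 := (h1.comp (e, x) h2).fderiv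
  exact congrArg (fun A => A (v, t)) h3

theorem LF.X_pull {g : E' → E} (hg : ContDiff ℝ (⊤ : ℕ∞) g) {g' : E' →L[ℝ] E}
    (hg' : ∀ e, HasFDerivAt g g' e) (f : LF E) : X (pull g hg f) = pull g hg (X f) := by
  rw [X, dirL_pull hg hg', map_zero]; rfl

/-- The change of parameters on pairs. -/
def pullB (g : E' → E) (hg : ContDiff ℝ (⊤ : ℕ∞) g) (L : LF E × LF E) : LF E' × LF E' :=
  (pull g hg L.1, pull g hg L.2)

variable {g : E' → E} (hg : ContDiff ℝ (⊤ : ℕ∞) g)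

theorem toPair_pullB (L : LF E × LF E) (e : E') : toPair (pullB g hg L) e = toPair L (g e) := rfl

theorem toForm_pullB (L : LF E × LF E) (e : E') : toForm (pullB g hg L) e = toForm L (g e) := rfl

theorem pullB_mul (L M : LF E × LF E) : pullB g hg (L * M) = pullB g hg L * pullB g hg M := rfl

theorem trB_pullB (L : LF E × LF E) (e : E') : trB (pullB g hg L) e = trB L (g e) := rfl

theorem IsPt.pullB {L : LF E × LF E} (h : IsPt L) : IsPt (pullB g hg L) :=
  ⟨fun p => h.1 (g p.1, p.2), fun p => h.2.1 (g p.1, p.2), fun p => h.2.2 (g p.1, p.2)⟩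

theorem IsTan.pullB {L : LF E × LF E} (h : IsTan L) : IsTan (pullB g hg L) :=
  ⟨fun p => h.1 (g p.1, p.2), fun p => h.2 (g p.1, p.2)⟩

theorem IsCov.pullB {L : LF E × LF E} (h : IsCov L) : IsCov (pullB g hg L) :=
  ⟨fun p => h.1 (g p.1, p.2), fun p => h.2 (g p.1, p.2)⟩

theorem dirB_pullB {g' : E' →L[ℝ] E} (hg' : ∀ e, HasFDerivAt g g' e) (L : LF E × LF E) (v : E') :
    dirB v (pullB g hg L) = pullB g hg (dirB (g' v) L) :=
  Prod.ext (dirL_pull hg hg' _ _ _) (dirL_pull hg hg' _ _ _)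

theorem pullB_br {g' : E' →L[ℝ] E} (hg' : ∀ e, HasFDerivAt g g' e) (L M : LF E × LF E) :
    pullB g hg ((todaData E).br L M) = (todaData E').br (pullB g hg L) (pullB g hg M) := by
  change (pull g hg (D L.1 * X M.1 - D M.1 * X L.1), pull g hg (D L.2 * X M.2 - D M.2 * X L.2)) =
    (D (pull g hg L.1) * X (pull g hg M.1) - D (pull g hg M.1) * X (pull g hg L.1),
      D (pull g hg L.2) * X (pull g hg M.2) - D (pull g hg M.2) * X (pull g hg L.2))
  simp only [X_pull hg hg']
  rfl

theorem pullB_cov {g' : E' →L[ℝ] E} (hg' : ∀ e, HasFDerivAt g g' e) (L o₁ o₂ : LF E × LF E) :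
    pullB g hg ((todaData E).cov L o₁ o₂)
      = (todaData E').cov (pullB g hg L) (pullB g hg o₁) (pullB g hg o₂) := by
  have hr : ∀ o, pullB g hg ((todaData E).rho L o)
      = (todaData E').rho (pullB g hg L) (pullB g hg o) := fun o => rfl
  have hs : ∀ o, pullB g hg ((todaData E).sig L o)
      = (todaData E').sig (pullB g hg L) (pullB g hg o) := fun o => by
    rw [QuadraticData.sig, QuadraticData.sig, ← pullB_br hg hg']; rfl
  simp only [QuadraticData.cov, ← hr, ← hs, ← pullB_br hg hg']
  rfl

theorem pullB_pencilCov {g' : E' →L[ℝ] E} (hg' : ∀ e, HasFDerivAt g g' e) (a b : ℂ)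
    (L o₁ o₂ : LF E × LF E) : pullB g hg (pencilCov a b L o₁ o₂)
      = pencilCov a b (pullB g hg L) (pullB g hg o₁) (pullB g hg o₂) := by
  have hsh : pullB g hg L + shiftDir E' = pullB g hg (L + shiftDir E) := rfl
  rw [pencilCov, pencilCov, hsh, ← pullB_cov hg hg', ← pullB_cov hg hg']
  rfl

/-- The projection of a pair to the cotangent directions, which does not change its pairing with
tangent vectors. -/
def projCov (T : LF E × LF E) : LF E × LF E := (ge 0 T.1, le 1 T.2)

theorem isCov_projCov (T : LF E × LF E) : IsCov (projCov T) := ⟨Ge.ge _ _, Le.le _ _⟩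

theorem trB_projCov_mul (T : LF E × LF E) {α : LF E × LF E} (h : IsTan α) :
    trB (projCov T * α) = trB (T * α) := by
  have h1 := tr_mul_ge T.1 α.1 0
  have h2 := tr_mul_le T.2 α.2 1
  rw [neg_zero, h.1.le_eq le_rfl] at h1
  rw [h.2.ge_eq le_rfl] at h2
  rw [trB_apply, trB_apply]
  exact congrArg₂ _ h1 h2

theorem toForm_injective {o o' : LF E × LF E} (h : ∀ e, toForm o e = toForm o' e) : o = o' := by
  refine Prod.ext (ext_fn (funext fun p => funext fun z => ?_))
    (ext_fn (funext fun p => funext fun z => ?_))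
  · rw [← z_mul_toForm_fst, h, z_mul_toForm_fst]
  · rw [← z_mul_toForm_snd, h, z_mul_toForm_snd]

theorem toPair_injective {o o' : LF E × LF E} (h : ∀ e, toPair o e = toPair o' e) : o = o' :=
  Prod.ext (ext_fn (funext fun p => congrArg Prod.fst (congrFun (h p.1) p.2)))
    (ext_fn (funext fun p => congrArg Prod.snd (congrFun (h p.1) p.2)))

theorem LF.hasDerivAt_fn_t (f : LF ℝ) (t x : ℝ) (z : Circle) :
    HasDerivAt (fun s => f.fn (s, x) z) ((dirL (1, 0) f).fn (t, x) z) t := by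
  have h1 := ((f.smooth.contDiff_apply z).differentiable (by simp) (t, x)).hasFDerivAt
  have h2 : HasDerivAt (fun s : ℝ => (s, x)) ((1 : ℝ), (0 : ℝ)) t :=
    (hasDerivAt_id t).prodMk (hasDerivAt_const t x)
  exact h1.comp_hasDerivAt t h2

theorem pderiv_toPair (L : LF ℝ × LF ℝ) (t x : ℝ) :
    pderiv (fun s => toPair L s x) t = toPair (dirB 1 L) t x :=
  Prod.ext (funext fun z => (hasDerivAt_fn_t L.1 t x z).deriv)
    (funext fun z => (hasDerivAt_fn_t L.2 t x z).deriv)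

theorem pderiv_toForm (o : LF ℝ × LF ℝ) (t x : ℝ) :
    pderiv (fun s => toForm o s x) t = toForm (dirB 1 o) t x :=
  Prod.ext (funext fun z => ((hasDerivAt_fn_t o.1 t x z).const_mul _).deriv)
    (funext fun z => ((hasDerivAt_fn_t o.2 t x z).const_mul _).deriv)

theorem hasDerivAt_trB (f : LF ℝ × LF ℝ) (t : ℝ) :
    HasDerivAt (trB f) (trB (dirB 1 f) t) t := by
  obtain ⟨A, hA, hA'⟩ := exists_hasFDerivAt_tr f.1 t
  obtain ⟨B, hB, hB'⟩ := exists_hasFDerivAt_tr f.2 t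
  have := (hA.hasDerivAt.add hB.hasDerivAt)
  rw [hA', hB'] at this
  exact this

/-! ### Nondegeneracy of the pairing -/

theorem LF.cf_mul_mono (f : LF E) (k : ℤ) (u : E × ℝ → ℂ) (hu : ContDiff ℝ (⊤ : ℕ∞) u)
    (hp : ∀ e x, u (e, x + 2 * Real.pi) = u (e, x)) (p : E × ℝ) (n : ℤ) :
    cf (f * mono k u hu hp) p n = u p * cf f p (n - k) := by
  have : (f * mono k u hu hp).fn p = fun z : Circle => (z : ℂ) ^ k * (u p * f.fn p z) := by
    funext z
    change f.fn p z * (u p * (z : ℂ) ^ k) = _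
    ring
  rw [cf, this, coeff_mul_zpow, coeff_const_mul, cf]

theorem eq_zero_of_integral_mul_conj {u : ℝ → ℂ} (hu : Continuous u)
    (hp : Function.Periodic u (2 * Real.pi))
    (h : ∫ x in (0 : ℝ)..2 * Real.pi, (starRingEnd ℂ) (u x) * u x = 0) (x : ℝ) : u x = 0 := by
  have e : ∀ x, (starRingEnd ℂ) (u x) * u x = ((‖u x‖ ^ 2 : ℝ) : ℂ) := fun x => by
    rw [mul_comm, Complex.mul_conj, Complex.normSq_eq_norm_sq]
  simp_rw [e] at h
  rw [intervalIntegral.integral_ofReal, Complex.ofReal_eq_zero] at h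
  have hc : ContinuousOn (fun x => ‖u x‖ ^ 2) (Set.Icc 0 (2 * Real.pi)) :=
    (hu.norm.pow 2).continuousOn
  by_contra hx
  obtain ⟨y, hy, hxy⟩ := hp.exists_mem_Ico₀ Real.two_pi_pos x
  have hpos := intervalIntegral.integral_pos Real.two_pi_pos hc (fun x _ => by positivity)
    ⟨y, ⟨hy.1, hy.2.le⟩, by
      rw [hxy] at hx
      have := norm_pos_iff.2 hx
      positivity⟩
  exact hpos.ne' h

/-- The conjugate of the `n`-th Laurent coefficient, times `z⁻ⁿ`, is a test function that detects
this coefficient. -/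
theorem LF.exists_conj_mono (f : LF E) (n : ℤ) : ∃ g : LF E, Le (-n) g ∧ Ge (-n) g ∧
    ∀ e, tr (f * g) e = 0 → ∀ x, cf f (e, x) n = 0 := by
  have hs : ContDiff ℝ (⊤ : ℕ∞) fun p => (starRingEnd ℂ) (cf f p n) :=
    Complex.conjCLE.contDiff.comp (f.contDiff_cf n)
  have hp : ∀ e x, (starRingEnd ℂ) (cf f (e, x + 2 * Real.pi) n) = (starRingEnd ℂ) (cf f (e, x) n) :=
    fun e x => by rw [cf, cf, f.periodic]
  refine ⟨mono (-n) _ hs hp, fun p m hm => ?_, fun p m hm => ?_, fun e he => ?_⟩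
  · rw [cf_mono, if_neg (by omega)]
  · rw [cf_mono, if_neg (by omega)]
  · refine eq_zero_of_integral_mul_conj (u := fun x => cf f (e, x) n)
      ((f.contDiff_cf n).continuous.comp (by fun_prop))
      (fun x => by simp only [cf, f.periodic]) ?_
    simpa only [tr_apply, cf_mul_mono, zero_sub, neg_neg] using he

/-- The pairing of covectors with tangent vectors is nondegenerate. -/
theorem IsCov.eq_zero {o : LF E × LF E} (h : IsCov o)
    (h0 : ∀ α, IsTan α → trB (o * α) = 0) : o = 0 := by
  refine Prod.ext (ext_cf fun p n => ?_) (ext_cf fun p n => ?_)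
  · refine Eq.trans ?_ (cf_zero p n).symm
    by_cases hn : n < 0
    · exact h.1 p n hn
    · obtain ⟨g, g1, g2, g3⟩ := exists_conj_mono o.1 n
      refine g3 p.1 ?_ p.2
      have := congrFun (h0 (g, 0) ⟨g1.mono (by omega), fun p n _ => cf_zero p n⟩) p.1
      simpa [trB_apply] using this
  · refine Eq.trans ?_ (cf_zero p n).symm
    by_cases hn : n > 1
    · exact h.2 p n hn
    · obtain ⟨g, g1, g2, g3⟩ := exists_conj_mono o.2 n
      refine g3 p.1 ?_ p.2
      have := congrFun (h0 (0, g) ⟨fun p n _ => cf_zero p n, g2.mono (by omega)⟩) p.1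
      simpa [trB_apply] using this

/-! ### Affine families -/

/-- A scalar function of the parameters, as an element of the algebra. -/
def LF.scal (u : E → ℝ) (hu : ContDiff ℝ (⊤ : ℕ∞) u) : LF E :=
  mono 0 (fun p => (u p.1 : ℂ)) (Complex.ofRealCLM.contDiff.comp (hu.comp contDiff_fst))
    fun _ _ => rfl

theorem LF.cf_scal (u : E → ℝ) (hu : ContDiff ℝ (⊤ : ℕ∞) u) (p : E × ℝ) (n : ℤ) :
    cf (scal u hu) p n = if n = 0 then (u p.1 : ℂ) else 0 := coeff_monomial _ _ _

theorem LF.fn_scal_mul (u : E → ℝ) (hu : ContDiff ℝ (⊤ : ℕ∞) u) (f : LF E) (p : E × ℝ) :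
    (scal u hu * f).fn p = (u p.1 : ℂ) • f.fn p := by
  funext z
  change ((u p.1 : ℂ) * (z : ℂ) ^ (0 : ℤ)) * f.fn p z = _
  rw [zpow_zero, mul_one]; rfl

/-- The family `(e, s) ↦ γ_e + s Y_e`. -/
def affineFamily (L Y : LF E × LF E) : LF (E × ℝ) × LF (E × ℝ) :=
  pullB Prod.fst contDiff_fst L + (scal Prod.snd contDiff_snd * pull Prod.fst contDiff_fst Y.1,
    scal Prod.snd contDiff_snd * pull Prod.fst contDiff_fst Y.2)

theorem toPair_affineFamily (L Y : LF E × LF E) (q : E × ℝ) :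
    toPair (affineFamily L Y) q = toPair L q.1 + q.2 • toPair Y q.1 := by
  funext x
  refine Prod.ext ?_ ?_
  · change (pull Prod.fst contDiff_fst L.1 + scal Prod.snd contDiff_snd * pull Prod.fst
      contDiff_fst Y.1).fn (q, x) = _
    rw [fn_add, fn_scal_mul]; rfl
  · change (pull Prod.fst contDiff_fst L.2 + scal Prod.snd contDiff_snd * pull Prod.fst
      contDiff_fst Y.2).fn (q, x) = _
    rw [fn_add, fn_scal_mul]; rfl

theorem isPt_affineFamily {L Y : LF E × LF E} (hL : IsPt L) (hY : IsTan Y) :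
    IsPt (affineFamily L Y) := by
  refine (hL.pullB _).add ⟨?_, ?_⟩
  · have h : Le 0 (scal (E := E × ℝ) Prod.snd contDiff_snd) := fun p n hn => by
      rw [cf_scal, if_neg (by omega)]
    exact h.mul (hY.pullB contDiff_fst).1
  · have h : Ge 0 (scal (E := E × ℝ) Prod.snd contDiff_snd) := fun p n hn => by
      rw [cf_scal, if_neg (by omega)]
    have := h.mul (hY.pullB (g := (Prod.fst : E × ℝ → E)) contDiff_fst).2
    rwa [zero_add] at this

theorem dirB_affineFamily (L Y : LF E × LF E) :
    dirB (0, 1) (affineFamily L Y) = pullB Prod.fst contDiff_fst Y := by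
  have hs : dirL ((0, 1), 0) (scal (E := E × ℝ) Prod.snd contDiff_snd) = 1 := ext_cf fun p n => by
    rw [cf_dirL]
    simp only [cf_scal, cf_one]
    split_ifs
    · have : HasFDerivAt (fun q : (E × ℝ) × ℝ => ((q.1.2 : ℝ) : ℂ)) (Complex.ofRealCLM.comp
          ((ContinuousLinearMap.snd ℝ E ℝ).comp (ContinuousLinearMap.fst ℝ (E × ℝ) ℝ))) p :=
        (Complex.ofRealCLM.comp ((ContinuousLinearMap.snd ℝ E ℝ).comp
          (ContinuousLinearMap.fst ℝ (E × ℝ) ℝ))).hasFDerivAt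
      rw [this.fderiv]; simp
    · simp
  have hp : ∀ f : LF E, dirL (((0 : E), (1 : ℝ)), (0 : ℝ)) (pull Prod.fst contDiff_fst f) = 0 :=
    fun f => by
      rw [dirL_pull contDiff_fst (fun _ => hasFDerivAt_fst)]
      refine ext_cf fun p n => ?_
      obtain ⟨q, x⟩ := p
      rw [cf_pull, cf_dirL, cf_zero]
      exact map_zero _
  have key : ∀ f f' : LF E, dirL ((0, 1), 0) (pull Prod.fst contDiff_fst f
      + scal Prod.snd contDiff_snd * pull Prod.fst contDiff_fst f')
      = pull Prod.fst contDiff_fst f' := fun f f' => by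
    rw [map_add, dirL_mul, hp, hp, hs]; ring
  exact Prod.ext (key _ _) (key _ _)

end Pull

open LF

/-! ### Differentials of functionals -/

section Differentials

theorem HasDifferential.exists_toForm {F : (ℝ → Pair) → ℂ} {δ : (ℝ → Pair) → ℝ → Pair}
    (h : HasDifferential F δ) {E : Type} [NormedAddCommGroup E] [NormedSpace ℝ E]
    [FiniteDimensional ℝ E] {L : LF E × LF E} (hL : IsPt L) :
    ∃ o, IsCov o ∧ ∀ e, δ (toPair L e) = toForm o e := by
  obtain ⟨o, ho, h1⟩ := (h.2.1 E _ (loopFamily_toPair hL)).exists_eq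
  exact ⟨o, ho, fun e => congrFun h1 e⟩

theorem HasDifferential.hasDerivAt {F : (ℝ → Pair) → ℂ} {δ : (ℝ → Pair) → ℝ → Pair}
    (h : HasDifferential F δ) {L o : LF ℝ × LF ℝ} (hL : IsPt L)
    (ho : ∀ t, δ (toPair L t) = toForm o t) (t : ℝ) :
    HasDerivAt (fun s => F (toPair L s)) (trB (o * dirB 1 L) t) t := by
  have := h.2.2 _ (loopFamily_toPair hL) t
  rwa [ho, funext (pderiv_toPair L t), loopPairing_toForm] at this

/-- To have a differential it suffices to have one along the families given by elements of the
algebra. -/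
theorem HasDifferential.of_families {F : (ℝ → Pair) → ℂ} {δ : (ℝ → Pair) → ℝ → Pair}
    (h1 : ∀ (E : Type) [NormedAddCommGroup E] [NormedSpace ℝ E] [FiniteDimensional ℝ E]
      (L : LF E × LF E), IsPt L → ∃ o, IsCov o ∧ ∀ e, δ (toPair L e) = toForm o e)
    (h2 : ∀ L o : LF ℝ × LF ℝ, IsPt L → (∀ t, δ (toPair L t) = toForm o t) → ∀ t,
      HasDerivAt (fun s => F (toPair L s)) (trB (o * dirB 1 L) t) t) : HasDifferential F δ := by
  have hf : ∀ (E : Type) [NormedAddCommGroup E] [NormedSpace ℝ E] [FiniteDimensional ℝ E]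
      (γ : E → ℝ → Pair), LoopFamily γ → FormFamily fun t => δ (γ t) := by
    intro E _ _ _ γ hγ
    obtain ⟨L, hL, rfl⟩ := hγ.exists_eq
    obtain ⟨o, ho, h⟩ := h1 E L hL
    rw [funext h]
    exact formFamily_toForm ho
  refine ⟨fun γ hγ => (hf ℝ _ (loopFamily_const hγ)).mem 0, hf, fun γ hγ t => ?_⟩
  obtain ⟨L, hL, rfl⟩ := hγ.exists_eq
  obtain ⟨o, ho, h⟩ := h1 ℝ L hL
  rw [h, funext (pderiv_toPair L t), loopPairing_toForm]
  exact h2 L o hL h t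

theorem exists_toPair_of_mem_LM {γ : ℝ → Pair} (h : γ ∈ LM) :
    ∃ L : LF PUnit × LF PUnit, IsPt L ∧ γ = toPair L PUnit.unit := by
  obtain ⟨L, hL, h1⟩ := (loopFamily_const (E := PUnit) h).exists_eq
  exact ⟨L, hL, congrFun h1 PUnit.unit⟩

theorem exists_toPair_of_mem_TLM {γ : ℝ → Pair} (h : γ ∈ TLM) :
    ∃ L : LF PUnit × LF PUnit, IsTan L ∧ γ = toPair L PUnit.unit := by
  obtain ⟨L, hL, h1⟩ := (tanFamily_const (E := PUnit) h).exists_eq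
  exact ⟨L, hL, congrFun h1 PUnit.unit⟩

theorem exists_toForm_of_mem {γ : ℝ → Pair} (h : γ ∈ TstarLM) :
    ∃ L : LF PUnit × LF PUnit, IsCov L ∧ γ = toForm L PUnit.unit := by
  obtain ⟨L, hL, h1⟩ := (formFamily_const (E := PUnit) h).exists_eq
  exact ⟨L, hL, congrFun h1 PUnit.unit⟩

/-- The straight line through `γ` in the direction `α`. -/
theorem exists_line {γ α : ℝ → Pair} (hγ : γ ∈ LM) (hα : α ∈ TLM) :
    ∃ L : LF ℝ × LF ℝ, IsPt L ∧ (∀ t : ℝ, toPair L t = γ + t • α) ∧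
      ∀ t, toPair (dirB 1 L) t = α := by
  obtain ⟨L, hL, rfl⟩ := exists_toPair_of_mem_LM hγ
  obtain ⟨Y, hY, rfl⟩ := exists_toPair_of_mem_TLM hα
  have hg : ContDiff ℝ (⊤ : ℕ∞) fun t : ℝ => (PUnit.unit, t) := contDiff_prodMk_const _
  have hg' : ∀ t : ℝ, HasFDerivAt (fun t : ℝ => (PUnit.unit, t))
      (ContinuousLinearMap.inr ℝ PUnit ℝ) t := fun t => hasFDerivAt_prodMk_right _ t
  refine ⟨pullB _ hg (affineFamily L Y), (isPt_affineFamily hL hY).pullB hg, fun t => ?_,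
    fun t => ?_⟩
  · rw [toPair_pullB, toPair_affineFamily]
  · rw [dirB_pullB hg hg', ContinuousLinearMap.inr_apply, show (0 : PUnit) = PUnit.unit from rfl,
      show ((PUnit.unit, (1 : ℝ)) : PUnit × ℝ) = (0, 1) from rfl, dirB_affineFamily]
    rfl

theorem HasDifferential.hasDerivAt_line {F : (ℝ → Pair) → ℂ} {δ : (ℝ → Pair) → ℝ → Pair}
    (h : HasDifferential F δ) {γ α : ℝ → Pair} (hγ : γ ∈ LM) (hα : α ∈ TLM) :
    HasDerivAt (fun t : ℝ => F (γ + t • α)) (loopPairing (δ γ) α) 0 := by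
  obtain ⟨L, hL, h1, h2⟩ := exists_line hγ hα
  obtain ⟨o, ho, h3⟩ := h.exists_toForm hL
  have := h.hasDerivAt hL h3 0
  rw [← loopPairing_toForm, ← h3, h1, h2, zero_smul, add_zero] at this
  exact this.congr_of_eventuallyEq (Filter.Eventually.of_forall fun t => by simp only [h1])

/-- On the loop space the differential of a functional is unique. -/
theorem HasDifferential.unique {F : (ℝ → Pair) → ℂ} {δ δ' : (ℝ → Pair) → ℝ → Pair}
    (h : HasDifferential F δ) (h' : HasDifferential F δ') {γ : ℝ → Pair} (hγ : γ ∈ LM) :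
    δ γ = δ' γ := by
  obtain ⟨o, ho, h1⟩ := exists_toForm_of_mem (h.1 γ hγ)
  obtain ⟨o', ho', h2⟩ := exists_toForm_of_mem (h'.1 γ hγ)
  have : o - o' = 0 := (ho.sub ho').eq_zero fun α hα => by
    have hα' : toPair α PUnit.unit ∈ TLM := (tanFamily_toPair hα).mem _
    have := (h.hasDerivAt_line hγ hα').unique (h'.hasDerivAt_line hγ hα')
    rw [h1, h2, loopPairing_toForm, loopPairing_toForm] at this
    funext e
    rw [sub_mul, map_sub, Pi.sub_apply, show e = PUnit.unit from rfl, this, sub_self]; rfl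
  rw [h1, h2, sub_eq_zero.1 this]

theorem Admissible.hasDifferential {F : (ℝ → Pair) → ℂ} (h : Admissible F) :
    HasDifferential F (diff F) := by
  rw [diff, dif_pos h]
  exact h.choose_spec

theorem HasDifferential.diff_eq {F : (ℝ → Pair) → ℂ} {δ : (ℝ → Pair) → ℝ → Pair}
    (h : HasDifferential F δ) {γ : ℝ → Pair} (hγ : γ ∈ LM) : diff F γ = δ γ :=
  (Admissible.hasDifferential ⟨δ, h⟩).unique h hγ

/-! ### The second derivative -/

/-- The second derivative of `F` at `γ` in the direction `Y`, a one-form. -/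
def hess (F : (ℝ → Pair) → ℂ) (γ Y : ℝ → Pair) : ℝ → Pair :=
  fun x => pderiv (fun s => diff F (γ + s • Y) x) 0

theorem Admissible.hess_eq {F : (ℝ → Pair) → ℂ} {E : Type} [NormedAddCommGroup E]
    [NormedSpace ℝ E] [FiniteDimensional ℝ E] {L Y : LF E × LF E}
    {o : LF (E × ℝ) × LF (E × ℝ)} (ho : ∀ q, diff F (toPair (affineFamily L Y) q) = toForm o q)
    (e : E) : hess F (toPair L e) (toPair Y e)
      = toForm (pullB _ contDiff_prodMk_zero (dirB (0, 1) o)) e := by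
  have hg : ContDiff ℝ (⊤ : ℕ∞) fun t : ℝ => (e, t) := contDiff_prodMk_const _
  funext x
  have h1 : (fun s : ℝ => diff F (toPair L e + s • toPair Y e) x)
      = fun s => toForm (pullB _ hg o) s x := funext fun s => by
    rw [toForm_pullB, ← ho, toPair_affineFamily]
  rw [hess, h1, pderiv_toForm, dirB_pullB hg (fun t => hasFDerivAt_prodMk_right _ t)]
  rfl

theorem Admissible.exists_hess {F : (ℝ → Pair) → ℂ} (hF : Admissible F) {E : Type}
    [NormedAddCommGroup E] [NormedSpace ℝ E] [FiniteDimensional ℝ E] {L Y : LF E × LF E}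
    (hL : IsPt L) (hY : IsTan Y) :
    ∃ h, IsCov h ∧ ∀ e, hess F (toPair L e) (toPair Y e) = toForm h e := by
  obtain ⟨o, ho, h1⟩ := hF.hasDifferential.exists_toForm (isPt_affineFamily hL hY)
  exact ⟨_, (ho.dirB _).pullB _, fun e => Admissible.hess_eq h1 e⟩

/-- Symmetry of mixed second derivatives along a two-parameter family of loops. -/
theorem HasDifferential.dirB_symm {F : (ℝ → Pair) → ℂ} {δ : (ℝ → Pair) → ℝ → Pair}
    (hF : HasDifferential F δ) {L o : LF (ℝ × ℝ) × LF (ℝ × ℝ)} (hL : IsPt L)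
    (ho : ∀ q, δ (toPair L q) = toForm o q) :
    trB (dirB (1, 0) o * dirB (0, 1) L) = trB (dirB (0, 1) o * dirB (1, 0) L) := by
  set u₁ := trB (o * dirB (1, 0) L) with hu₁
  set u₂ := trB (o * dirB (0, 1) L) with hu₂
  have hd : ∀ (f : LF (ℝ × ℝ) × LF (ℝ × ℝ)) (q : ℝ × ℝ), ∃ A : ℝ × ℝ →L[ℝ] ℂ,
      HasFDerivAt (trB f) A q ∧ ∀ v, A v = trB (dirB v f) q := fun f q => by
    obtain ⟨A, hA, hA'⟩ := exists_hasFDerivAt_tr f.1 q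
    obtain ⟨B, hB, hB'⟩ := exists_hasFDerivAt_tr f.2 q
    exact ⟨A + B, hA.add hB, fun v => by rw [add_apply, hA', hB']; rfl⟩
  have hc : ∀ f : LF (ℝ × ℝ) × LF (ℝ × ℝ), Continuous (trB f) := fun f =>
    (continuous_tr f.1).add (continuous_tr f.2)
  have hp₁ : ∀ q : ℝ × ℝ, HasDerivAt (fun t => F (toPair L (t, q.2))) (u₁ q) q.1 := fun q => by
    have hg : ContDiff ℝ (⊤ : ℕ∞) fun t : ℝ => (t, q.2) := contDiff_id.prodMk contDiff_const
    have := hF.hasDerivAt (hL.pullB hg) (o := pullB _ hg o) (fun t => ho (t, q.2)) q.1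
    rwa [dirB_pullB hg (fun t => hasFDerivAt_prodMk_left t _), ← pullB_mul, trB_pullB] at this
  have hp₂ : ∀ q : ℝ × ℝ, HasDerivAt (fun t => F (toPair L (q.1, t))) (u₂ q) q.2 := fun q => by
    have hg : ContDiff ℝ (⊤ : ℕ∞) fun t : ℝ => (q.1, t) := contDiff_prodMk_const _
    have := hF.hasDerivAt (hL.pullB hg) (o := pullB _ hg o) (fun t => ho (q.1, t)) q.2
    rwa [dirB_pullB hg (fun t => hasFDerivAt_prodMk_right _ t), ← pullB_mul, trB_pullB] at this
  have hcsm : ∀ u : ℝ × ℝ → ℂ, Continuous u →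
      Continuous fun q => ContinuousLinearMap.toSpanSingleton ℝ (u q) := fun u hu => by
    exact (ContinuousLinearMap.toSpanSingletonCLE (𝕜 := ℝ) (E := ℂ)).continuous.comp hu
  have hf : ∀ q : ℝ × ℝ, HasFDerivAt (fun q => F (toPair L q))
      ((ContinuousLinearMap.toSpanSingleton ℝ (u₁ q)).coprod
        (ContinuousLinearMap.toSpanSingleton ℝ (u₂ q))) q := fun q =>
    (hasStrictFDerivAt_uncurry_coprod (𝕜 := ℝ) (u := q) (f := fun t s => F (toPair L (t, s)))
      (f₁ := fun t s => ContinuousLinearMap.toSpanSingleton ℝ (u₁ (t, s)))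
      (f₂ := fun t s => ContinuousLinearMap.toSpanSingleton ℝ (u₂ (t, s)))
      (Filter.Eventually.of_forall fun q => (hp₁ q).hasFDerivAt)
      (Filter.Eventually.of_forall fun q => (hp₂ q).hasFDerivAt)
      (hcsm _ (hc _)).continuousAt (hcsm _ (hc _)).continuousAt).hasFDerivAt
  funext q
  obtain ⟨A₁, hA₁, hA₁'⟩ := hd (o * dirB (1, 0) L) q
  obtain ⟨A₂, hA₂, hA₂'⟩ := hd (o * dirB (0, 1) L) q
  let T := (ContinuousLinearMap.toSpanSingletonCLE (𝕜 := ℝ) (E := ℂ)).toContinuousLinearMap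
  let S := (ContinuousLinearMap.coprodEquivL (𝕜 := ℝ) (E := ℝ) (F := ℝ) (G := ℂ)
    ℝ).toContinuousLinearMap
  have hf' : HasFDerivAt (fun q => (ContinuousLinearMap.toSpanSingleton ℝ (u₁ q)).coprod
        (ContinuousLinearMap.toSpanSingleton ℝ (u₂ q)))
      (S.comp ((T.comp A₁).prod (T.comp A₂))) q :=
    S.hasFDerivAt.comp q ((T.hasFDerivAt.comp q hA₁).prodMk (T.hasFDerivAt.comp q hA₂))
  have hsymm := second_derivative_symmetric hf hf' (1, 0) (0, 1)
  have h1 : A₂ (1, 0) = A₁ (0, 1) := by simpa [S, T] using hsymm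
  have hcomm : dirB (1, 0) (dirB (0, 1) L) = dirB (0, 1) (dirB (1, 0) L) :=
    Prod.ext (dirL_comm _ _ _) (dirL_comm _ _ _)
  rw [hA₁', hA₂', dirB_mul, dirB_mul, hcomm, map_add, map_add, Pi.add_apply, Pi.add_apply] at h1
  exact add_right_cancel h1

end Differentials

section Hessian

/-- The derivative of `dF` along a curve `L`, paired with `Y`, is the second derivative of `F` in
the direction `Y`, paired with the velocity of the curve. -/
theorem Admissible.trB_dirB_mul {F : (ℝ → Pair) → ℂ} (hF : Admissible F)
    {L Y o h : LF ℝ × LF ℝ} (hL : IsPt L) (hY : IsTan Y)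
    (ho : ∀ t, diff F (toPair L t) = toForm o t)
    (hh : ∀ t, hess F (toPair L t) (toPair Y t) = toForm h t) :
    trB (dirB 1 o * Y) = trB (h * dirB 1 L) := by
  obtain ⟨q, -, hq⟩ := hF.hasDifferential.exists_toForm (isPt_affineFamily hL hY)
  have hsymm := hF.hasDifferential.dirB_symm (isPt_affineFamily hL hY) hq
  have hi : ContDiff ℝ (⊤ : ℕ∞) fun t : ℝ => (t, (0 : ℝ)) := contDiff_prodMk_zero
  have hi' : ∀ t : ℝ, HasFDerivAt (fun t : ℝ => (t, (0 : ℝ))) (ContinuousLinearMap.inl ℝ ℝ ℝ) t :=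
    fun t => hasFDerivAt_prodMk_left t _
  have hoq : o = pullB _ hi q := toForm_injective fun t => by
    rw [← ho, toForm_pullB, ← hq, toPair_affineFamily, zero_smul, add_zero]
  have hhq : h = pullB _ hi (dirB (0, 1) q) := toForm_injective fun t => by
    rw [← hh, Admissible.hess_eq hq]
  have hLq : L = pullB _ hi (affineFamily L Y) := toPair_injective fun t => by
    rw [toPair_pullB, toPair_affineFamily, zero_smul, add_zero]
  have hLd : dirB 1 L = pullB _ hi (dirB (1, 0) (affineFamily L Y)) := by
    conv_lhs => rw [hLq]
    rw [dirB_pullB hi hi']; rfl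
  have hYq : Y = pullB _ hi (dirB (0, 1) (affineFamily L Y)) := by
    rw [dirB_affineFamily]
    exact toPair_injective fun t => rfl
  rw [hhq, hLd, hoq, dirB_pullB hi hi']
  conv_lhs => rw [hYq]
  funext t
  rw [← pullB_mul, ← pullB_mul, trB_pullB, trB_pullB]
  exact congrFun hsymm (t, 0)

theorem Admissible.hess_symm {F : (ℝ → Pair) → ℂ} (hF : Admissible F) {γ Y Z : ℝ → Pair}
    (hγ : γ ∈ LM) (hY : Y ∈ TLM) (hZ : Z ∈ TLM) :
    loopPairing (hess F γ Y) Z = loopPairing (hess F γ Z) Y := by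
  obtain ⟨L, hL, h1, h2⟩ := exists_line hγ hZ
  obtain ⟨Y, hYT, rfl⟩ := exists_toPair_of_mem_TLM hY
  have hc : ContDiff ℝ (⊤ : ℕ∞) fun _ : ℝ => PUnit.unit := contDiff_const
  obtain ⟨o, ho, ho'⟩ := hF.hasDifferential.exists_toForm hL
  obtain ⟨h, hh, hh'⟩ := hF.exists_hess hL (hYT.pullB hc)
  have := congrFun (hF.trB_dirB_mul hL (hYT.pullB hc) ho' hh') 0
  rw [← loopPairing_toForm, ← loopPairing_toForm, ← hh', h2, h1, zero_smul, add_zero,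
    toPair_pullB] at this
  rw [← this]
  congr 1
  funext x
  rw [hess, ← pderiv_toForm]
  congr 1
  funext s
  rw [← ho', h1]

end Hessian

/-! ### The differential of a bracket -/

section Bracket

open Classical in
/-- The element of the algebra that represents a loop (zero outside `LM`). -/
def liftPair (γ : ℝ → Pair) : LF PUnit × LF PUnit :=
  if h : γ ∈ LM then (exists_toPair_of_mem_LM h).choose else 0

open Classical in
/-- The element of the algebra that represents a one-form (zero outside `TstarLM`). -/
def liftForm (ω : ℝ → Pair) : LF PUnit × LF PUnit :=
  if h : ω ∈ TstarLM then (exists_toForm_of_mem h).choose else 0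

/-- The one-form `α ↦ ⟨ω, (∂_α P)(η)⟩` for `P = a P₁ + b P₂`. -/
def covForm (a b : ℂ) (γ ω η : ℝ → Pair) : ℝ → Pair :=
  toForm (projCov (pencilCov a b (liftPair γ) (liftForm ω) (liftForm η))) PUnit.unit

variable {E : Type} [NormedAddCommGroup E] [NormedSpace ℝ E] [FiniteDimensional ℝ E]

theorem liftPair_toPair {L : LF E × LF E} (hL : IsPt L) (e : E) :
    liftPair (toPair L e) = pullB (fun _ => e) contDiff_const L := by
  have h := (loopFamily_toPair hL).mem e
  rw [liftPair, dif_pos h]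
  exact toPair_injective fun _ => (exists_toPair_of_mem_LM h).choose_spec.2.symm

theorem liftForm_toForm {o : LF E × LF E} (ho : IsCov o) (e : E) :
    liftForm (toForm o e) = pullB (fun _ => e) contDiff_const o := by
  have h := (formFamily_toForm ho).mem e
  rw [liftForm, dif_pos h]
  exact toForm_injective fun _ => (exists_toForm_of_mem h).choose_spec.2.symm

theorem covForm_toForm (a b : ℂ) {L o₁ o₂ : LF E × LF E} (hL : IsPt L) (h₁ : IsCov o₁)
    (h₂ : IsCov o₂) (e : E) : covForm a b (toPair L e) (toForm o₁ e) (toForm o₂ e)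
      = toForm (projCov (pencilCov a b L o₁ o₂)) e := by
  rw [covForm, liftPair_toPair hL, liftForm_toForm h₁, liftForm_toForm h₂,
    ← pullB_pencilCov contDiff_const (fun t => hasFDerivAt_const e t)]
  rfl

theorem toForm_sub (o o' : LF E × LF E) (e : E) : toForm (o - o') e = toForm o e - toForm o' e := by
  funext x
  exact Prod.ext (funext fun z => mul_sub _ _ _) (funext fun z => mul_sub _ _ _)

/-- The differential of the bracket `⟨dF, P(dG)⟩`, `P = a P₁ + b P₂`. -/
def bracketForm (a b : ℂ) (F G : (ℝ → Pair) → ℂ) (γ : ℝ → Pair) : ℝ → Pair :=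
  hess F γ (pencilP a b γ (diff G γ)) - hess G γ (pencilP a b γ (diff F γ))
    + covForm a b γ (diff F γ) (diff G γ)

theorem Admissible.bracketForm_toPair {F G : (ℝ → Pair) → ℂ} (hF : Admissible F)
    (hG : Admissible G) (a b : ℂ) {L : LF E × LF E} (hL : IsPt L) :
    ∃ o₁ o₂ h₁ h₂, IsCov o₁ ∧ IsCov o₂ ∧ IsCov h₁ ∧ IsCov h₂ ∧
      (∀ e, diff F (toPair L e) = toForm o₁ e) ∧ (∀ e, diff G (toPair L e) = toForm o₂ e) ∧
      (∀ e, hess F (toPair L e) (toPair (pencil a b L o₂) e) = toForm h₁ e) ∧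
      (∀ e, hess G (toPair L e) (toPair (pencil a b L o₁) e) = toForm h₂ e) ∧
      ∀ e, bracketForm a b F G (toPair L e)
        = toForm (h₁ - h₂ + projCov (pencilCov a b L o₁ o₂)) e := by
  obtain ⟨o₁, c₁, e₁⟩ := hF.hasDifferential.exists_toForm hL
  obtain ⟨o₂, c₂, e₂⟩ := hG.hasDifferential.exists_toForm hL
  obtain ⟨h₁, d₁, f₁⟩ := hF.exists_hess hL (isTan_pencil (o := o₂) a b hL)
  obtain ⟨h₂, d₂, f₂⟩ := hG.exists_hess hL (isTan_pencil (o := o₁) a b hL)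
  refine ⟨o₁, o₂, h₁, h₂, c₁, c₂, d₁, d₂, e₁, e₂, f₁, f₂, fun e => ?_⟩
  rw [bracketForm, e₁, e₂, pencilP_toPair, pencilP_toPair, f₁, f₂, covForm_toForm a b hL c₁ c₂,
    toForm_add, toForm_sub]

/-- The bracket of two functionals with a differential has a differential. The symmetry of the
second derivatives turns the derivatives of `dF` and `dG` along a curve into covectors paired with
its velocity. -/
theorem Admissible.hasDifferential_bracket {F G : (ℝ → Pair) → ℂ} (hF : Admissible F)
    (hG : Admissible G) (a b : ℂ) :
    HasDifferential (bracket (pencilP a b) F G) (bracketForm a b F G) := by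
  refine .of_families (fun E _ _ _ L hL => ?_) fun L o hL ho t => ?_
  · obtain ⟨o₁, o₂, h₁, h₂, -, -, d₁, d₂, -, -, -, -, h⟩ := hF.bracketForm_toPair hG a b hL
    exact ⟨_, (d₁.sub d₂).add (isCov_projCov _), h⟩
  · obtain ⟨o₁, o₂, h₁, h₂, -, -, -, -, e₁, e₂, f₁, f₂, h⟩ := hF.bracketForm_toPair hG a b hL
    have hb : (fun s => bracket (pencilP a b) F G (toPair L s)) = trB (o₁ * pencil a b L o₂) := by
      funext s
      rw [bracket, e₁, e₂, pencilP_toPair, loopPairing_toForm]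
    rw [hb, toForm_injective fun s => (ho s).symm.trans (h s)]
    convert hasDerivAt_trB (o₁ * pencil a b L o₂) t using 1
    have k₁ := hF.trB_dirB_mul hL (isTan_pencil a b hL) e₁ f₁
    have k₂ := hG.trB_dirB_mul hL (isTan_pencil a b hL) e₂ f₂
    rw [dirB_mul, map_add, k₁, trB_mul_dirB_pencil, trB_pencil_skew, k₂, add_mul, sub_mul, map_add,
      map_sub, trB_projCov_mul _ (hL.dirB 1), mul_comm (dirB 1 L)]
    simp only [Pi.add_apply, Pi.sub_apply, Pi.neg_apply]
    ring

theorem bracket_skew (a b : ℂ) {F G : (ℝ → Pair) → ℂ} (hF : Admissible F)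
    (hG : Admissible G) {γ : ℝ → Pair} (hγ : γ ∈ LM) :
    bracket (pencilP a b) F G γ = -bracket (pencilP a b) G F γ := by
  obtain ⟨L, hL, rfl⟩ := exists_toPair_of_mem_LM hγ
  obtain ⟨o₁, c₁, e₁⟩ := hF.hasDifferential.exists_toForm hL
  obtain ⟨o₂, c₂, e₂⟩ := hG.hasDifferential.exists_toForm hL
  simp only [bracket, e₁, e₂, pencilP_toPair, loopPairing_toForm]
  exact congrFun (trB_pencil_skew a b L o₁ o₂) _

/-- The double bracket in terms of the second derivatives and of the derivative of the tensor. -/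
theorem bracket_bracket (a b : ℂ) {F G H : (ℝ → Pair) → ℂ} (hF : Admissible F)
    (hG : Admissible G) {L o₁ o₂ o₃ : LF PUnit × LF PUnit} (hL : IsPt L)
    (h₁ : ∀ e, diff F (toPair L e) = toForm o₁ e) (h₂ : ∀ e, diff G (toPair L e) = toForm o₂ e)
    (h₃ : ∀ e, diff H (toPair L e) = toForm o₃ e) (e : PUnit) :
    bracket (pencilP a b) (bracket (pencilP a b) F G) H (toPair L e)
      = loopPairing (hess F (toPair L e) (toPair (pencil a b L o₂) e)) (toPair (pencil a b L o₃) e)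
        - loopPairing (hess G (toPair L e) (toPair (pencil a b L o₁) e))
            (toPair (pencil a b L o₃) e)
        + trB (pencilCov a b L o₁ o₂ * pencil a b L o₃) e := by
  obtain ⟨p₁, p₂, k₁, k₂, -, -, -, -, e₁, e₂, f₁, f₂, h⟩ := hF.bracketForm_toPair hG a b hL
  obtain rfl : p₁ = o₁ := toForm_injective fun e => (e₁ e).symm.trans (h₁ e)
  obtain rfl : p₂ = o₂ := toForm_injective fun e => (e₂ e).symm.trans (h₂ e)
  rw [bracket, (hF.hasDifferential_bracket hG a b).diff_eq ((loopFamily_toPair hL).mem e), h, h₃,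
    pencilP_toPair, f₁, f₂, loopPairing_toForm, loopPairing_toForm, loopPairing_toForm, add_mul,
    sub_mul, map_add, map_sub, trB_projCov_mul _ (isTan_pencil a b hL)]
  rfl

/-- The Jacobi identity. The second derivatives cancel by symmetry, and the remaining terms form
the Schouten bracket of the tensor. -/
theorem bracket_jacobi (a b : ℂ) {F G H : (ℝ → Pair) → ℂ} (hF : Admissible F)
    (hG : Admissible G) (hH : Admissible H) {γ : ℝ → Pair} (hγ : γ ∈ LM) :
    bracket (pencilP a b) (bracket (pencilP a b) F G) H γ
      + bracket (pencilP a b) (bracket (pencilP a b) G H) F γ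
      + bracket (pencilP a b) (bracket (pencilP a b) H F) G γ = 0 := by
  obtain ⟨L, hL, rfl⟩ := exists_toPair_of_mem_LM hγ
  obtain ⟨o₁, -, e₁⟩ := hF.hasDifferential.exists_toForm hL
  obtain ⟨o₂, -, e₂⟩ := hG.hasDifferential.exists_toForm hL
  obtain ⟨o₃, -, e₃⟩ := hH.hasDifferential.exists_toForm hL
  have ht : ∀ o, toPair (pencil a b L o) PUnit.unit ∈ TLM := fun o =>
    (tanFamily_toPair (isTan_pencil a b hL)).mem _
  rw [bracket_bracket a b hF hG hL e₁ e₂ e₃, bracket_bracket a b hG hH hL e₂ e₃ e₁,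
    bracket_bracket a b hH hF hL e₃ e₁ e₂, hF.hess_symm hγ (ht o₂) (ht o₃),
    hG.hess_symm hγ (ht o₁) (ht o₃), hH.hess_symm hγ (ht o₁) (ht o₂)]
  have := congrFun (pencil_schouten a b L o₁ o₂ o₃) PUnit.unit
  simp only [Pi.add_apply, Pi.zero_apply] at this
  linear_combination this

theorem LF.br_smul_right (c : ℂ) (f g : LF E) : br f (c • g) = c • br f g := by
  rw [br, br, map_smul, map_smul, mul_smul_comm, smul_mul_assoc, smul_sub]

theorem P1A_add (L o o' : LF E × LF E) : P1A L (o + o') = P1A L o + P1A L o' := by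
  ext : 1 <;> simp only [P1A, Prod.fst_add, Prod.snd_add, br_add_right, add_sub_add_comm, map_add]
    <;> abel

theorem P2A_add (L o o' : LF E × LF E) : P2A L (o + o') = P2A L o + P2A L o' := by
  ext : 1 <;> simp only [P2A, Prod.fst_add, Prod.snd_add, br_add_right, mul_add, map_add] <;> ring

theorem P1A_smul (c : ℂ) (L o : LF E × LF E) : P1A L (c • o) = c • P1A L o := by
  ext : 1 <;> simp only [P1A, Prod.smul_fst, Prod.smul_snd, br_smul_right, ← smul_sub, ← smul_add,
    map_smul, ← smul_neg]

theorem P2A_smul (c : ℂ) (L o : LF E × LF E) : P2A L (c • o) = c • P2A L o := by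
  ext : 1 <;> simp only [P2A, Prod.smul_fst, Prod.smul_snd, br_smul_right, mul_smul_comm,
    ← smul_sub, ← smul_add, map_smul, ← smul_neg]

theorem isPoisson_pencilP (a b : ℂ) : IsPoisson (pencilP a b) where
  mapsTo γ hγ ω hω := by
    obtain ⟨L, hL, rfl⟩ := exists_toPair_of_mem_LM hγ
    obtain ⟨o, -, rfl⟩ := exists_toForm_of_mem hω
    rw [pencilP_toPair]
    exact (tanFamily_toPair (isTan_pencil a b hL)).mem _
  map_add γ hγ ω hω η hη := by
    obtain ⟨L, hL, rfl⟩ := exists_toPair_of_mem_LM hγ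
    obtain ⟨o, -, rfl⟩ := exists_toForm_of_mem hω
    obtain ⟨o', -, rfl⟩ := exists_toForm_of_mem hη
    rw [← toForm_add, pencilP_toPair, pencilP_toPair, pencilP_toPair, pencil, P1A_add, P2A_add,
      smul_add, smul_add, add_add_add_comm]
    rfl
  map_smul γ hγ c ω hω := by
    obtain ⟨L, hL, rfl⟩ := exists_toPair_of_mem_LM hγ
    obtain ⟨o, -, rfl⟩ := exists_toForm_of_mem hω
    rw [← toForm_smul, pencilP_toPair, pencilP_toPair, pencil, P1A_smul, P2A_smul, smul_comm a,
      smul_comm b, ← smul_add]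
    rfl
  closed F G hF hG := ⟨_, hF.hasDifferential_bracket hG a b⟩
  skew F G hF hG γ hγ := bracket_skew a b hF hG hγ
  jacobi F G H hF hG hH γ hγ := bracket_jacobi a b hF hG hH hγ

theorem isPoisson_P₁ : IsPoisson P₁ := by
  have := isPoisson_pencilP 1 0
  rwa [show pencilP 1 0 = P₁ by funext γ ω; rw [pencilP, one_smul, zero_smul, add_zero]] at this

theorem isPoisson_P₂ : IsPoisson P₂ := by
  have := isPoisson_pencilP 0 1
  rwa [show pencilP 0 1 = P₂ by funext γ ω; rw [pencilP, one_smul, zero_smul, zero_add]] at this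

theorem compatible_P₁_P₂ : Compatible P₁ P₂ := isPoisson_pencilP

end Bracket

/-! ### Local functionals -/

section Local

variable {E : Type} [NormedAddCommGroup E] [NormedSpace ℝ E] [FiniteDimensional ℝ E]

variable (E) in
/-- The derivative `∂/∂x` on pairs. -/
def XB : LF E × LF E →+ LF E × LF E := X.toAddMonoidHom.prodMap X.toAddMonoidHom

theorem pderiv_toPair_x (L : LF E × LF E) (e : E) : pderiv (toPair L e) = toPair (XB E L) e := by
  funext x
  exact Prod.ext (funext fun z => (hasDerivAt_fn_x L.1 e x z).deriv)
    (funext fun z => (hasDerivAt_fn_x L.2 e x z).deriv)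

theorem pderiv_toForm_x (o : LF E × LF E) (e : E) : pderiv (toForm o e) = toForm (XB E o) e := by
  funext x
  exact Prod.ext (funext fun z => ((hasDerivAt_fn_x o.1 e x z).const_mul _).deriv)
    (funext fun z => ((hasDerivAt_fn_x o.2 e x z).const_mul _).deriv)

theorem iterate_pderiv_toPair (L : LF E × LF E) (e : E) (s : ℕ) :
    pderiv^[s] (toPair L e) = toPair ((XB E)^[s] L) e := by
  induction s generalizing L with
  | zero => rfl
  | succ s ih => rw [Function.iterate_succ_apply, pderiv_toPair_x, ih, Function.iterate_succ_apply]

theorem iterate_pderiv_toForm (o : LF E × LF E) (e : E) (s : ℕ) :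
    pderiv^[s] (toForm o e) = toForm ((XB E)^[s] o) e := by
  induction s generalizing o with
  | zero => rfl
  | succ s ih => rw [Function.iterate_succ_apply, pderiv_toForm_x, ih, Function.iterate_succ_apply]

theorem IsPt.XB {L : LF E × LF E} (h : IsPt L) : IsTan (XB E L) := by
  refine ⟨fun p n hn => ?_, h.2.2.dirL _⟩
  change cf (dirL (0, 1) L.1) p n = 0
  by_cases h1 : n = 1
  · rw [cf_dirL, h1, funext h.2.1]; simp
  · exact h.1.dirL (0, 1) p n (by omega)

theorem IsTan.iterate_XB {L : LF E × LF E} (h : IsTan L) (s : ℕ) : IsTan ((Toda.XB E)^[s] L) := by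
  induction s generalizing L with
  | zero => exact h
  | succ s ih => exact ih ⟨h.1.dirL _, h.2.dirL _⟩

theorem IsCov.iterate_XB {o : LF E × LF E} (h : IsCov o) (s : ℕ) : IsCov ((Toda.XB E)^[s] o) := by
  induction s generalizing o with
  | zero => exact h
  | succ s ih => exact ih ⟨h.1.dirL _, h.2.dirL _⟩

theorem dirB_iterate_XB (v : E) (L : LF E × LF E) (s : ℕ) :
    dirB v ((XB E)^[s] L) = (XB E)^[s] (dirB v L) := by
  induction s generalizing L with
  | zero => rfl
  | succ s ih =>
    rw [Function.iterate_succ_apply, ih, Function.iterate_succ_apply]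
    congr 1
    exact Prod.ext (dirL_comm _ _ _) (dirL_comm _ _ _)

/-- Integration by parts. -/
theorem trB_mul_XB (f g : LF E × LF E) : trB (f * XB E g) = -trB (XB E f * g) := by
  have h : ∀ f g : LF E, tr (f * X g) = -tr (X f * g) := fun f g => by
    have := tr_X (f * g)
    rw [X_mul, map_add] at this
    rw [eq_neg_iff_add_eq_zero, add_comm, this]
  rw [trB_apply, trB_apply, neg_add]
  exact congrArg₂ _ (h _ _) (h _ _)

theorem trB_mul_iterate_XB (f g : LF E × LF E) (s : ℕ) :
    trB (f * (XB E)^[s] g) = (-1 : ℂ) ^ s • trB ((XB E)^[s] f * g) := by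
  induction s generalizing f with
  | zero => simp
  | succ s ih =>
    rw [Function.iterate_succ_apply', trB_mul_XB, ih, Function.iterate_succ_apply, pow_succ,
      mul_neg_one, neg_smul]

/-- The jet of order `k` of a loop. -/
def jet (k : ℕ) (γ : ℝ → Pair) (x : ℝ) : Fin (k + 1) → Pair := fun s => (pderiv^[(s : ℕ)] γ) x

theorem jet_toPair (k : ℕ) (L : LF E × LF E) (e : E) (x : ℝ) :
    jet k (toPair L e) x = fun s : Fin (k + 1) => toPair ((XB E)^[(s : ℕ)] L) e x := by
  funext s
  rw [jet, iterate_pderiv_toPair]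

theorem jetFamily_jet (k : ℕ) {L : LF E × LF E} (h : IsPt L) :
    JetFamily fun p : E × ℝ => jet k (toPair L p.1) p.2 := by
  simp only [jet_toPair]
  refine ⟨(loopFamily_toPair h).1, fun s hs => ?_⟩
  obtain ⟨m, hm⟩ := Nat.exists_eq_succ_of_ne_zero (Fin.val_ne_zero_iff.2 hs)
  simp only [hm, Function.iterate_succ_apply]
  exact (tanFamily_toPair (h.XB.iterate_XB m)).1

theorem JetFamily.comp {k : ℕ} {J : E → Fin (k + 1) → Pair} (h : JetFamily J) {E' : Type}
    [NormedAddCommGroup E'] [NormedSpace ℝ E'] [FiniteDimensional ℝ E'] {g : E' → E}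
    (hg : ContDiff ℝ (⊤ : ℕ∞) g) : JetFamily fun q => J (g q) :=
  ⟨h.1.comp hg, fun s hs => (h.2 s hs).comp hg⟩

/-- The Euler–Lagrange expression `∑ₛ (-∂ₓ)ˢ (∂f / ∂γ⁽ˢ⁾)`. -/
def eulerLagrange (k : ℕ) (g : Fin (k + 1) → ℝ → (Fin (k + 1) → Pair) → Pair) (γ : ℝ → Pair) :
    ℝ → Pair :=
  ∑ s : Fin (k + 1), (-1 : ℂ) ^ (s : ℕ) • pderiv^[(s : ℕ)] fun y => g s y (jet k γ y)

theorem toForm_sum {ι : Type} (S : Finset ι) (o : ι → LF E × LF E) (e : E) :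
    toForm (∑ i ∈ S, o i) e = ∑ i ∈ S, toForm (o i) e := by
  let φ : LF E × LF E →+ (ℝ → Pair) :=
    { toFun := fun o => toForm o e
      map_zero' := by simpa using toForm_add (0 : LF E × LF E) 0 e
      map_add' := fun o o' => toForm_add o o' e }
  exact map_sum φ _ _

theorem IsCov.smul {o : LF E × LF E} (h : IsCov o) (c : ℂ) : IsCov (c • o) :=
  ⟨h.1.smul c, h.2.smul c⟩

theorem isCov_sum {ι : Type} (S : Finset ι) {o : ι → LF E × LF E} (h : ∀ i, IsCov (o i)) :
    IsCov (∑ i ∈ S, o i) :=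
  Finset.sum_induction _ _ (fun _ _ => IsCov.add)
    ⟨fun p n _ => cf_zero p n, fun p n _ => cf_zero p n⟩
    fun i _ => h i

theorem LocalFunctional.exists_hasDifferential {F : (ℝ → Pair) → ℂ} {k : ℕ}
    {f : ℝ → (Fin (k + 1) → Pair) → ℂ} {g : Fin (k + 1) → ℝ → (Fin (k + 1) → Pair) → Pair}
    (hg : ∀ s x j, g s (x + 2 * Real.pi) j = g s x j)
    (hs : ∀ (E : Type) [NormedAddCommGroup E] [NormedSpace ℝ E] [FiniteDimensional ℝ E]
      (ξ : E → ℝ) (J : E → Fin (k + 1) → Pair), ContDiff ℝ (⊤ : ℕ∞) ξ → JetFamily J →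
        ContDiff ℝ (⊤ : ℕ∞) (fun e => f (ξ e) (J e)) ∧ ∀ s, SmoothTstar fun e => g s (ξ e) (J e))
    (hd : ∀ (x : ℝ) (J : ℝ → Fin (k + 1) → Pair), JetFamily J → ∀ t,
      HasDerivAt (fun τ => f x (J τ))
        (∑ s, pairing (g s x (J t)) (pderiv (fun τ => J τ s) t)) t)
    (hF : ∀ γ ∈ LM, F γ = ∫ x in (0 : ℝ)..2 * Real.pi, f x (jet k γ x)) :
    HasDifferential F (eulerLagrange k g) := by
  have key : ∀ (E : Type) [NormedAddCommGroup E] [NormedSpace ℝ E] [FiniteDimensional ℝ E]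
      (L : LF E × LF E), IsPt L → ∃ o : Fin (k + 1) → LF E × LF E, (∀ s, IsCov (o s)) ∧
        (∀ s e, (fun y => g s y (jet k (toPair L e) y)) = toForm (o s) e) ∧
        ∀ e, eulerLagrange k g (toPair L e)
          = toForm (∑ s : Fin (k + 1), (-1 : ℂ) ^ (s : ℕ) • (XB E)^[(s : ℕ)] (o s)) e := by
    intro E _ _ _ L hL
    have h1 : ∀ s : Fin (k + 1), ∃ o, IsCov o ∧
        (fun (e : E) y => g s y (jet k (toPair L e) y)) = toForm o := fun s => by
      refine FormFamily.exists_eq ⟨(hs (E × ℝ) _ _ contDiff_snd (jetFamily_jet k hL)).2 s,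
        fun e x => ?_⟩
      have hp : jet k (toPair L e) (x + 2 * Real.pi) = jet k (toPair L e) x := by
        rw [jet_toPair, jet_toPair]
        exact funext fun s => Prod.ext (((XB E)^[(s : ℕ)] L).1.periodic _ _)
          (((XB E)^[(s : ℕ)] L).2.periodic _ _)
      simp only [hg, hp]
    choose o ho ho' using h1
    refine ⟨o, ho, fun s e => congrFun (ho' s) e, fun e => ?_⟩
    rw [eulerLagrange, toForm_sum]
    refine Finset.sum_congr rfl fun s _ => ?_
    rw [toForm_smul, ← iterate_pderiv_toForm, ← ho']
  refine .of_families (fun E _ _ _ L hL => ?_) fun L o hL ho t => ?_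
  · obtain ⟨o, ho, -, h⟩ := key E L hL
    exact ⟨_, isCov_sum _ fun s => ((ho s).iterate_XB _).smul _, h⟩
  · obtain ⟨q, -, hq, h⟩ := key ℝ L hL
    obtain rfl := toForm_injective fun s => (ho s).symm.trans (h s)
    have hG : ContDiff ℝ (⊤ : ℕ∞) fun p : ℝ × ℝ => f p.2 (jet k (toPair L p.1) p.2) :=
      (hs (ℝ × ℝ) _ _ contDiff_snd (jetFamily_jet k hL)).1
    have h1 := (hasFDerivAt_intervalIntegral_of_contDiff hG 0 (2 * Real.pi) t).hasDerivAt
    have h2 : ∀ x, (fderiv ℝ (fun p : ℝ × ℝ => f p.2 (jet k (toPair L p.1) p.2)) (t, x)) (1, 0)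
        = ∑ s : Fin (k + 1), cf ((q s).1 * (dirB 1 ((XB ℝ)^[(s : ℕ)] L)).1
          + (q s).2 * (dirB 1 ((XB ℝ)^[(s : ℕ)] L)).2) (t, x) 0 := fun x => by
      have a1 := ((hG.differentiable (by simp) (t, x)).hasFDerivAt.comp_hasDerivAt t
        ((hasDerivAt_id t).prodMk (hasDerivAt_const t x)))
      have a2 := hd x (fun τ => jet k (toPair L τ) x) ((jetFamily_jet k hL).comp
        (g := fun τ : ℝ => (τ, x)) (contDiff_id.prodMk contDiff_const)) t
      refine (a1.unique a2).trans (Finset.sum_congr rfl fun s _ => ?_)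
      rw [congrFun (hq s t) x]
      simp only [jet_toPair]
      rw [pderiv_toPair, pairing_toForm]
    have h3 : (trB ((∑ s : Fin (k + 1), (-1 : ℂ) ^ (s : ℕ) • (XB ℝ)^[(s : ℕ)] (q s)) * dirB 1 L) t)
        = (∫ x in (0 : ℝ)..2 * Real.pi, (fderiv ℝ (fun p : ℝ × ℝ =>
          f p.2 (jet k (toPair L p.1) p.2)) (t, x)).comp (ContinuousLinearMap.inl ℝ ℝ ℝ)) 1 := by
      have hc : Continuous fun x : ℝ => (fderiv ℝ (fun p : ℝ × ℝ =>
          f p.2 (jet k (toPair L p.1) p.2)) (t, x)).comp (ContinuousLinearMap.inl ℝ ℝ ℝ) :=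
        ((hG.continuous_fderiv (by simp)).comp
          (by fun_prop : Continuous fun x : ℝ => (t, x))).clm_comp continuous_const
      rw [ContinuousLinearMap.intervalIntegral_apply (hc.intervalIntegrable _ _)]
      simp only [ContinuousLinearMap.comp_apply, ContinuousLinearMap.inl_apply, h2]
      have hi : ∀ f : LF ℝ, IntervalIntegrable (fun x => cf f (t, x) 0) MeasureTheory.volume 0
          (2 * Real.pi) := fun f => (f.contDiff_cf 0).continuous.comp
        (by fun_prop : Continuous fun x : ℝ => (t, x)) |>.intervalIntegrable _ _
      rw [intervalIntegral.integral_finsetSum fun s _ => hi _, Finset.sum_mul, map_sum,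
        Finset.sum_apply]
      refine Finset.sum_congr rfl fun s _ => ?_
      rw [dirB_iterate_XB, smul_mul_assoc, trB_smul, ← trB_mul_iterate_XB, trB_apply, ← map_add]
      rfl
    rw [h3]
    exact h1.congr_of_eventuallyEq (Filter.Eventually.of_forall fun s =>
      hF _ ((loopFamily_toPair hL).mem s))

theorem LocalFunctional.admissible {F : (ℝ → Pair) → ℂ} (h : LocalFunctional F) :
    Admissible F := by
  obtain ⟨k, f, g, -, hg, hs, hd, hF⟩ := h
  exact ⟨_, LocalFunctional.exists_hasDifferential hg hs hd hF⟩

end Local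

/-! ### The Hamiltonians of the Toda flows -/

section Hamiltonians

/-- A functional `∮ f(γ) dx` whose density does not involve the derivatives of `γ`. -/
theorem localFunctional_of_density {F : (ℝ → Pair) → ℂ} {f : Pair → ℂ} {g : Pair → Pair}
    (h : ∀ (E : Type) [NormedAddCommGroup E] [NormedSpace ℝ E] [FiniteDimensional ℝ E]
      (L : LF E × LF E), IsPt L → ∃ (a : LF E) (o : LF E × LF E), IsCov o ∧
        (∀ e x, f (toPair L e x) = cf a (e, x) 0) ∧ (∀ e x, g (toPair L e x) = toForm o e x) ∧
        ∀ v p, cf (dirL (v, 0) a) p 0 = cf (o.1 * (dirB v L).1 + o.2 * (dirB v L).2) p 0)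
    (hF : ∀ γ ∈ LM, F γ = ∫ x in (0 : ℝ)..2 * Real.pi, f (γ x)) :
    LocalFunctional F ∧ HasDifferential F fun γ x => g (γ x) := by
  have key : ∀ (E : Type) [NormedAddCommGroup E] [NormedSpace ℝ E] [FiniteDimensional ℝ E]
      (J : E → Fin 1 → Pair), JetFamily J → ∃ (L : LF E × LF E), IsPt L ∧
        ∀ e, J e 0 = toPair L e 0 := fun E _ _ _ J hJ => by
    have : LoopFamily fun e (_ : ℝ) => J e 0 := ⟨hJ.1.comp contDiff_fst, fun _ _ => rfl⟩
    obtain ⟨L, hL, hLJ⟩ := this.exists_eq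
    exact ⟨L, hL, fun e => congrFun (congrFun hLJ e) 0⟩
  have hs : ∀ (E : Type) [NormedAddCommGroup E] [NormedSpace ℝ E] [FiniteDimensional ℝ E]
      (ξ : E → ℝ) (J : E → Fin (0 + 1) → Pair), ContDiff ℝ (⊤ : ℕ∞) ξ → JetFamily J →
      ContDiff ℝ (⊤ : ℕ∞) (fun e => (fun (_ : ℝ) (j : Fin (0 + 1) → Pair) => f (j 0)) (ξ e) (J e)) ∧
      ∀ s, SmoothTstar fun e => (fun (_ : Fin (0 + 1)) (_ : ℝ) (j : Fin (0 + 1) → Pair) => g (j 0))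
        s (ξ e) (J e) := fun E _ _ _ ξ J _ hJ => by
    obtain ⟨L, hL, hLJ⟩ := key E J hJ
    obtain ⟨a, o, ho, h1, h2, -⟩ := h E L hL
    simp only [hLJ, h1, h2]
    exact ⟨(a.contDiff_cf 0).comp contDiff_prodMk_zero,
      fun _ => (formFamily_toForm ho).1.comp contDiff_prodMk_zero⟩
  have hd : ∀ (x : ℝ) (J : ℝ → Fin (0 + 1) → Pair), JetFamily J → ∀ t,
      HasDerivAt (fun τ => (fun (_ : ℝ) (j : Fin (0 + 1) → Pair) => f (j 0)) x (J τ))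
        (∑ s, pairing ((fun (_ : Fin (0 + 1)) (_ : ℝ) (j : Fin (0 + 1) → Pair) => g (j 0)) s x (J t))
          (pderiv (fun τ => J τ s) t)) t := fun x J hJ t => by
    obtain ⟨L, hL, hLJ⟩ := key ℝ J hJ
    obtain ⟨a, o, ho, h1, h2, h3⟩ := h ℝ L hL
    rw [Fin.sum_univ_one]
    simp only [hLJ, h1, h2, pderiv_toPair, pairing_toForm, ← h3, cf_dirL]
    exact ((a.contDiff_cf 0).differentiable (by simp) (t, 0)).hasFDerivAt.comp_hasDerivAt t
      ((hasDerivAt_id t).prodMk (hasDerivAt_const t (0 : ℝ)))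
  refine ⟨⟨0, fun _ j => f (j 0), fun _ _ j => g (j 0), fun _ _ => rfl, fun _ _ _ => rfl, hs, hd,
    hF⟩, ?_⟩
  have := LocalFunctional.exists_hasDifferential (F := F) (k := 0) (f := fun _ j => f (j 0))
    (g := fun _ _ j => g (j 0)) (fun _ _ _ => rfl) hs hd hF
  refine cast (congrArg _ (funext fun γ => ?_)) this
  rw [eulerLagrange, Fin.sum_univ_one]
  exact one_smul ℂ _

/-- The differential of `Hₙ`. -/
def hamForm (n : ℕ) (a : Pair) : Pair := (fun z => (z : ℂ)⁻¹ * -projGE 0 (a.1 ^ n) z, 0)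

/-- The differential of `H̄ₙ`. -/
def hamBarForm (n : ℕ) (a : Pair) : Pair := (0, fun z => (z : ℂ)⁻¹ * -projLE 1 (a.2 ^ n) z)

variable {E : Type} [NormedAddCommGroup E] [NormedSpace ℝ E] [FiniteDimensional ℝ E]

theorem hamForm_toPair (n : ℕ) (L : LF E × LF E) (e : E) (x : ℝ) :
    hamForm n (toPair L e x) = toForm (-ge 0 (L.1 ^ n), 0) e x := by
  refine Prod.ext (funext fun z => ?_) (funext fun z => (mul_zero _).symm)
  simp only [hamForm, toForm, toPair, fn_neg, fn_ge, fn_pow]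
  rfl

theorem hamBarForm_toPair (n : ℕ) (L : LF E × LF E) (e : E) (x : ℝ) :
    hamBarForm n (toPair L e x) = toForm (0, -le 1 (L.2 ^ n)) e x := by
  refine Prod.ext (funext fun z => (mul_zero _).symm) (funext fun z => ?_)
  simp only [hamBarForm, toForm, toPair, fn_neg, fn_le, fn_pow]
  rfl

theorem contour_pow_div (n : ℕ) (f : LF E) (p : E × ℝ) :
    -(2 * Real.pi * Complex.I)⁻¹ * contour (fun z => f.fn p z ^ (n + 1) / (n + 1 : ℂ) / (z : ℂ))
      = cf (-((n + 1 : ℂ)⁻¹ • f ^ (n + 1))) p 0 := by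
  rw [cf_neg, neg_mul]
  refine congrArg _ (LF.cf_eq_contour _ _ fun z => ?_)
  have hz := Circle.coe_ne_zero z
  rw [fn_smul, fn_pow, Pi.smul_apply, Pi.pow_apply, smul_eq_mul]
  field_simp

theorem LF.map_pow_succ_of_leibniz {δ : LF E →ₗ[ℂ] LF E}
    (hδ : ∀ f g, δ (f * g) = δ f * g + f * δ g) (n : ℕ) (f : LF E) :
    δ (f ^ (n + 1)) = (n + 1 : ℂ) • (f ^ n * δ f) := by
  induction n with
  | zero => simp
  | succ n ih =>
    rw [pow_succ, hδ, ih, smul_mul_assoc]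
    push_cast
    rw [mul_right_comm, ← pow_succ]
    module

theorem LF.dirL_pow_div (n : ℕ) (f : LF E) (w : E × ℝ) :
    dirL w ((n + 1 : ℂ)⁻¹ • f ^ (n + 1)) = f ^ n * dirL w f := by
  rw [map_smul, map_pow_succ_of_leibniz (fun f g => dirL_mul f g w), smul_smul,
    inv_mul_cancel₀ (Nat.cast_add_one_ne_zero n), one_smul]

theorem ham_local (n : ℕ) : LocalFunctional (ham n) ∧
    HasDifferential (ham n) fun γ x => hamForm n (γ x) := by
  refine localFunctional_of_density (f := fun a => -(2 * Real.pi * Complex.I)⁻¹ *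
    contour fun z => a.1 z ^ (n + 1) / (n + 1 : ℂ) / (z : ℂ)) (fun E _ _ _ L hL => ?_)
    fun γ _ => (intervalIntegral.integral_const_mul _ _).symm
  refine ⟨-((n + 1 : ℂ)⁻¹ • L.1 ^ (n + 1)), (-ge 0 (L.1 ^ n), 0),
    ⟨(Ge.ge _ 0).neg, fun p m _ => cf_zero p m⟩, fun e x => contour_pow_div n L.1 (e, x),
    fun e x => hamForm_toPair n L e x, fun v p => ?_⟩
  -- `λⁿ` and `(λⁿ)₊` differ by negative powers, which do not pair with tangent vectors
  have h1 : Le (-1) (le (-1) (L.1 ^ n) * dirL (v, 0) L.1) :=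
    ((Le.le _ (-1)).mul (hL.dirB v).1).mono (by norm_num)
  have h2 := h1 p 0 (by norm_num)
  change cf (dirL (v, 0) (-((n + 1 : ℂ)⁻¹ • L.1 ^ (n + 1)))) p 0
    = cf (-ge 0 (L.1 ^ n) * dirL (v, 0) L.1 + 0 * dirL (v, 0) L.2) p 0
  rw [zero_mul, add_zero, map_neg, dirL_pow_div, cf_neg, neg_mul, cf_neg,
    ← neg_add_nonneg (L.1 ^ n), add_mul, cf_add, h2, zero_add, map_add,
    (Le.le _ (-1)).ge_eq (by norm_num : (-1 : ℤ) < 0), (Ge.ge _ 0).ge_eq le_rfl, zero_add]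

theorem hamBar_local (n : ℕ) : LocalFunctional (hamBar n) ∧
    HasDifferential (hamBar n) fun γ x => hamBarForm n (γ x) := by
  refine localFunctional_of_density (f := fun a => -(2 * Real.pi * Complex.I)⁻¹ *
    contour fun z => a.2 z ^ (n + 1) / (n + 1 : ℂ) / (z : ℂ)) (fun E _ _ _ L hL => ?_)
    fun γ _ => (intervalIntegral.integral_const_mul _ _).symm
  refine ⟨-((n + 1 : ℂ)⁻¹ • L.2 ^ (n + 1)), (0, -le 1 (L.2 ^ n)),
    ⟨fun p m _ => cf_zero p m, (Le.le _ 1).neg⟩, fun e x => contour_pow_div n L.2 (e, x),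
    fun e x => hamBarForm_toPair n L e x, fun v p => ?_⟩
  have h1 : Ge 1 (ge 2 (L.2 ^ n) * dirL (v, 0) L.2) :=
    ((Ge.ge _ 2).mul (hL.dirB v).2).mono (by norm_num)
  have h2 := h1 p 0 (by norm_num)
  change cf (dirL (v, 0) (-((n + 1 : ℂ)⁻¹ • L.2 ^ (n + 1)))) p 0
    = cf (0 * dirL (v, 0) L.1 + -le 1 (L.2 ^ n) * dirL (v, 0) L.2) p 0
  rw [zero_mul, zero_add, map_neg, dirL_pow_div, cf_neg, neg_mul, cf_neg, neg_inj,
    ← sub_eq_zero, ← cf_sub, ← sub_mul]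
  rwa [ge_eq_sub] at h2

/-! ### The Toda flows -/

theorem toPair_smul (c : ℂ) (L : LF E × LF E) (e : E) : toPair (c • L) e = c • toPair L e := rfl

theorem hamiltonianFlow_of_eq {P : (ℝ → Pair) → (ℝ → Pair) → ℝ → Pair} (hP : IsPoisson P) (c : ℂ)
    {H : (ℝ → Pair) → ℂ} {δ X : (ℝ → Pair) → ℝ → Pair} (hH : HasDifferential H δ)
    (h : ∀ γ ∈ LM, X γ = c • P γ (δ γ)) : HamiltonianFlow P c H X := by
  intro γ hγ
  have h1 : X γ = c • P γ (diff H γ) := by rw [h γ hγ, hH.diff_eq hγ]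
  obtain ⟨α, hα, hα'⟩ := exists_toPair_of_mem_TLM (hP.mapsTo γ hγ _ (hH.1 γ hγ))
  have h2 : X γ = toPair (c • α) PUnit.unit := by rw [h γ hγ, hα', toPair_smul]
  have h3 : X γ ∈ TLM := by rw [h2]; exact (tanFamily_toPair (hα.smul c)).mem _
  refine ⟨h3, h1, fun F hF => ?_⟩
  obtain ⟨o, -, ho⟩ := exists_toForm_of_mem (hF.hasDifferential.1 γ hγ)
  convert hF.hasDifferential.hasDerivAt_line hγ h3 using 1
  rw [bracket, hH.diff_eq hγ, h2, hα', ho, loopPairing_toForm, loopPairing_toForm,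
    mul_smul_comm, trB_smul]
  rfl

theorem flow_toPair (n : ℕ) (L : LF E × LF E) (e : E) : flow n (toPair L e)
    = toPair (br (ge 0 (L.1 ^ n)) L.1, br (ge 0 (L.1 ^ n)) L.2) e := by
  funext x
  simp only [flow, toPair, ← fn_pow, ← fn_ge, brack_fn]

theorem flowBar_toPair (n : ℕ) (L : LF E × LF E) (e : E) : flowBar n (toPair L e)
    = toPair (br (le (-1) (L.2 ^ n)) L.1, br (le (-1) (L.2 ^ n)) L.2) e := by
  funext x
  simp only [flowBar, toPair, ← fn_pow, ← fn_le, brack_fn]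

/-- `P₁(dHₙ)` is the flow `∂/∂sₙ`. -/
theorem P1A_ham (n : ℕ) {L : LF E × LF E} (hL : IsPt L) : P1A L (-ge 0 (L.1 ^ n), 0)
    = (br (ge 0 (L.1 ^ n)) L.1, br (ge 0 (L.1 ^ n)) L.2) := by
  have h1 : le (-1) (ge 0 (L.1 ^ n)) = 0 := (Ge.ge _ 0).le_eq (by norm_num)
  have h2 : ge 0 (ge 0 (L.1 ^ n)) = ge 0 (L.1 ^ n) := (Ge.ge _ 0).ge_eq le_rfl
  have h3 : br L.1 (-ge 0 (L.1 ^ n)) = br (ge 0 (L.1 ^ n)) L.1 := by rw [br_neg_right, ← br_skew]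
  have h4 : br L.2 (-ge 0 (L.1 ^ n)) = br (ge 0 (L.1 ^ n)) L.2 := by rw [br_neg_right, ← br_skew]
  have h5 : Le 0 (br (ge 0 (L.1 ^ n)) L.1) := by
    have : Le 0 (br L.1 (le (-1) (L.1 ^ n))) := (hL.1.br (Le.le _ (-1))).mono (by norm_num)
    rwa [ge_eq_sub, br_sub_left, br_skew (L.1 ^ n), br_pow, neg_zero, zero_sub, ← br_skew]
  have h6 := h5.le_eq le_rfl
  have h7 : ge 1 (br (ge 0 (L.1 ^ n)) L.1) = 0 := h5.ge_eq (by norm_num)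
  ext : 1 <;> simp only [P1A, sub_zero, map_neg, h1, h2, h3, h4, h6, h7, br_zero_right, neg_zero,
    add_zero, zero_add]

/-- `P₁(dH̄ₙ)` is the flow `∂/∂s̄ₙ`. -/
theorem P1A_hamBar (n : ℕ) {L : LF E × LF E} (hL : IsPt L) : P1A L (0, -le 1 (L.2 ^ n))
    = (br (le (-1) (L.2 ^ n)) L.1, br (le (-1) (L.2 ^ n)) L.2) := by
  have h1 : le (-1) (le 1 (L.2 ^ n)) = le (-1) (L.2 ^ n) := ext_cf fun p m => by
    rw [cf_le, cf_le, cf_le]; split_ifs <;> first | rfl | omega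
  have h2 : ge 0 (le 1 (L.2 ^ n)) = le 1 (L.2 ^ n) - le (-1) (L.2 ^ n) := by
    rw [ge_eq_sub, zero_sub, h1]
  have h3 : br L.2 (-le 1 (L.2 ^ n)) = br L.2 (ge 2 (L.2 ^ n)) := by
    rw [ge_eq_sub, br_sub_right, br_pow, br_neg_right, zero_sub]; rfl
  have h5 : Ge 1 (br L.2 (ge 2 (L.2 ^ n))) := (hL.2.2.br (Ge.ge _ 2)).mono (by norm_num)
  have h6 := h5.ge_eq le_rfl
  have h7 : le 0 (br L.2 (ge 2 (L.2 ^ n))) = 0 := h5.le_eq (by norm_num)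
  ext : 1
  · simp only [P1A, zero_sub, neg_neg, h1, h3, h7, br_zero_right, zero_add, add_zero]
    rw [← br_skew]
  · simp only [P1A, zero_sub, neg_neg, h2, h3, h6, br_zero_right, zero_add]
    rw [← h3, br_sub_right, br_neg_right, br_skew (le (-1) _)]
    ring

theorem LF.pz_D_mul_pow (n : ℕ) (f : LF E) : pz (D f * f ^ n) = 0 := by
  have h := congrArg pz (map_pow_succ_of_leibniz D_mul n f)
  rw [pz_D, map_smul, mul_comm] at h
  exact (smul_eq_zero.1 h.symm).resolve_left (Nat.cast_add_one_ne_zero n)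

theorem LF.br_pz (f g : LF E) : br f (pz g) = D f * X (pz g) := by
  rw [br, D_pz, zero_mul, sub_zero]

/-- `P₂(dHₙ)` is minus the flow `∂/∂sₙ₊₁`. The constant term of `λ (λⁿ)₋` that the projection
`(·)₋` removes is compensated by the term with `φ_x`. -/
theorem P2A_ham (n : ℕ) {L : LF E × LF E} (hL : IsPt L) : P2A L (-ge 0 (L.1 ^ n), 0)
    = (-br (ge 0 (L.1 ^ (n + 1))) L.1, -br (ge 0 (L.1 ^ (n + 1))) L.2) := by
  obtain ⟨l, m⟩ := L
  change P2A (l, m) (-ge 0 (l ^ n), 0)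
    = (-br (ge 0 (l ^ (n + 1))) l, -br (ge 0 (l ^ (n + 1))) m)
  obtain ⟨N, hN⟩ : ∃ N, N = le (-1) (l ^ n) := ⟨_, rfl⟩
  have hNL : Le (-1) N := hN ▸ Le.le _ (-1)
  have hlN : Le 0 (l * N) := (hL.1.mul hNL).mono (by norm_num)
  have hA : -ge 0 (l ^ n) = N - l ^ n := by rw [hN, ge_eq_sub, neg_sub]; rfl
  have hu : l * (N - l ^ n) = l * N - l ^ (n + 1) := by ring
  have hle : le (-1) (l * N) = l * N - pz (l * N) := by
    refine ext_cf fun p k => ?_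
    rw [cf_sub, cf_le, cf_pz]
    split_ifs <;> first | omega | simp
    exact (hlN p k (by omega)).symm
  have hw : br l (N - l ^ n) = br l N := by rw [br_sub_right, br_pow, sub_zero]
  have hwL : Le 0 (br l N) := (hL.1.br hNL).mono (by norm_num)
  have h6 := hwL.le_eq le_rfl
  have h7 : ge 1 (br l N) = 0 := hwL.ge_eq (by norm_num)
  have hphi : pz (D l * (N - l ^ n)) = pz (l * N) := by
    have := (hL.le_D_sub.mul hNL).pz_eq (by norm_num)
    rw [sub_mul, map_sub] at this
    rw [mul_sub, map_sub, pz_D_mul_pow, sub_zero, sub_eq_zero.1 this]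
  have hge : ∀ f : LF E, ge 0 f = f - le (-1) f := fun f => ge_eq_sub f 0
  rw [hA]
  ext : 1
  · simp only [P2A, hu, hw, h6, br_zero_right, mul_zero, add_zero, hphi, map_sub, hle, hge,
      br_sub_right, br_mul_right, br_self, br_pz, br_sub_left, br_skew (l ^ (n + 1)) l, br_pow,
      br_skew (le (-1) (l ^ (n + 1))) l]
    ring
  · simp only [P2A, hu, hw, h7, br_zero_right, mul_zero, add_zero, zero_add, hphi, map_sub, hle,
      hge, br_sub_right, br_pz, br_skew _ m]
    ring

/-- `P₂(dH̄ₙ)` is the flow `∂/∂s̄ₙ₊₁`. -/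
theorem P2A_hamBar (n : ℕ) {L : LF E × LF E} (hL : IsPt L) : P2A L (0, -le 1 (L.2 ^ n))
    = (br (le (-1) (L.2 ^ (n + 1))) L.1, br (le (-1) (L.2 ^ (n + 1))) L.2) := by
  obtain ⟨l, m⟩ := L
  change P2A (l, m) (0, -le 1 (m ^ n))
    = (br (le (-1) (m ^ (n + 1))) l, br (le (-1) (m ^ (n + 1))) m)
  obtain ⟨N, hN⟩ : ∃ N, N = ge 2 (m ^ n) := ⟨_, rfl⟩
  have hNG : Ge 2 N := hN ▸ Ge.ge _ 2
  have hmN : Ge 1 (m * N) := (hL.2.2.mul hNG).mono (by norm_num)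
  have hA : -le 1 (m ^ n) = N - m ^ n := by rw [hN, ge_eq_sub]; ring_nf
  have hu : m * (N - m ^ n) = m * N - m ^ (n + 1) := by ring
  have hle : le (-1) (m * N) = 0 := hmN.le_eq (by norm_num)
  have hw : br m (N - m ^ n) = br m N := by rw [br_sub_right, br_pow, sub_zero]
  have hwG : Ge 1 (br m N) := (hL.2.2.br hNG).mono (by norm_num)
  have h6 := hwG.ge_eq le_rfl
  have h7 : le 0 (br m N) = 0 := hwG.le_eq (by norm_num)
  have hphi : pz (D m * (N - m ^ n)) = 0 := by
    rw [mul_sub, map_sub, pz_D_mul_pow, sub_zero]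
    exact (hL.2.2.D.mul hNG).pz_eq (by norm_num)
  have hge : ∀ f : LF E, ge 0 f = f - le (-1) f := fun f => ge_eq_sub f 0
  ext : 1
  · simp only [P2A, hA, hu, hw, h7, br_zero_right, mul_zero, zero_add, hphi, map_sub, hle, map_zero,
      zero_sub, br_neg_right, br_skew _ l]
    ring
  · simp only [P2A, hA, hu, hw, h6, br_zero_right, mul_zero, add_zero, zero_add, hphi, map_sub,
      hle, hge, br_sub_right, br_mul_right, br_self, br_pow, map_zero, br_skew _ m]
    ring

theorem hamiltonianFlow_P₁_flow (n : ℕ) : HamiltonianFlow P₁ 1 (ham n) (flow n) :=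
  hamiltonianFlow_of_eq isPoisson_P₁ 1 (ham_local n).2 fun γ hγ => by
    obtain ⟨L, hL, rfl⟩ := exists_toPair_of_mem_LM hγ
    rw [funext (hamForm_toPair n L _), P₁_toPair, P1A_ham n hL, flow_toPair, one_smul]

theorem hamiltonianFlow_P₁_flowBar (n : ℕ) : HamiltonianFlow P₁ 1 (hamBar n) (flowBar n) :=
  hamiltonianFlow_of_eq isPoisson_P₁ 1 (hamBar_local n).2 fun γ hγ => by
    obtain ⟨L, hL, rfl⟩ := exists_toPair_of_mem_LM hγ
    rw [funext (hamBarForm_toPair n L _), P₁_toPair, P1A_hamBar n hL, flowBar_toPair, one_smul]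

theorem hamiltonianFlow_P₂_flow (n : ℕ) : HamiltonianFlow P₂ (-1) (ham n) (flow (n + 1)) :=
  hamiltonianFlow_of_eq isPoisson_P₂ (-1) (ham_local n).2 fun γ hγ => by
    obtain ⟨L, hL, rfl⟩ := exists_toPair_of_mem_LM hγ
    rw [funext (hamForm_toPair n L _), P₂_toPair, P2A_ham n hL, flow_toPair, ← toPair_smul]
    simp

theorem hamiltonianFlow_P₂_flowBar (n : ℕ) : HamiltonianFlow P₂ 1 (hamBar n) (flowBar (n + 1)) :=
  hamiltonianFlow_of_eq isPoisson_P₂ 1 (hamBar_local n).2 fun γ hγ => by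
    obtain ⟨L, hL, rfl⟩ := exists_toPair_of_mem_LM hγ
    rw [funext (hamBarForm_toPair n L _), P₂_toPair, P2A_hamBar n hL, flowBar_toPair, one_smul]

end Hamiltonians

end Toda

end

theorem mainTheorem7 :
    -- local functionals have differentials, so the brackets below apply to all of them
    (∀ F, Toda.LocalFunctional F → Toda.Admissible F) ∧
    -- a compatible pair of Poisson structures
    Toda.IsPoisson Toda.P₁ ∧ Toda.IsPoisson Toda.P₂ ∧ Toda.Compatible Toda.P₁ Toda.P₂ ∧
    -- the Hamiltonians are local functionals
    (∀ n : ℕ, Toda.LocalFunctional (Toda.ham n) ∧ Toda.LocalFunctional (Toda.hamBar n)) ∧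
    -- the Toda flows are Hamiltonian for both structures
    ∀ n : ℕ, 1 ≤ n →
      Toda.HamiltonianFlow Toda.P₁ 1 (Toda.ham n) (Toda.flow n) ∧
      Toda.HamiltonianFlow Toda.P₂ (-1) (Toda.ham (n - 1)) (Toda.flow n) ∧
      Toda.HamiltonianFlow Toda.P₁ 1 (Toda.hamBar n) (Toda.flowBar n) ∧
      Toda.HamiltonianFlow Toda.P₂ 1 (Toda.hamBar (n - 1)) (Toda.flowBar n) := by
  refine ⟨fun F hF => hF.admissible, Toda.isPoisson_P₁, Toda.isPoisson_P₂, Toda.compatible_P₁_P₂,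
    fun n => ⟨(Toda.ham_local n).1, (Toda.hamBar_local n).1⟩, fun n hn => ?_⟩
  obtain ⟨m, rfl⟩ : ∃ m, n = m + 1 := ⟨n - 1, by omega⟩
  exact ⟨Toda.hamiltonianFlow_P₁_flow _, Toda.hamiltonianFlow_P₂_flow m,
    Toda.hamiltonianFlow_P₁_flowBar _, Toda.hamiltonianFlow_P₂_flowBar m⟩
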